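/- For an integral scheme $Y$, let $\mathrm{Pic}(Y)$ be the group of Cartier divisors on $Y$ modulo linear equivalence, and for a Cartier divisor $D$ let $H^0(Y,D)$ be the group of rational functions $f$ on $Y$ such that $f g_y$ is regular at $y$ for every $y\in Y$, where $g_y$ is a local equation of $D$ at $y$; a nonzero $f\in H^0(Y,D)$ has divisor of zeros $D+\mathrm{div}(f)$. If the Cartier divisors $D_1,\dots,D_r$ freely generate $\mathrm{Pic}(Y)$, the Cox ring of $Y$ (with respect to $D_1,\dots,D_r$) is the $\mathbb{Z}^r$-graded ring $$\mathrm{Cox}(Y)=\bigoplus_{(m_1,\dots,m_r)\in\mathbb{Z}^r}H^0(Y,\,m_1D_1+\dots+m_rD_r),$$ whose multiplication is induced by that of rational functions. **Proposition.** Let $X'$ be a projective variety (an integral projective scheme) over $\mathbb{C}$ with $\dim X'\ge 2$, let $p\in X'$ be a smooth closed point, and let $\pi\colon X\to X'$ be the blow-up of $p$, with exceptional divisor $E\subset X$ (the effective Cartier divisor defined by the ideal sheaf $\pi^{-1}\mathfrak{m}_p\cdot\mathcal{O}_X$). Let $D'_1,\dots,D'_{r'}$ be divisors that freely generate $\mathrm{Pic}(X')$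 and $D_1,\dots,D_r$ divisors that freely generate $\mathrm{Pic}(X)$, and form $\mathrm{Cox}(X')$ and $\mathrm{Cox}(X)$ with respect to them. Let $x_E\in H^0(X,m_1D_1+\dots+m_rD_r)\subset\mathrm{Cox}(X)$ be a section corresponding to $E$, that is, a nonzero homogeneous element whose divisor of zeros is $E$. Then there is an isomorphism of rings $$\mathrm{Cox}(X)_{x_E}\;\cong\;\mathrm{Cox}(X')[T,T^{-1}].$$ -/

import Mathlib

open AlgebraicGeometry CategoryTheory

noncomputable section

namespace CoxRing

universe u

/-! ### Projective varieties over `ℂ` and their smooth points -/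

/-- The grading of `ℂ[x₀, …, xₙ]` by degree. -/
instance (n : ℕ) : GradedRing (MvPolynomial.homogeneousSubmodule (Fin (n + 1)) ℂ) :=
  MvPolynomial.gradedAlgebra

/-- Projective `n`-space over `ℂ`, as `Proj ℂ[x₀, …, xₙ]`. -/
def ProjSpace (n : ℕ) : Scheme.{0} :=
  Proj (MvPolynomial.homogeneousSubmodule (Fin (n + 1)) ℂ)

/-- The structure morphism of projective space. -/
def ProjSpace.toSpec (n : ℕ) : ProjSpace n ⟶ Spec (.of ℂ) :=
  Proj.toSpecZero (MvPolynomial.homogeneousSubmodule (Fin (n + 1)) ℂ) ≫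
    Spec.map (CommRingCat.ofHom
      (algebraMap ℂ (MvPolynomial.homogeneousSubmodule (Fin (n + 1)) ℂ 0)))

/-- A scheme over `ℂ` is projective if it is isomorphic, over `ℂ`, to a closed subscheme of a
projective space. -/
def IsProjective {X : Scheme.{0}} (s : X ⟶ Spec (.of ℂ)) : Prop :=
  ∃ (n : ℕ) (i : X ⟶ ProjSpace n), IsClosedImmersion i ∧ i ≫ ProjSpace.toSpec n = s

/-- A smooth (that is, nonsingular) point of a complex variety: a closed point whose local
ring `R` is regular, i.e. `dim 𝔪/𝔪² = dim R`. -/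
structure IsSmoothPoint (X : Scheme.{u}) (p : X) : Prop where
  isClosed : IsClosed ({p} : Set X)
  isRegular : IsRegularLocalRing (X.presheaf.stalk p)

/-! ### Cartier divisors on an integral scheme -/

section Divisors

variable (X : Scheme.{u}) [IsIntegral X]

/-- The function field `K(X)` (a type synonym for Mathlib's, so that it carries a single ring
structure, the one underlying its field structure). -/
def FunField : Type u := X.functionField

instance : Field (FunField X) := inferInstanceAs (Field X.functionField)

/-- The inclusion of the local ring `𝒪_{X,x}` into `K(X)`. -/
instance (x : X) : Algebra (X.presheaf.stalk x) (FunField X) :=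
  inferInstanceAs (Algebra (X.presheaf.stalk x) X.functionField)

/-- The units of the local ring `𝒪_{X,x}`, as a subgroup of `K(X)ˣ`. -/
def unitsAt (x : X) : Subgroup (FunField X)ˣ :=
  (Units.map (algebraMap (X.presheaf.stalk x) (FunField X)).toMonoidHom).range

/-- Global sections of the sheaf `K(X)ˣ / 𝒪_Xˣ`: families of elements of the stalks
`K(X)ˣ / 𝒪_{X,x}ˣ` that are locally induced by one rational function. -/
def cartierSubgroup : Subgroup (∀ x : X, (FunField X)ˣ ⧸ unitsAt X x) where
  carrier := {D | ∀ x : X, ∃ U : X.Opens, x ∈ U ∧ ∃ g : (FunField X)ˣ,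
    ∀ y ∈ U, D y = QuotientGroup.mk g}
  one_mem' x := ⟨⊤, trivial, 1, fun _ _ => rfl⟩
  mul_mem' {D D'} hD hD' x := by
    obtain ⟨U, hxU, g, hg⟩ := hD x
    obtain ⟨V, hxV, h, hh⟩ := hD' x
    exact ⟨U ⊓ V, ⟨hxU, hxV⟩, g * h, fun y hy => by
      rw [Pi.mul_apply, hg y hy.1, hh y hy.2]; rfl⟩
  inv_mem' {D} hD x := by
    obtain ⟨U, hxU, g, hg⟩ := hD x
    exact ⟨U, hxU, g⁻¹, fun y hy => by rw [Pi.inv_apply, hg y hy]; rfl⟩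

/-- The group of Cartier divisors, written additively. -/
def CaDiv : Type u := Additive (cartierSubgroup X)

instance : AddCommGroup (CaDiv X) := inferInstanceAs (AddCommGroup (Additive (cartierSubgroup X)))

variable {X}

/-- The class in `K(X)ˣ / 𝒪_{X,x}ˣ` of the local equations of a Cartier divisor at `x`. -/
def CaDiv.germ (D : CaDiv X) (x : X) : (FunField X)ˣ ⧸ unitsAt X x :=
  (Additive.toMul (α := cartierSubgroup X) D).1 x

theorem CaDiv.germ_zero (x : X) : (0 : CaDiv X).germ x = 1 := rfl

theorem CaDiv.germ_add (D D' : CaDiv X) (x : X) : (D + D').germ x = D.germ x * D'.germ x := rfl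

/-- `g` is a local equation of the Cartier divisor `D` at the point `x`. -/
def IsLocalEq (D : CaDiv X) (x : X) (g : (FunField X)ˣ) : Prop :=
  D.germ x = QuotientGroup.mk g

variable (X)

/-- The principal divisor of a nonzero rational function. -/
def principal : Additive (FunField X)ˣ →+ CaDiv X where
  toFun f := Additive.ofMul (α := cartierSubgroup X)
    ⟨fun _ => QuotientGroup.mk f.toMul, fun _ => ⟨⊤, trivial, f.toMul, fun _ _ => rfl⟩⟩
  map_zero' := rfl
  map_add' _ _ := rfl

/-- The Picard group, as the group of Cartier divisors modulo linear equivalence. -/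
abbrev Pic : Type u := CaDiv X ⧸ (principal X).range

variable {X}

/-- The divisors `D₁, …, D_r` freely generate the Picard group. -/
def FreelyGeneratesPic {r : ℕ} (D : Fin r → CaDiv X) : Prop :=
  LinearIndependent ℤ (fun i => (QuotientAddGroup.mk (D i) : Pic X)) ∧
    Submodule.span ℤ (Set.range fun i => (QuotientAddGroup.mk (D i) : Pic X)) = ⊤

/-- `H⁰(X, D)`: the rational functions `f` such that `f g` is regular at `x` for every point `x`
and every local equation `g` of `D` at `x`. -/
def H0 (D : CaDiv X) : AddSubgroup (FunField X) where
  carrier := {f | ∀ (x : X) (g : (FunField X)ˣ), IsLocalEq D x g →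
    f * g ∈ (algebraMap (X.presheaf.stalk x) (FunField X)).range}
  zero_mem' x g _ := by rw [zero_mul]; exact zero_mem _
  add_mem' ha hb x g hg := by rw [add_mul]; exact add_mem (ha x g hg) (hb x g hg)
  neg_mem' ha x g hg := by rw [neg_mul]; exact neg_mem (ha x g hg)

/-- The divisor of zeros of a nonzero section `s ∈ H⁰(X, D)`, namely `D + div(s)`, equals `E`. -/
def HasZeroDivisor {D : CaDiv X} (s : H0 D) (E : CaDiv X) : Prop :=
  ∃ f : (FunField X)ˣ, (f : FunField X) = s ∧ D + principal X (Additive.ofMul f) = E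

/-! ### Cox rings -/

theorem one_mem_H0_zero : (1 : FunField X) ∈ H0 (0 : CaDiv X) := by
  intro x g hg
  have hg' : (QuotientGroup.mk 1 : (FunField X)ˣ ⧸ unitsAt X x) = QuotientGroup.mk g := hg
  rw [QuotientGroup.eq, inv_one, one_mul] at hg'
  obtain ⟨v, rfl⟩ := hg'
  exact ⟨v, by simp⟩

theorem mul_mem_H0_add {D D' : CaDiv X} {f f' : FunField X} (hf : f ∈ H0 D)
    (hf' : f' ∈ H0 D') : f * f' ∈ H0 (D + D') := by
  intro x g hg
  obtain ⟨h, hh⟩ := QuotientGroup.mk_surjective (D.germ x)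
  have hh' : IsLocalEq D' x (h⁻¹ * g) := by
    have : D.germ x * D'.germ x = QuotientGroup.mk g := hg
    rw [← hh] at this
    exact eq_inv_mul_of_mul_eq this
  have e : f * f' * g = (f * h) * (f' * (h⁻¹ * g : (FunField X)ˣ)) := by
    have : (h : FunField X) * ((h⁻¹ * g : (FunField X)ˣ) : FunField X) = g := by
      rw [← Units.val_mul, mul_inv_cancel_left]
    rw [mul_mul_mul_comm, this]
  rw [e]
  exact mul_mem (hf x h hh.symm) (hf' x _ hh')

/-- The graded piece `H⁰(X, m₁D₁ + … + m_rD_r)` of the Cox ring. -/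
def coxPiece {r : ℕ} (D : Fin r → CaDiv X) (m : Fin r → ℤ) : AddSubgroup (FunField X) :=
  H0 (∑ i, m i • D i)

instance {r : ℕ} (D : Fin r → CaDiv X) : SetLike.GradedMonoid (coxPiece D) where
  one_mem := by simpa [coxPiece] using one_mem_H0_zero
  mul_mem m n f f' hf hf' := by
    have := mul_mem_H0_add hf hf'
    simpa only [coxPiece, Pi.add_apply, add_smul, Finset.sum_add_distrib] using this

/-- The Cox ring `⨁_{m ∈ ℤʳ} H⁰(X, m₁D₁ + … + m_rD_r)` with respect to divisors `D₁, …, D_r`,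
multiplied as rational functions. -/
abbrev Cox {r : ℕ} (D : Fin r → CaDiv X) : Type u :=
  DirectSum (Fin r → ℤ) fun m => coxPiece D m

/-- A section of `m₁D₁ + … + m_rD_r`, as a homogeneous element of the Cox ring. -/
def Cox.ofSection {r : ℕ} (D : Fin r → CaDiv X) (m : Fin r → ℤ)
    (s : H0 (∑ i, m i • D i)) : Cox D :=
  DirectSum.of (fun m => coxPiece D m) m s

end Divisors

/-! ### Blow-ups -/

/-- An ideal sheaf is invertible (the ideal sheaf of an effective Cartier divisor) if it is
locally generated by a nonzerodivisor. -/
def IsInvertibleIdeal {X : Scheme.{u}} (I : X.IdealSheafData) : Prop :=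
  ∀ x : X, ∃ U : X.affineOpens, x ∈ U.1 ∧
    ∃ g ∈ nonZeroDivisors Γ(X, U), I.ideal U = Ideal.span {g}

/-- `π : X ⟶ Y` is the blow-up of `Y` along the ideal sheaf `I`: the inverse image ideal sheaf
`π⁻¹I · 𝒪_X` is invertible, and `π` is universal with this property. -/
structure IsBlowUp {X Y : Scheme.{u}} (I : Y.IdealSheafData) (π : X ⟶ Y) : Prop where
  isInvertible : IsInvertibleIdeal (I.comap π)
  existsUnique_lift : ∀ (T : Scheme.{u}) (f : T ⟶ Y), IsInvertibleIdeal (I.comap f) →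
    ∃! g : T ⟶ X, g ≫ π = f

/-- The ideal sheaf of a closed point with its reduced structure. -/
def pointIdeal {X : Scheme.{u}} (p : X) (hp : IsClosed ({p} : Set X)) : X.IdealSheafData :=
  Scheme.IdealSheafData.vanishingIdeal ⟨{p}, hp⟩

section

variable {X : Scheme.{u}} [IsIntegral X]

/-- The element of the function field given by a section over an open neighbourhood of `x`. -/
def toFunField {U : X.Opens} {x : X} (hx : x ∈ U) (g : Γ(X, U)) : FunField X :=
  algebraMap (X.presheaf.stalk x) (FunField X) (X.presheaf.germ U x hx g)

theorem toFunField_eq {U : X.Opens} {x y : X} (hx : x ∈ U) (hy : y ∈ U) (g : Γ(X, U)) :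
    toFunField hx g = toFunField hy g := by
  have : Nonempty U := ⟨⟨x, hx⟩⟩
  exact (Scheme.algebraMap_germ_eq_germToFunctionField X hx g).trans
    (Scheme.algebraMap_germ_eq_germToFunctionField X hy g).symm

theorem toFunField_ne_zero {U : X.Opens} {x : X} (hx : x ∈ U) {g : Γ(X, U)}
    (hg : g ∈ nonZeroDivisors Γ(X, U)) : toFunField hx g ≠ 0 := by
  have : Nonempty U := ⟨⟨x, hx⟩⟩
  have hg0 : g ≠ 0 := nonZeroDivisors.ne_zero hg
  intro h
  refine hg0 (X.germToFunctionField_injective U ?_)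
  rw [map_zero]
  exact (Scheme.algebraMap_germ_eq_germToFunctionField X hx g).symm.trans h

/-- `f` is, in `K(X)`, a generator of the ideal sheaf `I` over an affine neighbourhood of `x`. -/
def IsLocalGenerator (I : X.IdealSheafData) (x : X) (f : (FunField X)ˣ) : Prop :=
  ∃ (U : X.affineOpens) (hx : x ∈ U.1) (g : Γ(X, U)),
    I.ideal U = Ideal.span {g} ∧ (f : FunField X) = toFunField hx g

theorem exists_isLocalGenerator {I : X.IdealSheafData} (hI : IsInvertibleIdeal I) (x : X) :
    ∃ f, IsLocalGenerator I x f := by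
  obtain ⟨U, hx, g, hg, h⟩ := hI x
  exact ⟨Units.mk0 _ (toFunField_ne_zero hx hg), U, hx, g, h, rfl⟩

/-- Two local generators of an ideal sheaf at `x` differ by a unit of `𝒪_{X,x}`. -/
theorem IsLocalGenerator.mk_eq {I : X.IdealSheafData} {x : X} {f f' : (FunField X)ˣ}
    (hf : IsLocalGenerator I x f) (hf' : IsLocalGenerator I x f') :
    (QuotientGroup.mk f : (FunField X)ˣ ⧸ unitsAt X x) = QuotientGroup.mk f' := by
  obtain ⟨U, hU, g, hg, e⟩ := hf
  obtain ⟨V, hV, g', hg', e'⟩ := hf'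
  obtain ⟨_, ⟨W, hW, rfl⟩, hxW, hWUV⟩ := X.isBasis_affineOpens.exists_subset_of_mem_open
    (show x ∈ ((U.1 ⊓ V.1 : X.Opens) : Set X) from ⟨hU, hV⟩) (U.1 ⊓ V.1).isOpen
  have hWU : (⟨W, hW⟩ : X.affineOpens) ≤ U := fun y hy => (hWUV hy).1
  have hWV : (⟨W, hW⟩ : X.affineOpens) ≤ V := fun y hy => (hWUV hy).2
  have key : ∀ (A : X.affineOpens) (hA : x ∈ A.1) (h : (⟨W, hW⟩ : X.affineOpens) ≤ A)
      (a : Γ(X, A)), I.ideal A = Ideal.span {a} →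
      (I.ideal ⟨W, hW⟩).map (X.presheaf.germ W x hxW).hom =
        Ideal.span {X.presheaf.germ A.1 x hA a} := by
    intro A hA h a ha
    rw [← I.map_ideal h, ha, Ideal.map_map, Ideal.map_span, Set.image_singleton]
    congr 2
    exact X.presheaf.germ_res_apply (homOfLE h) x hxW a
  have hs := (key U hU hWU g hg).symm.trans (key V hV hWV g' hg')
  obtain ⟨v, hv⟩ := Ideal.span_singleton_eq_span_singleton.mp hs
  rw [QuotientGroup.eq]
  refine ⟨v, ?_⟩
  rw [eq_inv_mul_iff_mul_eq]
  ext
  rw [Units.val_mul, e, e', toFunField, toFunField, ← hv, map_mul]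
  rfl

/-- The effective Cartier divisor defined by an invertible ideal sheaf: its local equations are
the local generators of the ideal sheaf. -/
def divisorOfIdeal (I : X.IdealSheafData) (hI : IsInvertibleIdeal I) : CaDiv X :=
  Additive.ofMul (α := cartierSubgroup X)
    ⟨fun x => QuotientGroup.mk (exists_isLocalGenerator hI x).choose, fun x => by
      obtain ⟨U, hx, g, hg, h⟩ := hI x
      refine ⟨U.1, hx, Units.mk0 _ (toFunField_ne_zero hx hg), fun y hy => ?_⟩
      exact (exists_isLocalGenerator hI y).choose_spec.mk_eq
        ⟨U, hy, g, h, toFunField_eq hx hy g⟩⟩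

/-- The exceptional divisor of a blow-up, defined by the ideal sheaf `π⁻¹I · 𝒪_X`. -/
def exceptionalDivisor {Y : Scheme.{u}} {I : Y.IdealSheafData} {π : X ⟶ Y}
    (h : IsBlowUp I π) : CaDiv X :=
  divisorOfIdeal (I.comap π) h.isInvertible

end

end CoxRing

end

/-! Both varieties have the same function field, and every Cartier divisor on X is in a unique way
π^*D' + kE, with D' a divisor on X' and k an integer. A section of π^*D' + kE is a section of D'
away from p, hence everywhere because the local ring at p is regular of dimension at least two.
Conversely, if k ≥ 0, every section of D' is a section of π^*D' + kE, since E is effective. After a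
regrading, and a twist by rational functions that absorbs linear equivalence, Cox(X) is therefore a
subring of Cox(X')[T, T⁻¹] that contains Cox(X')[T], the exponent of T being k. The section x_E goes
to T times a unit of degree 0, so inverting it yields all Laurent polynomials
(`nonempty_localizationAway_equiv`).

Two local inputs carry this.

Across p, functions and invertible sheaves extend from the punctured spectrum. For functions one
divides by a prime parameter. For sheaves, the sections over the locus where that parameter is
invertible form a projective module with a finite free resolution; it is stably free, so principal
by a determinant argument. The trivialization is then corrected by a power of the parameter
(`IsRegularSystem.exists_mul_mem_localUnits`).

Over p, the blow-up is known only through its universal property. The 𝔪-adic order is a valuation,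
because the associated graded ring is a polynomial ring. A local subring of a local ring of X over p
in which 𝔪 becomes principal is the whole ring (`IsBlowUp.subring_eq_top`). Applied to the fractions
y/z with y, z in 𝔪ⁱ and z generating 𝔪ⁱ upstairs, this shows that a local equation of E divides
every function of positive order. Hence a divisor that is trivial off E is a multiple of E
(`IsBlowUpModel.exists_eq_zsmul`). -/

noncomputable section

/-! ### Regular systems of parameters -/

section RegularSystem

open IsLocalRing MvPolynomial

/-- A finite sequence of `dim A` elements generating the maximal ideal of the local ring `A`. -/
structure IsRegularSystem {A : Type*} [CommRing A] [IsLocalRing A] {n : ℕ} (x : Fin n → A) :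
    Prop where
  span_eq : Ideal.span (Set.range x) = maximalIdeal A
  le_dim : (n : WithBot ℕ∞) ≤ ringKrullDim A

theorem IsRegularLocalRing.exists_isRegularSystem (A : Type*) [CommRing A]
    [IsRegularLocalRing A] : ∃ (n : ℕ) (x : Fin n → A), IsRegularSystem x := by
  have hfg := (maximalIdeal A).fg_of_isNoetherianRing
  have hfin := Submodule.FG.finite_generators hfg
  have hc := Submodule.FG.generators_ncard hfg
  let e := hfin.equivFinOfCardEq (n := (maximalIdeal A).spanFinrank) (by simpa using hc)
  refine ⟨_, fun i => (e.symm i : A), ?_, ?_⟩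
  · have : Set.range (fun i => (e.symm i : A)) = (maximalIdeal A).generators := by
      rw [show (fun i => (e.symm i : A)) = Subtype.val ∘ e.symm from rfl, Set.range_comp]
      simp
    rw [this]
    exact (maximalIdeal A).span_generators
  · rw [← IsRegularLocalRing.spanFinrank_maximalIdeal]

variable {A : Type*} [CommRing A] [IsLocalRing A] {n : ℕ} {x : Fin n → A}

theorem MvPolynomial.IsHomogeneous.eval_mul_left {R σ : Type*} [CommSemiring R]
    {F : MvPolynomial σ R} {d : ℕ} (hF : F.IsHomogeneous d) (t : R) (c : σ → R) :
    eval (fun i => t * c i) F = t ^ d * eval c F := by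
  rw [eval_eq, eval_eq, Finset.mul_sum]
  refine Finset.sum_congr rfl fun m hm => ?_
  have : ∑ i ∈ m.support, m i = d := by
    have := hF (mem_support_iff.mp hm)
    simpa [Finsupp.weight_apply, Finsupp.sum] using this
  simp_rw [mul_pow]
  rw [Finset.prod_mul_distrib, Finset.prod_pow_eq_pow_sum, this]
  ring

/-- Krull's height theorem: the maximal ideal would be minimal over fewer than `n` elements, while
its height is at least `n`. -/
theorem IsRegularSystem.not_pow_le_span [IsNoetherianRing A] (hx : IsRegularSystem x)
    {s : Finset A} (hs : s.card < n) {d : ℕ} (hsm : Ideal.span (s : Set A) ≤ maximalIdeal A)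
    (h : maximalIdeal A ^ d ≤ Ideal.span (s : Set A)) : False := by
  have hmin : maximalIdeal A ∈ (Ideal.span (s : Set A)).minimalPrimes := by
    refine ⟨⟨inferInstance, hsm⟩, fun q ⟨hq, hsq⟩ _ => ?_⟩
    exact Ideal.IsPrime.le_of_pow_le (h.trans hsq)
  have h1 := Ideal.height_le_card_of_mem_minimalPrimes_span_finset hmin
  have h2 := hx.le_dim
  rw [← maximalIdeal_height_eq_ringKrullDim] at h2
  have h3 : (n : ℕ∞) ≤ (maximalIdeal A).height := by exact_mod_cast h2
  have h4 : (n : ℕ∞) ≤ (s.card : ℕ∞) := h3.trans h1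
  exact absurd (by exact_mod_cast h4) (not_le.mpr hs)

/-- A regular system of parameters is quasi-regular. -/
theorem IsRegularSystem.coeff_mem [IsNoetherianRing A] [Infinite (ResidueField A)]
    (hx : IsRegularSystem x) {F : MvPolynomial (Fin n) A} {d : ℕ} (hF : F.IsHomogeneous d)
    (h : eval x F ∈ maximalIdeal A ^ (d + 1)) : MvPolynomial.map (residue A) F = 0 := by
  by_contra hne
  -- A nonzero form over an infinite field has a point where it does not vanish.
  obtain ⟨cb, hcb⟩ : ∃ c, eval c (MvPolynomial.map (residue A) F) ≠ 0 := by
    by_contra! hc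
    exact hne ((hF.map _).eq_zero_of_forall_eval_eq_zero hc)
  choose c hc using fun i => residue_surjective (cb i)
  have hFc : IsUnit (eval c F) := by
    rw [← residue_ne_zero_iff_isUnit]
    have : residue A (eval c F) = eval cb (MvPolynomial.map (residue A) F) := by
      rw [MvPolynomial.eval_map, show cb = residue A ∘ c from (funext hc).symm, ← eval₂_comp]
    rwa [this]
  by_cases hj : ∃ j, IsUnit (c j)
  · obtain ⟨j, u, hu⟩ := hj
    classical
    -- Modulo these at most `n - 1` elements the point `x` is the multiple `u⁻¹ x j` of the point
    -- `c`. So `F(x)` becomes `(u⁻¹ x j) ^ d * F(c)`, with `F(c)` a unit, and the maximal ideal is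
    -- generated by `x j`. The hypothesis then forces `x j ^ d = 0` in the quotient, against the
    -- height bound.
    let s : Finset A := (Finset.univ.erase j).image fun i => x i - c i * (↑u⁻¹ * x j)
    let b : Ideal A := Ideal.span (s : Set A)
    let q := Ideal.Quotient.mk b
    have hxm : ∀ i, x i ∈ maximalIdeal A := fun i => hx.span_eq ▸ Ideal.subset_span ⟨i, rfl⟩
    have hsm : b ≤ maximalIdeal A := by
      rw [Ideal.span_le]
      intro y hy
      obtain ⟨i, -, rfl⟩ := Finset.mem_image.mp hy
      exact sub_mem (hxm i) (Ideal.mul_mem_left _ _ (Ideal.mul_mem_left _ _ (hxm j)))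
    have hq : ∀ i, q (x i) = q (↑u⁻¹ * x j) * q (c i) := by
      intro i
      rw [mul_comm, ← map_mul, Ideal.Quotient.eq]
      by_cases hij : i = j
      · subst hij
        rw [← hu, Units.mul_inv_cancel_left, sub_self]
        exact zero_mem _
      · exact Ideal.subset_span (Finset.mem_image.mpr ⟨i, by simp [hij], rfl⟩)
    have hev : q (eval x F) = q (↑u⁻¹ * x j) ^ d * q (eval c F) := by
      have e1 : ∀ y : Fin n → A, q (eval y F) = eval (fun i => q (y i)) (MvPolynomial.map q F) := by
        intro y
        rw [MvPolynomial.eval_map, show (fun i => q (y i)) = q ∘ y from rfl, ← eval₂_comp]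
      rw [e1, e1, ← (hF.map q).eval_mul_left]
      congr 2
      funext i
      exact hq i
    have hmap : (maximalIdeal A).map q = Ideal.span {q (x j)} := by
      rw [← hx.span_eq, Ideal.map_span]
      refine le_antisymm (Ideal.span_le.mpr ?_) (Ideal.span_le.mpr ?_)
      · rintro _ ⟨_, ⟨i, rfl⟩, rfl⟩
        rw [hq i, map_mul, SetLike.mem_coe, Ideal.mem_span_singleton]
        exact ⟨q ↑u⁻¹ * q (c i), by ring⟩
      · rintro _ rfl
        exact Ideal.subset_span ⟨x j, ⟨j, rfl⟩, rfl⟩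
    have h1 : q (eval x F) ∈ Ideal.span {q (x j) ^ (d + 1)} := by
      rw [← Ideal.span_singleton_pow, ← hmap, ← Ideal.map_pow]
      exact Ideal.mem_map_of_mem _ h
    obtain ⟨r, hr⟩ := Ideal.mem_span_singleton.mp h1
    obtain ⟨r, rfl⟩ := Ideal.Quotient.mk_surjective r
    rw [hev] at hr
    obtain ⟨w, hw⟩ := hFc
    have h2 : q (x j) ^ d * q ((↑u⁻¹) ^ d * ↑w - x j * r) = 0 := by
      rw [← hw, map_mul, mul_pow] at hr
      simp only [map_sub, map_mul, map_pow]
      linear_combination hr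
    have hun : IsUnit ((↑u⁻¹ : A) ^ d * ↑w - x j * r) := by
      have : IsUnit ((↑u⁻¹ : A) ^ d * ↑w) := (u⁻¹.isUnit.pow d).mul w.isUnit
      by_contra hcon
      have h5 : (↑u⁻¹ : A) ^ d * ↑w ∈ maximalIdeal A := by
        have := add_mem ((mem_maximalIdeal _).mpr hcon)
          (Ideal.mul_mem_right r _ (hxm j))
        simpa using this
      exact (mem_maximalIdeal _).mp h5 this
    have h3 : q (x j) ^ d = 0 := ((hun.map q).mul_left_eq_zero).mp h2
    refine hx.not_pow_le_span (s := s) (d := d) ?_ hsm ?_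
    · refine (Finset.card_image_le).trans_lt ?_
      rw [Finset.card_erase_of_mem (Finset.mem_univ j), Finset.card_univ, Fintype.card_fin]
      have := j.pos
      omega
    · have : (maximalIdeal A ^ d).map q = ⊥ := by
        rw [Ideal.map_pow, hmap, Ideal.span_singleton_pow, h3, Ideal.span_singleton_eq_bot]
      rw [Ideal.map_eq_bot_iff_le_ker, Ideal.mk_ker] at this
      exact this
  -- Here the chosen point is the origin of the residue field, so the form must be a constant, and
  -- that constant is both a unit and a member of the maximal ideal.
  · push Not at hj
    have hd : d = 0 := by
      by_contra hd
      have h0 : eval cb (MvPolynomial.map (residue A) F) = 0 := by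
        have : cb = fun i => (0 : ResidueField A) * cb i := by
          funext i
          rw [zero_mul, ← hc i, residue_eq_zero_iff]
          exact hj i
        rw [this, (hF.map _).eval_mul_left, zero_pow hd, zero_mul]
      exact hcb h0
    subst hd
    have h0 := hF.eval_mul_left 0 c
    have h1 := hF.eval_mul_left 0 x
    simp only [zero_mul, pow_zero, one_mul] at h0 h1
    rw [zero_add, pow_one, ← h1, h0] at h
    exact (mem_maximalIdeal _).mp h hFc

/-- By quasi-regularity the leading forms live in a polynomial ring over the residue field, a
domain. A form of degree `i` whose coefficients all lie in the maximal ideal takes a value in the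
next power, so exact order means nonzero reduction. -/
theorem IsRegularSystem.mul_notMem_pow [IsNoetherianRing A] [Infinite (ResidueField A)]
    (hx : IsRegularSystem x) {i j : ℕ} {y z : A} (hy : y ∈ maximalIdeal A ^ i)
    (hy' : y ∉ maximalIdeal A ^ (i + 1)) (hz : z ∈ maximalIdeal A ^ j)
    (hz' : z ∉ maximalIdeal A ^ (j + 1)) : y * z ∉ maximalIdeal A ^ (i + j + 1) := by
  have key : ∀ {i : ℕ} {y : A}, y ∈ maximalIdeal A ^ i → y ∉ maximalIdeal A ^ (i + 1) →
      ∃ F : MvPolynomial (Fin n) A, F.IsHomogeneous i ∧ eval x F = y ∧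
        MvPolynomial.map (residue A) F ≠ 0 := by
    intro i y hy hy'
    rw [← hx.span_eq, Ideal.mem_span_pow_iff_exists_isHomogeneous] at hy
    obtain ⟨F, hF, rfl⟩ := hy
    refine ⟨F, hF, rfl, fun h0 => hy' ?_⟩
    rw [eval_eq]
    refine sum_mem fun m hm => ?_
    rw [pow_succ']
    refine Ideal.mul_mem_mul ?_ ?_
    · rw [← residue_eq_zero_iff, ← coeff_map, h0, coeff_zero]
    · have : ∑ i ∈ m.support, m i = i := by
        have := hF (mem_support_iff.mp hm)
        simpa [Finsupp.weight_apply, Finsupp.sum] using this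
      rw [← this, ← Finset.prod_pow_eq_pow_sum]
      refine Ideal.prod_mem_prod fun i _ => Ideal.pow_mem_pow ?_ _
      exact hx.span_eq ▸ Ideal.subset_span ⟨i, rfl⟩
  obtain ⟨F, hF, rfl, hF0⟩ := key hy hy'
  obtain ⟨G, hG, rfl, hG0⟩ := key hz hz'
  intro hmem
  rw [← map_mul] at hmem
  have := hx.coeff_mem (hF.mul hG) hmem
  rw [map_mul] at this
  exact (mul_ne_zero hF0 hG0) this

/-- Krull's intersection theorem gives every nonzero element a finite order. -/
theorem exists_mem_pow_notMem_pow_succ [IsNoetherianRing A] {y : A} (hy : y ≠ 0) :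
    ∃ i, y ∈ maximalIdeal A ^ i ∧ y ∉ maximalIdeal A ^ (i + 1) := by
  by_contra! h
  refine hy ?_
  have h1 : ∀ i, y ∈ maximalIdeal A ^ i := by
    intro i
    induction i with
    | zero => simp
    | succ k ih => exact h k ih
  have h2 : y ∈ ⨅ i, maximalIdeal A ^ i := by simpa [Submodule.mem_iInf] using h1
  rwa [Ideal.iInf_pow_eq_bot_of_isLocalRing _ (maximalIdeal.isMaximal A).ne_top] at h2

theorem IsRegularSystem.isDomain [IsNoetherianRing A] [Infinite (ResidueField A)]
    (hx : IsRegularSystem x) : IsDomain A := by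
  have : NoZeroDivisors A := by
    refine ⟨fun {a b} hab => ?_⟩
    by_contra! h
    obtain ⟨i, hi, hi'⟩ := exists_mem_pow_notMem_pow_succ h.1
    obtain ⟨j, hj, hj'⟩ := exists_mem_pow_notMem_pow_succ h.2
    exact hx.mul_notMem_pow hi hi' hj hj' (hab ▸ zero_mem _)
  exact NoZeroDivisors.to_isDomain A

open WithZero in
/-- The order of vanishing at the closed point is a valuation of a regular local ring. -/
theorem IsRegularSystem.exists_valuation [IsNoetherianRing A] [Infinite (ResidueField A)]
    (hx : IsRegularSystem x) : ∃ v : Valuation A (WithZero (Multiplicative ℤ)),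
      ∀ (y : A) (i : ℕ), v y ≤ exp (-(i : ℤ)) ↔ y ∈ maximalIdeal A ^ i := by
  classical
  have := hx.isDomain
  choose o ho ho' using fun (y : A) (hy : y ≠ 0) => exists_mem_pow_notMem_pow_succ hy
  have hmem : ∀ (y : A) (hy : y ≠ 0) (i : ℕ), i ≤ o y hy ↔ y ∈ maximalIdeal A ^ i := by
    intro y hy i
    refine ⟨fun h => Ideal.pow_le_pow_right h (ho y hy), fun h => ?_⟩
    by_contra! hlt
    exact ho' y hy (Ideal.pow_le_pow_right hlt h)
  let f : A → WithZero (Multiplicative ℤ) := fun y =>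
    if hy : y = 0 then 0 else exp (-(o y hy : ℤ))
  have hf : ∀ (y : A) (i : ℕ), f y ≤ exp (-(i : ℤ)) ↔ y ∈ maximalIdeal A ^ i := by
    intro y i
    by_cases hy : y = 0
    · simp [f, hy]
    · rw [← hmem y hy]
      simp only [f, hy, dite_false, exp_le_exp]
      omega
  have hf' : ∀ y : A, y ≠ 0 → ∃ i : ℕ, f y = exp (-(i : ℤ)) ∧ y ∈ maximalIdeal A ^ i ∧
      y ∉ maximalIdeal A ^ (i + 1) := fun y hy => ⟨o y hy, by simp [f, hy], ho y hy, ho' y hy⟩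
  have heq : ∀ (y : A) (i : ℕ), y ∈ maximalIdeal A ^ i → y ∉ maximalIdeal A ^ (i + 1) →
      f y = exp (-(i : ℤ)) := by
    intro y i h h'
    have hy : y ≠ 0 := by rintro rfl; exact h' (zero_mem _)
    rw [← hmem y hy] at h h'
    simp only [f, hy, dite_false]
    congr 2
    omega
  refine ⟨⟨⟨⟨f, by simp [f]⟩, ?_, ?_⟩, ?_⟩, hf⟩
  · refine (heq 1 0 (by simp) ?_).trans (by simp)
    rw [zero_add, pow_one]
    exact (Ideal.ne_top_iff_one _).mp (maximalIdeal.isMaximal A).ne_top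
  · intro a b
    by_cases ha : a = 0
    · simp [f, ha]
    by_cases hb : b = 0
    · simp [f, hb]
    obtain ⟨i, hi, hi1, hi2⟩ := hf' a ha
    obtain ⟨j, hj, hj1, hj2⟩ := hf' b hb
    change f (a * b) = f a * f b
    rw [hi, hj, ← exp_add]
    refine (heq _ (i + j) ?_ (hx.mul_notMem_pow hi1 hi2 hj1 hj2)).trans ?_
    · rw [pow_add]; exact Ideal.mul_mem_mul hi1 hj1
    · congr 1; push_cast; ring
  · intro a b
    change f (a + b) ≤ max (f a) (f b)
    by_cases ha : a = 0
    · simp [ha]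
    by_cases hb : b = 0
    · simp [hb]
    obtain ⟨i, hi, hi1, -⟩ := hf' a ha
    obtain ⟨j, hj, hj1, -⟩ := hf' b hb
    rcases le_total i j with hij | hij
    · refine le_trans ?_ (le_max_left _ _)
      rw [hi, hf]
      exact add_mem hi1 (Ideal.pow_le_pow_right hij hj1)
    · refine le_trans ?_ (le_max_right _ _)
      rw [hj, hf]
      exact add_mem (Ideal.pow_le_pow_right hij hi1) hj1

/-- Keeps the residue field infinite in inductions that divide by a parameter. -/
instance quotientResidueField_infinite [Infinite (ResidueField A)] (I : Ideal A)
    [IsLocalRing (A ⧸ I)] : Infinite (ResidueField (A ⧸ I)) := by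
  have := IsLocalHom.of_surjective (Ideal.Quotient.mk I) Ideal.Quotient.mk_surjective
  exact Infinite.of_injective _ (ResidueField.map (Ideal.Quotient.mk I)).injective

/-- The image of a regular system modulo its first member is regular. -/
theorem IsRegularSystem.quotient [IsNoetherianRing A] {x : Fin (n + 1) → A}
    (hx : IsRegularSystem x) [IsLocalRing (A ⧸ Ideal.span {x 0})] :
    IsRegularSystem fun i : Fin n => Ideal.Quotient.mk (Ideal.span {x 0}) (x i.succ) where
  span_eq := by
    have hx0 : x 0 ∈ maximalIdeal A := hx.span_eq ▸ Ideal.subset_span ⟨0, rfl⟩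
    have := IsLocalHom.of_surjective (Ideal.Quotient.mk (Ideal.span {x 0}))
      Ideal.Quotient.mk_surjective
    have hmap : (maximalIdeal A).map (Ideal.Quotient.mk (Ideal.span {x 0})) =
        maximalIdeal _ := by
      exact map_maximalIdeal_of_surjective _ Ideal.Quotient.mk_surjective
    rw [← hmap, ← hx.span_eq, Ideal.map_span]
    refine le_antisymm (Ideal.span_mono ?_) (Ideal.span_le.mpr ?_)
    · rintro _ ⟨i, rfl⟩
      exact ⟨_, ⟨i.succ, rfl⟩, rfl⟩
    · rintro _ ⟨_, ⟨i, rfl⟩, rfl⟩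
      induction i using Fin.cases with
      | zero =>
        have : Ideal.Quotient.mk (Ideal.span {x 0}) (x 0) = 0 :=
          Ideal.Quotient.eq_zero_iff_mem.mpr (Ideal.mem_span_singleton_self _)
        rw [this]
        exact zero_mem _
      | succ i => exact Ideal.subset_span ⟨i, rfl⟩
  le_dim := by
    have hx0 : x 0 ∈ maximalIdeal A := hx.span_eq ▸ Ideal.subset_span ⟨0, rfl⟩
    -- Dividing by one element lowers the dimension by at most one.
    have h := Ideal.height_le_ringKrullDim_quotient_add_one (p := maximalIdeal A) hx0
    rw [maximalIdeal_height_eq_ringKrullDim] at h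
    have h2 := hx.le_dim.trans h
    push_cast at h2
    generalize ringKrullDim (A ⧸ Ideal.span {x 0}) = k at h2
    cases k with
    | bot =>
      rw [WithBot.bot_add, le_bot_iff] at h2
      exact absurd h2 (by exact_mod_cast WithBot.coe_ne_bot (a := ((n + 1 : ℕ) : ℕ∞)))
    | coe k =>
      have h3 : ((n : ℕ∞) + 1) ≤ k + 1 := by exact_mod_cast h2
      exact_mod_cast (ENat.add_le_add_iff_right ENat.one_ne_top).mp h3

end RegularSystem

end

noncomputable section

/-! ### Finite free resolutions -/

section FreeResolutions

universe u

/-- `M` has a resolution of length `k` by finite free modules. -/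
def HasFreeResolution (R : Type u) [CommRing R] :
    ℕ → ∀ (M : Type u) [AddCommGroup M] [Module R M], Prop
  | 0, M, _, _ => Module.Free R M ∧ Module.Finite R M
  | k + 1, M, _, _ => ∃ (n : ℕ) (f : (Fin n → R) →ₗ[R] M), Function.Surjective f ∧
      HasFreeResolution R k (LinearMap.ker f)

theorem HasFreeResolution.congr {R : Type u} [CommRing R] {k : ℕ} {M N : Type u} [AddCommGroup M]
    [Module R M] [AddCommGroup N] [Module R N] (e : M ≃ₗ[R] N) (h : HasFreeResolution R k M) :
    HasFreeResolution R k N := by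
  cases k with
  | zero =>
    obtain ⟨h1, h2⟩ := h
    exact ⟨Module.Free.of_equiv e, Module.Finite.equiv e⟩
  | succ k =>
    obtain ⟨n, f, hf, h⟩ := h
    refine ⟨n, e.toLinearMap ∘ₗ f, e.surjective.comp hf, ?_⟩
    rwa [LinearEquiv.ker_comp]

-- Resolutions lift from `R/x` to `R`: a cover of `N/xN` lifts to a cover of `N` by Nakayama, and
-- since `x` is regular on `N` the reduction of its kernel is the kernel of the original cover.
-- Freeness itself lifts at the bottom of the induction.
open Pointwise in
theorem HasFreeResolution.of_quotSMulTop {R : Type u} [CommRing R] [IsNoetherianRing R] {x : R}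
    (hxj : x ∈ (⊥ : Ideal R).jacobson) (hxR : IsSMulRegular R x) {k : ℕ} :
    ∀ {N : Type u} [AddCommGroup N] [Module R N] [Module.Finite R N] (_ : IsSMulRegular N x)
      (_ : HasFreeResolution (R ⧸ Ideal.span {x}) k (QuotSMulTop x N)),
      HasFreeResolution R k N := by
  induction k with
  | zero =>
    intro N _ _ _ hxN h
    have : Module.FinitePresentation R N := Module.finitePresentation_of_finite R N
    exact ⟨(Module.free_quotSMulTop_iff_free R N hxj hxN).mp h.1, inferInstance⟩
  | succ k ih =>
    intro N _ _ _ hxN h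
    obtain ⟨n, f, hf, h⟩ := h
    let π : N →ₗ[R] QuotSMulTop x N := Submodule.mkQ _
    have hπ : Function.Surjective π := Submodule.mkQ_surjective _
    let red : (Fin n → R) →ₗ[R] (Fin n → R ⧸ Ideal.span {x}) :=
      (Submodule.mkQ (Ideal.span {x})).compLeft (Fin n)
    have hred : Function.Surjective red := by
      intro v
      choose w hw using fun i => Submodule.mkQ_surjective (Ideal.span {x}) (v i)
      exact ⟨w, funext hw⟩
    obtain ⟨g, hg⟩ := Module.projective_lifting_property π (f.restrictScalars R ∘ₗ red) hπ
    have hg' : ∀ v, π (g v) = f (red v) := fun v => LinearMap.congr_fun hg v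
    have hredker : ∀ v, red v = 0 → ∃ w, v = x • w := by
      intro v hv
      have : ∀ i, ∃ w, v i = x * w := by
        intro i
        have h1 : Submodule.mkQ (Ideal.span {x}) (v i) = 0 := congrFun hv i
        rw [Submodule.mkQ_apply, Submodule.Quotient.mk_eq_zero] at h1
        exact Ideal.mem_span_singleton.mp h1
      choose w hw using this
      exact ⟨w, funext hw⟩
    have hredx : ∀ v, red (x • v) = 0 := by
      intro v
      funext i
      change Submodule.mkQ (Ideal.span {x}) (x * v i) = 0
      rw [Submodule.mkQ_apply, Submodule.Quotient.mk_eq_zero]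
      exact Ideal.mem_span_singleton.mpr ⟨_, rfl⟩
    have hsurj : Function.Surjective g := by
      apply g.surjective_of_surjective_comp_mkQ (Ideal.span {x}) (by simpa using hxj)
      rw [Submodule.ideal_span_singleton_smul x ⊤, hg]
      exact hf.comp hred
    have hker : ∀ v, g v = 0 → red v ∈ LinearMap.ker f := by
      intro v hv
      rw [LinearMap.mem_ker, ← hg', hv, map_zero]
    let ρ : LinearMap.ker g →ₗ[R] LinearMap.ker f :=
      { toFun := fun v => ⟨red v.1, hker v.1 v.2⟩
        map_add' := fun v w => Subtype.ext (map_add red v.1 w.1)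
        map_smul' := fun r v => Subtype.ext (map_smul red r v.1) }
    -- A lift `v` of a kernel element has `g v = x • g z` for some `z`, and `v - x • z` is a lift
    -- inside the kernel of `g`.
    have hρ : Function.Surjective ρ := by
      rintro ⟨w, hw⟩
      obtain ⟨v, rfl⟩ := hred w
      have h1 : π (g v) = 0 := by rw [hg']; exact hw
      rw [Submodule.mkQ_apply, Submodule.Quotient.mk_eq_zero] at h1
      obtain ⟨m, -, hm⟩ := (Submodule.mem_smul_pointwise_iff_exists _ _ _).mp h1
      obtain ⟨z, rfl⟩ := hsurj m
      refine ⟨⟨v - x • z, ?_⟩, ?_⟩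
      · rw [LinearMap.mem_ker, map_sub, map_smul, hm, sub_self]
      · apply Subtype.ext
        change red (v - x • z) = red v
        rw [map_sub, hredx, sub_zero]
    -- If `x • w` is killed by `g`, then so is `w`, because `x` is regular on `N`.
    have hρker : LinearMap.ker ρ = x • (⊤ : Submodule R (LinearMap.ker g)) := by
      ext ⟨v, hv⟩
      rw [LinearMap.mem_ker, Submodule.mem_smul_pointwise_iff_exists]
      constructor
      · intro h0
        obtain ⟨w, rfl⟩ := hredker v (congrArg Subtype.val h0)
        have hw : g w = 0 := by
          rw [LinearMap.mem_ker, map_smul] at hv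
          exact hxN.right_eq_zero_of_smul hv
        exact ⟨⟨w, hw⟩, trivial, rfl⟩
      · rintro ⟨w, -, hw⟩
        apply Subtype.ext
        have : v = x • w.1 := (congrArg Subtype.val hw).symm
        change red v = 0
        rw [this, hredx]
    let e₀ : QuotSMulTop x (LinearMap.ker g) ≃ₗ[R] LinearMap.ker f :=
      (Submodule.quotEquivOfEq _ _ hρker.symm).trans (ρ.quotKerEquivOfSurjective hρ)
    let e : QuotSMulTop x (LinearMap.ker g) ≃ₗ[R ⧸ Ideal.span {x}] LinearMap.ker f :=
      e₀.extendScalarsOfSurjective Ideal.Quotient.mk_surjective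
    refine ⟨n, g, hsurj, ih ?_ (h.congr e.symm)⟩
    intro v w hvw
    apply Subtype.ext
    have h2 : x • v.1 = x • w.1 := congrArg Subtype.val hvw
    funext i
    exact hxR (congrFun h2 i)

-- The linear form `X i` has nonzero reduction, so quasi-regularity excludes its value from the
-- square.
open IsLocalRing in
theorem IsRegularSystem.notMem_sq {A : Type*} [CommRing A] [IsLocalRing A] [IsNoetherianRing A]
    [Infinite (ResidueField A)] {n : ℕ} {x : Fin n → A} (hx : IsRegularSystem x) (i : Fin n) :
    x i ∉ maximalIdeal A ^ 2 := by
  intro h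
  have := hx.coeff_mem (F := MvPolynomial.X i) (d := 1) (MvPolynomial.isHomogeneous_X _ i)
    (by simpa using h)
  rw [MvPolynomial.map_X] at this
  exact MvPolynomial.X_ne_zero i this

-- Hilbert's syzygy theorem by induction on the dimension. The kernel of a free cover of `M` sits in
-- a free module, so `x 0` is regular on it; modulo `x 0` the induction hypothesis resolves it, and
-- the resolution lifts.
open IsLocalRing in
theorem IsRegularSystem.hasFreeResolution {n : ℕ} : ∀ {A : Type u} [CommRing A] [IsLocalRing A]
    [IsNoetherianRing A] [Infinite (ResidueField A)] {x : Fin n → A} (_ : IsRegularSystem x)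
    (M : Type u) [AddCommGroup M] [Module A M] [Module.Finite A M], HasFreeResolution A n M := by
  induction n with
  | zero =>
    intro A _ _ _ _ x hx M _ _ _
    have hm : maximalIdeal A = ⊥ := by
      rw [← hx.span_eq, Set.range_eq_empty, Ideal.span_empty]
    let : Field A := (isField_iff_maximalIdeal_eq.mpr hm).toField
    exact ⟨Module.Free.of_divisionRing A M, inferInstance⟩
  | succ n ih =>
    intro A _ _ _ _ x hx M _ _ _
    have := hx.isDomain
    have hx0 : x 0 ∈ maximalIdeal A := hx.span_eq ▸ Ideal.subset_span ⟨0, rfl⟩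
    have hne : x 0 ≠ 0 := fun h0 => hx.notMem_sq 0 (h0 ▸ zero_mem _)
    have : Nontrivial (A ⧸ Ideal.span {x 0}) := by
      rw [Ideal.Quotient.nontrivial_iff]
      intro h
      rw [Ideal.span_singleton_eq_top] at h
      exact (mem_maximalIdeal _).mp hx0 h
    have : IsLocalRing (A ⧸ Ideal.span {x 0}) :=
      IsLocalRing.of_surjective' (Ideal.Quotient.mk (Ideal.span {x 0}))
        Ideal.Quotient.mk_surjective
    obtain ⟨k, f, hf⟩ := Module.Finite.exists_fin' A M
    have hreg : IsSMulRegular A (x 0) := fun a b h => mul_left_cancel₀ hne h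
    have : Module.Finite (A ⧸ Ideal.span {x 0}) (QuotSMulTop (x 0) (LinearMap.ker f)) :=
      Module.Finite.of_restrictScalars_finite A _ _
    refine ⟨k, f, hf, HasFreeResolution.of_quotSMulTop (x := x 0) ?_ hreg ?_ (ih hx.quotient _)⟩
    · rwa [IsLocalRing.jacobson_eq_maximalIdeal _ bot_ne_top]
    · intro v w hvw
      apply Subtype.ext
      funext i
      exact hreg (congrFun (congrArg Subtype.val hvw) i)

theorem HasFreeResolution.localize {R R' : Type u} [CommRing R] [CommRing R'] [Algebra R R']
    (S : Submonoid R) [IsLocalization S R'] {k : ℕ} : ∀ {M N : Type u} [AddCommGroup M]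
    [Module R M] [AddCommGroup N] [Module R N] [Module R' N] [IsScalarTower R R' N]
    (f : M →ₗ[R] N) [IsLocalizedModule S f] (_ : HasFreeResolution R k M),
    HasFreeResolution R' k N := by
  induction k with
  | zero =>
    intro M N _ _ _ _ _ _ f _ h
    obtain ⟨h1, h2⟩ := h
    exact ⟨Module.free_of_isLocalizedModule S f, Module.Finite.of_isLocalizedModule S f⟩
  | succ k ih =>
    intro M N _ _ _ _ _ _ f _ h
    obtain ⟨n, φ, hφ, h⟩ := h
    let ι : (Fin n → R) →ₗ[R] (Fin n → R') :=
      LinearMap.pi fun i => Algebra.linearMap R R' ∘ₗ LinearMap.proj i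
    have hι : IsLocalizedModule S ι := inferInstance
    let ψ := IsLocalizedModule.mapExtendScalars S ι f R' φ
    refine ⟨n, ψ, IsLocalizedModule.map_surjective S ι f φ hφ, ?_⟩
    let κ : LinearMap.ker φ →ₗ[R] LinearMap.ker ψ := LinearMap.toKerIsLocalized S ι f φ
    have hκ : IsLocalizedModule S κ := LinearMap.toKerLocalized_isLocalizedModule R' S ι f φ
    exact ih κ h

/-- A projective module with a finite free resolution is stably free. -/
theorem HasFreeResolution.exists_prod_equiv {R : Type u} [CommRing R] {k : ℕ} :
    ∀ {M : Type u} [AddCommGroup M] [Module R M] [Module.Projective R M]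
    (_ : HasFreeResolution R k M),
    ∃ s t : ℕ, Nonempty ((M × (Fin s → R)) ≃ₗ[R] (Fin t → R)) := by
  induction k with
  | zero =>
    intro M _ _ _ h
    obtain ⟨h1, h2⟩ := h
    rcases subsingleton_or_nontrivial R with hR | hR
    · have := Module.subsingleton R M
      exact ⟨0, 0, ⟨LinearEquiv.ofSubsingleton _ _⟩⟩
    · exact ⟨0, Module.finrank R M, ⟨LinearEquiv.prodUnique.trans (Module.finBasis R M).equivFun⟩⟩
  | succ k ih =>
    intro M _ _ _ h
    obtain ⟨n, f, hf, h⟩ := h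
    -- The cover splits, so the kernel is again projective, with a shorter resolution.
    obtain ⟨σ, hσ⟩ := Module.projective_lifting_property f LinearMap.id hf
    have hσ' : ∀ m, f (σ m) = m := fun m => LinearMap.congr_fun hσ m
    let e : (Fin n → R) ≃ₗ[R] M × LinearMap.ker f :=
      { toFun := fun v => (f v, ⟨v - σ (f v), by simp [hσ']⟩)
        map_add' := fun v w => by
          ext
          · simp
          · simp only [map_add, Prod.mk_add_mk, AddMemClass.mk_add_mk]
            simp only [Pi.sub_apply, Pi.add_apply]
            ring
        map_smul' := fun r v => by
          ext
          · simp
          · simp [mul_sub]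
        invFun := fun p => σ p.1 + p.2.1
        left_inv := fun v => by simp
        right_inv := fun p => by
          have h2 : f p.2.1 = 0 := p.2.2
          ext <;> simp [hσ', h2] }
    have : Module.Projective R (LinearMap.ker f) := by
      refine Module.Projective.of_split (LinearMap.ker f).subtype
        (LinearMap.snd R M (LinearMap.ker f) ∘ₗ e.toLinearMap) ?_
      ext v
      have hv : f v.1 = 0 := v.2
      simp [e, hv]
    obtain ⟨s, t, ⟨e'⟩⟩ := ih h
    -- With `K` the kernel: `M ⊕ Rᵗ ≅ M ⊕ K ⊕ Rˢ ≅ Rⁿ ⊕ Rˢ`.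
    refine ⟨t, n + s, ⟨?_⟩⟩
    exact ((LinearEquiv.refl R M).prodCongr e'.symm).trans <|
      (LinearEquiv.prodAssoc R M _ _).symm.trans <|
      (e.symm.prodCongr (LinearEquiv.refl R _)).trans <|
      (LinearEquiv.sumArrowLequivProdArrow (Fin n) (Fin s) R R).symm.trans <|
      LinearEquiv.funCongrLeft R R finSumFinEquiv.symm

end FreeResolutions

end

noncomputable section

/-! ### Stably free fractional ideals are principal -/

section StablyFree

/-- Each term of the Leibniz expansion has exactly one factor from row `i₀`; the others are scalars
from `B`. -/
theorem Matrix.det_mem_of_row_mem {B K ι : Type*} [CommRing B] [CommRing K] [Algebra B K]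
    [Fintype ι] [DecidableEq ι] (M : Matrix ι ι K) (J : Submodule B K) (i₀ : ι)
    (h₀ : ∀ j, M i₀ j ∈ J) (h : ∀ i ≠ i₀, ∀ j, M i j ∈ (algebraMap B K).range) : M.det ∈ J := by
  rw [Matrix.det_apply]
  refine sum_mem fun σ _ => ?_
  have hprod : ∏ i, M (σ i) i ∈ J := by
    rw [← Finset.mul_prod_erase Finset.univ _ (Finset.mem_univ (σ⁻¹ i₀))]
    have : ∏ i ∈ Finset.univ.erase (σ⁻¹ i₀), M (σ i) i ∈ (algebraMap B K).range := by
      refine prod_mem fun i hi => h _ ?_ _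
      intro hi'
      apply Finset.ne_of_mem_erase hi
      rw [← hi']
      simp
    obtain ⟨b, hb⟩ := this
    rw [← hb, mul_comm, ← Algebra.smul_def]
    refine J.smul_mem b ?_
    have hσ : σ (σ⁻¹ i₀) = i₀ := by simp
    rw [hσ]
    exact h₀ _
  rcases Int.units_eq_one_or (Equiv.Perm.sign σ) with h1 | h1
  · rwa [h1, one_smul]
  · rw [h1, Units.neg_smul, one_smul]
    exact neg_mem hprod

/-- The top exterior power of `J ⊕ Bˢ ≅ Bᵗ`, written with matrices. The inverse isomorphism has
determinant in `J`, the isomorphism has determinant in the inverse ideal of `J`, and their product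
is 1; so the first determinant generates `J`. -/
theorem Submodule.exists_eq_span_singleton_of_prod_equiv {B K : Type*} [CommRing B] [IsDomain B]
    [Field K] [Algebra B K] [IsFractionRing B K] (J : Submodule B K) (hJ : J ≠ ⊥) {s t : ℕ}
    (φ : (J × (Fin s → B)) ≃ₗ[B] (Fin t → B)) : ∃ d : K, J = Submodule.span B {d} := by
  classical
  obtain ⟨a, haJ, ha0⟩ := Submodule.exists_mem_ne_zero_of_ne_bot hJ
  let α : J := ⟨a, haJ⟩
  -- Elements of `J` are proportional over the fraction field, so `φ` acts on `J` as multiplication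
  -- by one vector, computed here at `a`.
  let c : Fin t → K := fun j => algebraMap B K (φ (α, 0) j) / a
  have hc : ∀ (b : J) (j), algebraMap B K (φ (b, 0) j) = b.1 * c j := by
    intro b j
    obtain ⟨r, q, hq, hrq⟩ := IsFractionRing.div_surjective (A := B) (b.1 / a)
    have hq0 : algebraMap B K q ≠ 0 := by
      simpa using nonZeroDivisors.ne_zero hq
    have h1 : q • b = r • α := by
      apply Subtype.ext
      rw [Submodule.coe_smul, Submodule.coe_smul, Algebra.smul_def, Algebra.smul_def]
      field_simp at hrq
      change algebraMap B K q * b.1 = algebraMap B K r * a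
      linear_combination -hrq
    have h2 : q • φ (b, 0) = r • φ (α, 0) := by
      rw [← map_smul, ← map_smul, Prod.smul_mk, Prod.smul_mk, h1, smul_zero, smul_zero]
    have h3 : algebraMap B K q * algebraMap B K (φ (b, 0) j) =
        algebraMap B K r * algebraMap B K (φ (α, 0) j) := by
      rw [← map_mul, ← map_mul]
      exact congrArg _ (congrFun h2 j)
    have hr : algebraMap B K r = b.1 / a * algebraMap B K q := by
      rw [← hrq]; field_simp
    apply mul_left_cancel₀ hq0
    rw [h3, hr]
    simp only [c]
    ring
  -- `N` and `M` are the matrices of `φ` and its inverse over `K`; the index `none` stands for the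
  -- summand `J`.
  let N : Matrix (Fin t) (Option (Fin s)) K := fun j i =>
    i.elim (c j) fun i => algebraMap B K (φ (0, Pi.single i 1) j)
  let M : Matrix (Option (Fin s)) (Fin t) K := fun i j =>
    i.elim ((φ.symm (Pi.single j 1)).1 : K) fun i => algebraMap B K ((φ.symm (Pi.single j 1)).2 i)
  have hφ : ∀ (p : J × (Fin s → B)) j, algebraMap B K (φ p j) =
      p.1.1 * c j + ∑ i, algebraMap B K (p.2 i) * algebraMap B K (φ (0, Pi.single i 1) j) := by
    intro p j
    have h1 : p = (p.1, 0) + ∑ i, p.2 i • ((0 : J), (Pi.single i (1 : B) : Fin s → B)) := by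
      refine Prod.ext ?_ ?_
      · simp [Prod.fst_sum]
      · simp only [Prod.snd_add, Prod.snd_sum, Prod.smul_snd, zero_add]
        funext i
        simp [Finset.sum_apply, Pi.single_apply]
    conv_lhs => rw [h1]
    rw [map_add, map_sum, Pi.add_apply, map_add, hc, Finset.sum_apply, map_sum]
    congr 1
    refine Finset.sum_congr rfl fun i _ => ?_
    rw [map_smul, Pi.smul_apply, smul_eq_mul, map_mul]
  have hψ : ∀ v : Fin t → B, ((φ.symm v).1 : K) = ∑ j, algebraMap B K (v j) * M none j ∧
      ∀ i, algebraMap B K ((φ.symm v).2 i) = ∑ j, algebraMap B K (v j) * M (some i) j := by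
    intro v
    have h1 : v = ∑ j, v j • (Pi.single j (1 : B) : Fin t → B) := by
      funext i
      simp [Finset.sum_apply, Pi.single_apply]
    have h2 : φ.symm v = ∑ j, v j • φ.symm (Pi.single j (1 : B)) := by
      conv_lhs => rw [h1]
      rw [map_sum]
      simp_rw [map_smul]
    constructor
    · rw [h2, Prod.fst_sum, AddSubmonoidClass.coe_finsetSum]
      refine Finset.sum_congr rfl fun j _ => ?_
      rw [Prod.smul_fst, Submodule.coe_smul, Algebra.smul_def]
      rfl
    · intro i
      rw [h2, Prod.snd_sum, Finset.sum_apply, map_sum]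
      refine Finset.sum_congr rfl fun j _ => ?_
      rw [Prod.smul_snd, Pi.smul_apply, smul_eq_mul, map_mul]
      rfl
  have hNM : N * M = 1 := by
    ext j k
    rw [Matrix.mul_apply, Fintype.sum_option]
    have := hφ (φ.symm (Pi.single k 1)) j
    rw [φ.apply_symm_apply] at this
    rw [Matrix.one_apply, ← Pi.single_apply k (1 : K) j] at *
    have h2 : algebraMap B K ((Pi.single k (1 : B) : Fin t → B) j) =
        (Pi.single k (1 : K) : Fin t → K) j := by
      rw [Pi.single_apply, Pi.single_apply]; split_ifs <;> simp
    rw [← h2, this]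
    simp only [N, M, Option.elim_none, Option.elim_some]
    congr 1
    · ring
    · exact Finset.sum_congr rfl fun i _ => mul_comm _ _
  have hMN : M * N = 1 := by
    ext i k
    rw [Matrix.mul_apply]
    cases k with
    | none =>
      have h1 := hψ (φ (α, 0))
      rw [φ.symm_apply_apply] at h1
      have hN : ∀ j, N j none = algebraMap B K (φ (α, 0) j) / a := fun j => rfl
      simp_rw [hN, mul_div_assoc', ← Finset.sum_div]
      cases i with
      | none =>
        rw [Matrix.one_apply_eq, div_eq_one_iff_eq ha0]
        simp_rw [mul_comm (M none _)]
        exact h1.1.symm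
      | some i =>
        rw [Matrix.one_apply_ne (by simp)]
        simp_rw [mul_comm (M (some i) _)]
        rw [← h1.2 i]
        simp
    | some k =>
      have h1 := hψ (φ (0, Pi.single k 1))
      rw [φ.symm_apply_apply] at h1
      have hN : ∀ j, N j (some k) = algebraMap B K (φ (0, Pi.single k 1) j) := fun j => rfl
      simp_rw [hN, mul_comm (M i _)]
      cases i with
      | none =>
        rw [Matrix.one_apply_ne (by simp)]
        exact h1.1.symm
      | some i =>
        rw [← h1.2 i, Matrix.one_apply]
        by_cases hik : i = k <;> simp [hik]
  have hcard := Matrix.square_of_invertible M N hMN hNM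
  let e : Option (Fin s) ≃ Fin t := Fintype.equivOfCardEq hcard
  let M' := M.submatrix id e
  let N' := N.submatrix e id
  have hMN' : M' * N' = 1 := by
    simp only [M', N', Matrix.submatrix_mul_equiv, hMN]
    simp
  have hdet : M'.det * N'.det = 1 := by rw [← Matrix.det_mul, hMN', Matrix.det_one]
  have hM' : M'.det ∈ J := by
    refine M'.det_mem_of_row_mem J none (fun j => (φ.symm (Pi.single (e j) 1)).1.2) ?_
    intro i hi j
    cases i with
    | none => exact absurd rfl hi
    | some i => exact ⟨_, rfl⟩
  -- The inverse ideal of `J`; the entries of the column `none` of `N` belong to it.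
  let J' : Submodule B K :=
    { carrier := {k | ∀ b ∈ J, k * b ∈ (algebraMap B K).range}
      zero_mem' := fun b _ => by rw [zero_mul]; exact zero_mem _
      add_mem' := fun hk hl b hb => by rw [add_mul]; exact add_mem (hk b hb) (hl b hb)
      smul_mem' := fun r k hk b hb => by
        rw [Algebra.smul_def, mul_assoc]; exact mul_mem ⟨r, rfl⟩ (hk b hb) }
  have hN' : N'.det ∈ J' := by
    rw [← Matrix.det_transpose]
    refine Matrix.det_mem_of_row_mem _ J' none (fun j b hb => ?_) ?_
    · have : N'.transpose none j * b = algebraMap B K (φ (⟨b, hb⟩, 0) (e j)) := by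
        rw [hc, mul_comm]
        rfl
      exact ⟨_, this.symm⟩
    · intro i hi j
      cases i with
      | none => exact absurd rfl hi
      | some i => exact ⟨_, rfl⟩
  refine ⟨M'.det, le_antisymm (fun b hb => ?_) ?_⟩
  · obtain ⟨r, hr⟩ := hN' b hb
    rw [Submodule.mem_span_singleton]
    refine ⟨r, ?_⟩
    rw [Algebra.smul_def, hr]
    linear_combination b * hdet
  · rw [Submodule.span_singleton_le_iff_mem]
    exact hM'

end StablyFree

end

noncomputable section

/-! ### Divisors on the punctured spectrum of a regular local ring -/

section PuncturedSpectrum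

universe u

/-- The units of a subring of a field. -/
def Subring.unitGroup {K : Type*} [Field K] (R : Subring K) : Subgroup Kˣ where
  carrier := {u | (u : K) ∈ R ∧ ((u⁻¹ : Kˣ) : K) ∈ R}
  one_mem' := ⟨one_mem R, by simp⟩
  mul_mem' := fun {u v} hu hv => ⟨by simpa using mul_mem hu.1 hv.1, by
    rw [mul_inv, Units.val_mul]; exact mul_mem hu.2 hv.2⟩
  inv_mem' := fun {u} hu => ⟨hu.2, by simpa using hu.1⟩

variable {A : Type u} (K : Type u) [CommRing A] [Field K] [Algebra A K]

/-- The local ring of `Spec A` at `q`, inside the fraction field. -/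
def localSubring (q : PrimeSpectrum A) : Subring K where
  carrier := {h | ∃ a s : A, s ∉ q.asIdeal ∧ h * algebraMap A K s = algebraMap A K a}
  zero_mem' := ⟨0, 1, (Ideal.ne_top_iff_one _).mp q.2.ne_top, by simp⟩
  one_mem' := ⟨1, 1, (Ideal.ne_top_iff_one _).mp q.2.ne_top, by simp⟩
  add_mem' := by
    rintro h h' ⟨a, s, hs, e⟩ ⟨a', s', hs', e'⟩
    refine ⟨a * s' + a' * s, s * s', q.2.mul_notMem hs hs', ?_⟩
    simp only [map_mul, map_add, ← e, ← e']
    ring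
  mul_mem' := by
    rintro h h' ⟨a, s, hs, e⟩ ⟨a', s', hs', e'⟩
    refine ⟨a * a', s * s', q.2.mul_notMem hs hs', ?_⟩
    simp only [map_mul, ← e, ← e']
    ring
  neg_mem' := by
    rintro h ⟨a, s, hs, e⟩
    exact ⟨-a, s, hs, by rw [map_neg, ← e, neg_mul]⟩

/-- The units of the local ring of `Spec A` at `q`, inside the fraction field. -/
abbrev localUnits (q : PrimeSpectrum A) : Subgroup Kˣ := (localSubring K q).unitGroup

variable {K}

theorem algebraMap_mem_localSubring (q : PrimeSpectrum A) (a : A) :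
    algebraMap A K a ∈ localSubring K q :=
  ⟨a, 1, (Ideal.ne_top_iff_one _).mp q.2.ne_top, by simp⟩

theorem mem_localSubring_of_mul_mem {q : PrimeSpectrum A} {s : A} (hs : s ∉ q.asIdeal) {h : K}
    (hh : algebraMap A K s * h ∈ localSubring K q) : h ∈ localSubring K q := by
  obtain ⟨a, t, ht, e⟩ := hh
  exact ⟨a, s * t, q.2.mul_notMem hs ht, by rw [map_mul, ← e]; ring⟩

theorem localSubring_mono {q q' : PrimeSpectrum A} (h : q' ≤ q) :
    localSubring K q ≤ localSubring K q' := by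
  rintro k ⟨a, s, hs, e⟩
  exact ⟨a, s, fun hs' => hs (h hs'), e⟩

theorem localUnits_mono {q q' : PrimeSpectrum A} (h : q' ≤ q) :
    localUnits K q ≤ localUnits K q' :=
  fun _ hu => ⟨localSubring_mono h hu.1, localSubring_mono h hu.2⟩

variable [IsFractionRing A K]

theorem ne_zero_of_notMem {q : PrimeSpectrum A} {s : A} (hs : s ∉ q.asIdeal) :
    algebraMap A K s ≠ 0 := by
  rw [Ne, IsFractionRing.to_map_eq_zero_iff]
  rintro rfl
  exact hs (zero_mem _)

theorem mk0_mem_localUnits {q : PrimeSpectrum A} {s : A} (hs : s ∉ q.asIdeal) :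
    Units.mk0 _ (ne_zero_of_notMem (K := K) hs) ∈ localUnits K q := by
  refine ⟨algebraMap_mem_localSubring q s, ?_⟩
  refine mem_localSubring_of_mul_mem hs ?_
  have h1 := Units.mul_inv (Units.mk0 _ (ne_zero_of_notMem (K := K) hs))
  rw [Units.val_mk0] at h1
  rw [h1]
  exact one_mem _

/-- If the ideal of denominators of `h` missed `S`, it would lie in a prime disjoint from `S`, where
`h` nevertheless has a denominator outside that prime. -/
theorem exists_mul_mem_range_of_forall_mem (S : Submonoid A) (h : K)
    (H : ∀ q : PrimeSpectrum A, Disjoint (q.asIdeal : Set A) S → h ∈ localSubring K q) :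
    ∃ t ∈ S, algebraMap A K t * h ∈ (algebraMap A K).range := by
  let I : Ideal A :=
    { carrier := {r | algebraMap A K r * h ∈ (algebraMap A K).range}
      zero_mem' := by simp
      add_mem' := fun {a b} ha hb => by
        simp only [Set.mem_ofPred_eq, map_add, add_mul] at *
        exact add_mem ha hb
      smul_mem' := fun r a ha => by
        simp only [Set.mem_ofPred_eq, smul_eq_mul, map_mul, mul_assoc] at *
        exact mul_mem ⟨r, rfl⟩ ha }
  by_contra! hcon
  have hdis : Disjoint (I : Set A) S := by
    rw [Set.disjoint_left]
    exact fun t ht hS => hcon t hS ht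
  obtain ⟨q, hq, hIq, hqS⟩ := Ideal.exists_le_prime_disjoint I S hdis
  obtain ⟨a, s, hs, e⟩ := H ⟨q, hq⟩ hqS
  exact hs (hIq ⟨a, by rw [← e, mul_comm]⟩)

theorem exists_pow_mul_mem_range (s : A) (h : K)
    (H : ∀ q : PrimeSpectrum A, s ∉ q.asIdeal → h ∈ localSubring K q) :
    ∃ N, algebraMap A K (s ^ N) * h ∈ (algebraMap A K).range := by
  obtain ⟨_, ⟨N, rfl⟩, hN⟩ := exists_mul_mem_range_of_forall_mem (Submonoid.powers s) h
    fun q hq => H q fun hs => Set.disjoint_left.mp hq hs (Submonoid.mem_powers s)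
  exact ⟨N, hN⟩

/-- An invertible sheaf on the basic open set `D(x)` has a section generating it at a given
point. -/
theorem exists_section_generating {x : A} (g : PrimeSpectrum A → Kˣ)
    (hg : ∀ q : PrimeSpectrum A, x ∉ q.asIdeal → ∃ s ∉ q.asIdeal, ∀ q' : PrimeSpectrum A,
      x ∉ q'.asIdeal → s ∉ q'.asIdeal → g q / g q' ∈ localUnits K q')
    {q : PrimeSpectrum A} (hq : x ∉ q.asIdeal) :
    ∃ f : Kˣ, (∀ q' : PrimeSpectrum A, x ∉ q'.asIdeal → ↑(f * g q') ∈ localSubring K q') ∧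
      f * g q ∈ localUnits K q := by
  classical
  choose s hs hgs using hg
  -- Quasi-compactness reduces the bounds on denominators to finitely many charts.
  obtain ⟨t, ht⟩ := (PrimeSpectrum.isCompact_basicOpen x).elim_finite_subcover
    (fun i : {q : PrimeSpectrum A // x ∉ q.asIdeal} =>
      (PrimeSpectrum.basicOpen (s i.1 i.2) : Set (PrimeSpectrum A)))
    (fun i => (PrimeSpectrum.basicOpen _).isOpen)
    (fun q hq => Set.mem_iUnion.mpr ⟨⟨q, hq⟩, hs q hq⟩)
  -- On the overlap of the charts at `q` and at `i` the quotient of local equations is a unit, so a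
  -- power of the function defining the overlap clears its denominators.
  have key : ∀ i : {q : PrimeSpectrum A // x ∉ q.asIdeal}, ∃ N,
      algebraMap A K ((s q hq * s i.1 i.2 * x) ^ N) * ↑(g i.1 / g q) ∈
        (algebraMap A K).range := by
    intro i
    apply exists_pow_mul_mem_range
    intro q' hq'
    have h1 : x ∉ q'.asIdeal := fun h => hq' (Ideal.mul_mem_left _ _ h)
    have h2 : s q hq ∉ q'.asIdeal :=
      fun h => hq' (Ideal.mul_mem_right _ _ (Ideal.mul_mem_right _ _ h))
    have h3 : s i.1 i.2 ∉ q'.asIdeal :=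
      fun h => hq' (Ideal.mul_mem_right _ _ (Ideal.mul_mem_left _ _ h))
    have := div_mem (hgs i.1 i.2 q' h1 h3) (hgs q hq q' h1 h2)
    rw [div_div_div_cancel_right] at this
    exact this.1
  choose N hN using key
  let n := t.sup N
  have hsK : algebraMap A K (s q hq ^ n) ≠ 0 := by
    rw [map_pow]
    exact pow_ne_zero _ (ne_zero_of_notMem (hs q hq))
  -- The local generator `1 / g q` times a power of `s q` high enough for all charts at once; that
  -- power is still a unit at `q`.
  refine ⟨Units.mk0 _ hsK / g q, fun q' hq' => ?_, ?_⟩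
  · obtain ⟨i, hi, hiq⟩ : ∃ i ∈ t, s i.1 i.2 ∉ q'.asIdeal := by
      simpa using ht hq'
    have h1 : ((Units.mk0 _ hsK / g q * g q' : Kˣ) : K) =
        (algebraMap A K (s q hq ^ n) * ↑(g i.1 / g q)) * ↑(g i.1 / g q')⁻¹ := by
      simp only [Units.val_mul, Units.val_div_eq_div_val, Units.val_mk0, Units.val_inv_eq_inv_val]
      have := (g i.1).ne_zero
      field_simp
    rw [h1]
    refine mul_mem ?_ (hgs i.1 i.2 q' hq' hiq).2
    have h2 : (s i.1 i.2 * x) ^ n ∉ q'.asIdeal :=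
      fun h => q'.2.mul_notMem hiq hq' (q'.2.mem_of_pow_mem n h)
    apply mem_localSubring_of_mul_mem h2
    obtain ⟨b, hb⟩ := hN i
    have hle : N i ≤ n := Finset.le_sup hi
    have h3 : algebraMap A K ((s i.1 i.2 * x) ^ n) *
        (algebraMap A K (s q hq ^ n) * ↑(g i.1 / g q)) =
        algebraMap A K ((s q hq * s i.1 i.2 * x) ^ (n - N i)) * algebraMap A K b := by
      rw [hb, ← mul_assoc, ← mul_assoc, ← map_mul, ← map_mul]
      congr 2
      rw [← pow_add, Nat.sub_add_cancel hle]
      ring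
    rw [h3]
    exact mul_mem (algebraMap_mem_localSubring _ _) (algebraMap_mem_localSubring _ _)
  · rw [div_mul_cancel]
    exact mk0_mem_localUnits (s := s q hq ^ n) fun h => hs q hq (q.2.mem_of_pow_mem n h)

/-- If every finite module has a finite free resolution, then all invertible sheaves on basic
open sets are trivial. -/
theorem exists_mul_mem_localUnits_of_hasFreeResolution [IsDomain A] [IsNoetherianRing A] {n : ℕ}
    (hA : ∀ (M : Type u) [AddCommGroup M] [Module A M] [Module.Finite A M],
      HasFreeResolution A n M) {x : A} (hx : x ≠ 0) (g : PrimeSpectrum A → Kˣ)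
    (hg : ∀ q : PrimeSpectrum A, x ∉ q.asIdeal → ∃ s ∉ q.asIdeal, ∀ q' : PrimeSpectrum A,
      x ∉ q'.asIdeal → s ∉ q'.asIdeal → g q / g q' ∈ localUnits K q') :
    ∃ f : Kˣ, ∀ q : PrimeSpectrum A, x ∉ q.asIdeal → f * g q ∈ localUnits K q := by
  have hS : Submonoid.powers x ≤ nonZeroDivisors A := by
    rw [Submonoid.powers_le]
    exact mem_nonZeroDivisors_of_ne_zero hx
  let B := Localization.subalgebra.ofField K (Submonoid.powers x) hS
  have hB : ∀ k : K, k ∈ B ↔ ∃ N, algebraMap A K (x ^ N) * k ∈ (algebraMap A K).range := by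
    intro k
    constructor
    · rintro ⟨a, _, ⟨N, rfl⟩, rfl⟩
      refine ⟨N, a, ?_⟩
      have : algebraMap A K (x ^ N) ≠ 0 := by simpa using fun h => absurd h hx
      simp only
      field_simp
    · rintro ⟨N, a, ha⟩
      refine ⟨a, x ^ N, ⟨N, rfl⟩, ?_⟩
      have : algebraMap A K (x ^ N) ≠ 0 := by simpa using fun h => absurd h hx
      rw [ha]
      field_simp
  have hBq : ∀ (b : B) (q : PrimeSpectrum A), x ∉ q.asIdeal → (b : K) ∈ localSubring K q := by
    intro b q hq
    obtain ⟨N, a, ha⟩ := (hB b).mp b.2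
    apply mem_localSubring_of_mul_mem (s := x ^ N) fun h => hq (q.2.mem_of_pow_mem N h)
    rw [← ha]
    exact algebraMap_mem_localSubring _ _
  have hBmem : ∀ k : K, (∀ q : PrimeSpectrum A, x ∉ q.asIdeal → k ∈ localSubring K q) → k ∈ B :=
    fun k hk => (hB k).mpr (exists_pow_mul_mem_range x k hk)
  -- The sections over `D(x)` of the sheaf with local equations `g`, a module over `B = A[1/x]`.
  let Γ : (PrimeSpectrum A → Kˣ) → Submodule B K := fun g =>
    { carrier := {k | ∀ q : PrimeSpectrum A, x ∉ q.asIdeal → k * g q ∈ localSubring K q}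
      zero_mem' := fun q _ => by rw [zero_mul]; exact zero_mem _
      add_mem' := fun ha hb q hq => by rw [add_mul]; exact add_mem (ha q hq) (hb q hq)
      smul_mem' := fun b k hk q hq => by
        rw [Algebra.smul_def, mul_assoc]
        exact mul_mem (hBq b q hq) (hk q hq) }
  let J := Γ g
  let J' := Γ fun q => (g q)⁻¹
  have hg' : ∀ q : PrimeSpectrum A, x ∉ q.asIdeal → ∃ s ∉ q.asIdeal, ∀ q' : PrimeSpectrum A,
      x ∉ q'.asIdeal → s ∉ q'.asIdeal → (g q)⁻¹ / (g q')⁻¹ ∈ localUnits K q' := by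
    intro q hq
    obtain ⟨s, hs, h⟩ := hg q hq
    refine ⟨s, hs, fun q' h1 h2 => ?_⟩
    have := inv_mem (h q' h1 h2)
    rwa [div_eq_mul_inv, mul_inv] at this
  have hJJ' : J * J' = 1 := by
    refine le_antisymm ?_ ?_
    · rw [Submodule.mul_le]
      intro k hk l hl
      rw [Submodule.one_eq_range]
      refine ⟨⟨k * l, hBmem _ fun q hq => ?_⟩, rfl⟩
      have := mul_mem (hk q hq) (hl q hq)
      rwa [mul_mul_mul_comm, Units.mul_inv, mul_one] at this
    · rw [Submodule.one_le]
      let I : Ideal A :=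
        { carrier := {r | algebraMap A K r ∈ J * J'}
          zero_mem' := by simp
          add_mem' := fun {a b} ha hb => by
            simp only [Set.mem_ofPred_eq, map_add] at *
            exact add_mem ha hb
          smul_mem' := fun r a ha => by
            simp only [Set.mem_ofPred_eq, smul_eq_mul, map_mul] at *
            exact Submodule.smul_mem _ (algebraMap A B r) ha }
      -- At each prime of `D(x)` local generators of the sheaf and of its inverse multiply to a
      -- unit, so `I` lies in no such prime. Hence `I` contains a power of `x`, which is invertible
      -- in `B`.
      have hrad : x ∈ I.radical := by
        rw [Ideal.radical_eq_sInf, Ideal.mem_sInf]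
        rintro q ⟨hIq, hq⟩
        by_contra hxq
        obtain ⟨f, hf, hfq⟩ := exists_section_generating g hg (q := ⟨q, hq⟩) hxq
        obtain ⟨f', hf', hfq'⟩ := exists_section_generating (fun q => (g q)⁻¹) hg'
          (q := ⟨q, hq⟩) hxq
        have hmem : (f : K) * f' ∈ J * J' := Submodule.mul_mem_mul
          (fun q hq => by simpa using hf q hq) (fun q hq => by simpa using hf' q hq)
        have hu : f * f' ∈ localUnits K ⟨q, hq⟩ := by
          have := mul_mem hfq hfq'
          rwa [mul_mul_mul_comm, mul_inv_cancel, mul_one] at this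
        obtain ⟨a, s, hs, e⟩ := hu.1
        obtain ⟨b, t, ht, e'⟩ := hu.2
        have ha : a ∈ I := by
          change algebraMap A K a ∈ J * J'
          rw [← e, mul_comm (_ : K) (algebraMap A K s)]
          exact Submodule.smul_mem _ (algebraMap A B s) hmem
        have hab : a * b = s * t := by
          apply IsFractionRing.injective A K
          rw [map_mul, map_mul, ← e, ← e']
          have : ((f * f' : Kˣ) : K) * ((f * f')⁻¹ : Kˣ) = 1 := Units.mul_inv _
          linear_combination (algebraMap A K s * algebraMap A K t) * this
        exact hq.mul_notMem hs ht (hab ▸ Ideal.mul_mem_right _ _ (hIq ha))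
      obtain ⟨N, hN⟩ := hrad
      have hN' : algebraMap A K (x ^ N) ∈ J * J' := hN
      have hxN : algebraMap A K (x ^ N) ≠ 0 := by simpa using fun h => absurd h hx
      have hinv : (algebraMap A K (x ^ N))⁻¹ ∈ B := by
        rw [hB]
        exact ⟨N, 1, by rw [map_one, mul_inv_cancel₀ hxN]⟩
      have := Submodule.smul_mem _ (⟨_, hinv⟩ : B) hN'
      rwa [Algebra.smul_def, show algebraMap B K ⟨_, hinv⟩ = (algebraMap A K (x ^ N))⁻¹ from rfl,
        inv_mul_cancel₀ hxN] at this
  have hJu : IsUnit J := IsUnit.of_mul_eq_one _ hJJ'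
  have hproj : Module.Projective B J := Submodule.projective_of_isUnit hJu
  -- `J` is the localization of the `A`-span of finitely many generators, which has a resolution by
  -- hypothesis.
  have hres : HasFreeResolution B n J := by
    obtain ⟨T, hT⟩ : J.FG := by simpa using Submodule.fg_unit hJu.unit
    have := isLocalizedModule_id (Submonoid.powers x) K B
    have hfin : Module.Finite A (Submodule.span A (T : Set K)) :=
      Module.Finite.span_of_finite A T.finite_toSet
    have h1 := (hA (Submodule.span A (T : Set K))).localize (R' := B) (Submonoid.powers x)
      ((Submodule.span A (T : Set K)).toLocalized' B (Submonoid.powers x) LinearMap.id)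
    refine h1.congr (LinearEquiv.ofEq _ _ ?_)
    rw [Submodule.localized'_span, ← hT]
    simp
  obtain ⟨s, t, ⟨φ⟩⟩ := hres.exists_prod_equiv
  have hJ0 : J ≠ ⊥ := by
    intro h0
    rw [h0, Submodule.bot_mul] at hJJ'
    have : (1 : K) ∈ (⊥ : Submodule B K) := by rw [hJJ']; exact Submodule.one_le.mp le_rfl
    exact one_ne_zero ((Submodule.mem_bot B).mp this)
  obtain ⟨d, hd⟩ := J.exists_eq_span_singleton_of_prod_equiv hJ0 φ
  have hd0 : d ≠ 0 := by
    rintro rfl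
    exact hJ0 (by rw [hd]; simp)
  have hdJ : d ∈ J := hd ▸ Submodule.mem_span_singleton_self d
  refine ⟨Units.mk0 d hd0, fun q hq => ⟨by simpa using hdJ q hq, ?_⟩⟩
  -- The generator `d` divides a section that generates at `q`, so it generates there too.
  obtain ⟨f, hf, hfq⟩ := exists_section_generating g hg hq
  have hfJ : (f : K) ∈ J := fun q hq => by simpa using hf q hq
  rw [hd, Submodule.mem_span_singleton] at hfJ
  obtain ⟨b, hb⟩ := hfJ
  have h1 : (((Units.mk0 d hd0 * g q)⁻¹ : Kˣ) : K) = b * ((f * g q)⁻¹ : Kˣ) := by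
    rw [Algebra.smul_def, show algebraMap B K b = (b : K) from rfl] at hb
    have hf0 : (f : K) ≠ 0 := f.ne_zero
    simp only [mul_inv, Units.val_mul, Units.val_inv_eq_inv_val, Units.val_mk0]
    have : (g q : K) ≠ 0 := (g q).ne_zero
    field_simp
    rw [mul_comm, hb]
  rw [h1]
  exact mul_mem (hBq b q hq) hfq.2

end PuncturedSpectrum

end

noncomputable section

/-! ### Extension of functions and invertible sheaves over the closed point of a regular local ring
-/

section RegularPuncturedSpectrum

universe u

open IsLocalRing

variable {A : Type u} [CommRing A] [IsLocalRing A] [IsNoetherianRing A]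
  [Infinite (ResidueField A)]

/-- The quotient by `x 0` again has a regular system, hence is a domain. -/
theorem IsRegularSystem.prime_zero {n : ℕ} {x : Fin (n + 1) → A} (hx : IsRegularSystem x) :
    Prime (x 0) := by
  have hx0 : x 0 ∈ maximalIdeal A := hx.span_eq ▸ Ideal.subset_span ⟨0, rfl⟩
  have hne : x 0 ≠ 0 := fun h0 => hx.notMem_sq 0 (h0 ▸ zero_mem _)
  have : Nontrivial (A ⧸ Ideal.span {x 0}) := by
    rw [Ideal.Quotient.nontrivial_iff]
    intro h
    rw [Ideal.span_singleton_eq_top] at h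
    exact (mem_maximalIdeal _).mp hx0 h
  have : IsLocalRing (A ⧸ Ideal.span {x 0}) :=
    IsLocalRing.of_surjective' (Ideal.Quotient.mk (Ideal.span {x 0})) Ideal.Quotient.mk_surjective
  have := hx.quotient.isDomain
  rw [← Ideal.span_singleton_prime hne]
  exact (Ideal.Quotient.isDomain_iff_prime _).mp inferInstance

/-- The point of `Spec A` defined by the first member of a regular system. -/
def IsRegularSystem.primeZero {n : ℕ} {x : Fin (n + 1) → A} (hx : IsRegularSystem x) :
    PrimeSpectrum A :=
  ⟨Ideal.span {x 0}, (Ideal.span_singleton_prime hx.prime_zero.ne_zero).mpr hx.prime_zero⟩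

/-- Dimension at least two enters here: a single element cannot generate the maximal ideal. -/
theorem IsRegularSystem.primeZero_ne {n : ℕ} {x : Fin (n + 2) → A} (hx : IsRegularSystem x) :
    hx.primeZero ≠ closedPoint A := by
  intro h
  have h1 : Ideal.span {x 0} = maximalIdeal A := congrArg PrimeSpectrum.asIdeal h
  refine hx.not_pow_le_span (s := {x 0}) (d := 1) (by simp) ?_ ?_
  · rw [Finset.coe_singleton, h1]
  · rw [Finset.coe_singleton, h1, pow_one]

variable {K : Type u} [Field K] [Algebra A K] [IsFractionRing A K]

/-- Functions on the punctured spectrum extend. -/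
theorem IsRegularSystem.mem_range_of_forall_mem {n : ℕ} {x : Fin (n + 2) → A}
    (hx : IsRegularSystem x) {h : K}
    (hh : ∀ q : PrimeSpectrum A, q ≠ closedPoint A → h ∈ localSubring K q) :
    h ∈ (algebraMap A K).range := by
  have hx0 : x 0 ∈ maximalIdeal A := hx.span_eq ▸ Ideal.subset_span ⟨0, rfl⟩
  have hxK : algebraMap A K (x 0) ≠ 0 := by
    rw [Ne, IsFractionRing.to_map_eq_zero_iff]
    exact hx.prime_zero.ne_zero
  obtain ⟨N, hN⟩ := exists_pow_mul_mem_range (x 0) h fun q hq => hh q fun h0 => hq (h0 ▸ hx0)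
  induction N with
  | zero => simpa using hN
  | succ N ih =>
    refine ih ?_
    obtain ⟨a, ha⟩ := hN
    -- Regularity at the prime `(x 0)` gives a denominator prime to `x 0`, so one factor `x 0` of
    -- the denominator cancels.
    obtain ⟨b, s, hs, e⟩ := hh _ hx.primeZero_ne
    have hs' : ¬ x 0 ∣ s := fun h => hs (Ideal.mem_span_singleton.mpr h)
    have h1 : s * a = x 0 ^ (N + 1) * b := by
      apply IsFractionRing.injective A K
      rw [map_mul, map_mul, ha, ← e]
      ring
    have h2 : x 0 ∣ s * a := ⟨x 0 ^ N * b, by rw [h1]; ring⟩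
    obtain ⟨c, rfl⟩ := (hx.prime_zero.dvd_or_dvd h2).resolve_left hs'
    refine ⟨c, mul_left_cancel₀ hxK ?_⟩
    rw [← map_mul, ha, ← mul_assoc, ← map_mul, pow_succ']

/-- A nonzero rational function that is a unit away from a prime element is, locally, a power of
this element up to a unit. -/
theorem exists_zpow_mul_mem_localUnits {A K : Type u} [CommRing A] [Field K] [Algebra A K]
    [IsFractionRing A K] {x : A} (hx : Prime x)
    {y : PrimeSpectrum A} (hx0 : algebraMap A K x ≠ 0) {h : Kˣ}
    (hh : ∀ q : PrimeSpectrum A, q ≤ y → x ∉ q.asIdeal → h ∈ localUnits K q) :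
    ∃ j : ℤ, h * Units.mk0 _ hx0 ^ j ∈ localUnits K y := by
  have : IsDomain A := (IsFractionRing.injective A K).isDomain (algebraMap A K)
  -- The primes below `y` that avoid `x` are those disjoint from the monoid generated by `x` and the
  -- complement of `y`, whence the shape `x ^ N * t` of the denominator.
  have key : ∀ k : K, (∀ q : PrimeSpectrum A, q ≤ y → x ∉ q.asIdeal → k ∈ localSubring K q) →
      ∃ N, ∃ t ∉ y.asIdeal, algebraMap A K (x ^ N * t) * k ∈ (algebraMap A K).range := by
    intro k hk
    obtain ⟨r, hr, hr'⟩ := exists_mul_mem_range_of_forall_mem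
      (Submonoid.powers x ⊔ y.asIdeal.primeCompl) k fun q hq => by
        refine hk q ?_ ?_
        · intro a ha
          by_contra hay
          exact Set.disjoint_left.mp hq ha
            ((le_sup_right : y.asIdeal.primeCompl ≤ Submonoid.powers x ⊔ _) hay)
        · intro hxq
          exact Set.disjoint_left.mp hq hxq
            ((le_sup_left : Submonoid.powers x ≤ _ ⊔ y.asIdeal.primeCompl)
              (Submonoid.mem_powers x))
    obtain ⟨_, ⟨N, rfl⟩, t, ht, rfl⟩ := Submonoid.mem_sup.mp hr
    exact ⟨N, t, ht, hr'⟩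
  obtain ⟨N, t, ht, a, ha⟩ := key h fun q h1 h2 => (hh q h1 h2).1
  obtain ⟨M, u, hu, b, hb⟩ := key (h⁻¹ : Kˣ) fun q h1 h2 => (hh q h1 h2).2
  have hab : a * b = x ^ (N + M) * (t * u) := by
    apply IsFractionRing.injective A K
    rw [map_mul, ha, hb]
    have : (h : K) * (h⁻¹ : Kˣ) = 1 := Units.mul_inv h
    simp only [map_mul, map_pow]
    linear_combination (algebraMap A K x ^ (N + M) * algebraMap A K t * algebraMap A K u) * this
  -- Since `x` is prime, its powers split between `a` and `b`. The cofactor `c` divides `t * u`, so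
  -- it is a unit at `y`, and `h` is `x ^ (i - N)` times `c / t`.
  obtain ⟨i, j, c, d, hij, hcd, rfl, rfl⟩ := mul_eq_mul_prime_pow hx
    (show a * b = t * u * x ^ (N + M) by rw [hab]; ring)
  have hc : c ∉ y.asIdeal := fun h' =>
    y.2.mul_notMem ht hu (by rw [hcd]; exact Ideal.mul_mem_right _ _ h')
  refine ⟨N - i, ?_⟩
  have h1 : h * Units.mk0 _ hx0 ^ ((N : ℤ) - i) =
      Units.mk0 _ (ne_zero_of_notMem (K := K) hc) / Units.mk0 _ (ne_zero_of_notMem ht) := by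
    rw [eq_div_iff_mul_eq']
    ext
    simp only [Units.val_mul, Units.val_zpow_eq_zpow_val, Units.val_mk0]
    rw [zpow_sub₀ hx0, zpow_natCast, zpow_natCast]
    simp only [map_mul, map_pow] at ha
    have := pow_ne_zero i hx0
    field_simp
    linear_combination -ha
  rw [h1]
  exact div_mem (mk0_mem_localUnits hc) (mk0_mem_localUnits ht)

/-- Invertible sheaves on the punctured spectrum of a regular local ring are trivial. -/
theorem IsRegularSystem.exists_mul_mem_localUnits {n : ℕ} {x : Fin (n + 2) → A}
    (hx : IsRegularSystem x) (g : PrimeSpectrum A → Kˣ)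
    (hg : ∀ q ≠ closedPoint A, ∃ s ∉ q.asIdeal, ∀ q' ≠ closedPoint A, s ∉ q'.asIdeal →
      g q / g q' ∈ localUnits K q') :
    ∃ f : Kˣ, ∀ q ≠ closedPoint A, f * g q ∈ localUnits K q := by
  have := hx.isDomain
  have hx0 : x 0 ∈ maximalIdeal A := hx.span_eq ▸ Ideal.subset_span ⟨0, rfl⟩
  have hne : ∀ q : PrimeSpectrum A, x 0 ∉ q.asIdeal → q ≠ closedPoint A :=
    fun q hq h0 => hq (h0 ▸ hx0)
  have hxK : algebraMap A K (x 0) ≠ 0 := by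
    rw [Ne, IsFractionRing.to_map_eq_zero_iff]
    exact hx.prime_zero.ne_zero
  let ϖ : Kˣ := Units.mk0 _ hxK
  have hspec : ∀ q ≠ closedPoint A, ∀ q' ≤ q, g q / g q' ∈ localUnits K q' := by
    intro q hq q' hq'
    obtain ⟨s, hs, h⟩ := hg q hq
    refine h q' ?_ fun hs' => hs (hq' hs')
    rintro rfl
    exact hq (le_antisymm (le_maximalIdeal q.2.ne_top) hq')
  obtain ⟨f, hf⟩ := exists_mul_mem_localUnits_of_hasFreeResolution (K := K)
    (fun M _ _ _ => hx.hasFreeResolution M) hx.prime_zero.ne_zero g fun q hq => by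
      obtain ⟨s, hs, h⟩ := hg q (hne q hq)
      exact ⟨s, hs, fun q' h1 h2 => h q' (hne q' h1) h2⟩
  -- After trivialization off `x 0 = 0`, only a power of `ϖ` can obstruct at each remaining point.
  have hloc : ∀ y ≠ closedPoint A, ∃ j : ℤ, f * g y * ϖ ^ j ∈ localUnits K y := by
    intro y hy
    refine exists_zpow_mul_mem_localUnits hx.prime_zero hxK fun q hq hxq => ?_
    have := mul_mem (hf q hxq) (hspec y hy q hq)
    rwa [mul_assoc, mul_div_cancel] at this
  -- The exponent is determined at the generic point of `x 0 = 0`.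
  have hpow : ∀ j : ℤ, ϖ ^ j ∈ localUnits K hx.primeZero → j = 0 := by
    have hnat : ∀ j : ℕ, (ϖ ^ j)⁻¹ ∈ localUnits K hx.primeZero → j = 0 := by
      intro j hj
      by_contra hj0
      obtain ⟨a, s, hs, e⟩ := hj.1
      apply hs
      have : s = x 0 ^ j * a := by
        apply IsFractionRing.injective A K
        rw [map_mul, ← e, map_pow, ← mul_assoc]
        have : (algebraMap A K (x 0)) ^ j * (((ϖ ^ j)⁻¹ : Kˣ) : K) = 1 := by
          have := Units.mul_inv (ϖ ^ j)
          simpa [ϖ] using this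
        rw [this, one_mul]
      rw [this]
      exact Ideal.mul_mem_right _ _ (Ideal.pow_mem_of_mem _ (Ideal.mem_span_singleton_self _) _
        (Nat.pos_of_ne_zero hj0))
    intro j hj
    obtain ⟨k, rfl | rfl⟩ := j.eq_nat_or_neg
    · rw [zpow_natCast, ← inv_mem_iff] at hj
      simpa using hnat k hj
    · rw [zpow_neg, zpow_natCast] at hj
      simpa using hnat k hj
  obtain ⟨j₀, hj₀⟩ := hloc hx.primeZero hx.primeZero_ne
  -- Every point `y` of `x 0 = 0` specializes from `(x 0)`, so its exponent equals `j₀`, and one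
  -- correction works everywhere.
  refine ⟨f * ϖ ^ j₀, fun y hy => ?_⟩
  by_cases hxy : x 0 ∈ y.asIdeal
  · obtain ⟨j, hj⟩ := hloc y hy
    have hle : hx.primeZero ≤ y := by
      change Ideal.span {x 0} ≤ y.asIdeal
      rwa [Ideal.span_singleton_le_iff_mem]
    have h1 := div_mem (localUnits_mono hle hj) (mul_mem hj₀ (hspec y hy _ hle))
    have h2 : f * g y * ϖ ^ j / (f * g hx.primeZero * ϖ ^ j₀ * (g y / g hx.primeZero)) =
        ϖ ^ (j - j₀) := by
      rw [zpow_sub, div_eq_iff_eq_mul, div_eq_mul_inv]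
      have : g hx.primeZero * (g hx.primeZero)⁻¹ = 1 := mul_inv_cancel _
      calc f * g y * ϖ ^ j = f * g y * ϖ ^ j * (ϖ ^ j₀ * (ϖ ^ j₀)⁻¹) *
            (g hx.primeZero * (g hx.primeZero)⁻¹) := by simp
        _ = _ := by
          simp only [mul_comm, mul_left_comm, mul_assoc]
    rw [h2] at h1
    have : j = j₀ := by have := hpow _ h1; omega
    subst this
    rwa [mul_right_comm] at hj
  · rw [mul_right_comm]
    refine mul_mem (hf y hxy) (zpow_mem ?_ _)
    exact mk0_mem_localUnits hxy

end RegularPuncturedSpectrum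

end

noncomputable section

namespace CoxRing

universe u

/-! ### Local rings inside the function field -/

section PrimeOf

variable {X : Scheme.{u}}

/-- The prime ideal of the local ring at `x` defined by a generization of `x`. -/
def primeOf {x y : X} (h : y ⤳ x) : PrimeSpectrum (X.presheaf.stalk x) :=
  PrimeSpectrum.comap (X.presheaf.stalkSpecializes h).hom
    (IsLocalRing.closedPoint (X.presheaf.stalk y))

theorem notMem_primeOf {x y : X} (h : y ⤳ x) (a : X.presheaf.stalk x) :
    a ∉ (primeOf h).asIdeal ↔ IsUnit (X.presheaf.stalkSpecializes h a) := by
  change ¬ (X.presheaf.stalkSpecializes h a ∈ IsLocalRing.maximalIdeal _) ↔ _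
  rw [IsLocalRing.mem_maximalIdeal, mem_nonunits_iff, not_not]

theorem fromSpecStalk_primeOf {x y : X} (h : y ⤳ x) :
    X.fromSpecStalk x (primeOf h) = y := by
  have := Scheme.fromSpecStalk_closedPoint (x := y)
  rw [← Scheme.SpecMap_stalkSpecializes_fromSpecStalk h] at this
  exact this

theorem specializes_of_fromSpecStalk (x : X) (q : PrimeSpectrum (X.presheaf.stalk x)) :
    X.fromSpecStalk x q ⤳ x := by
  have : X.fromSpecStalk x q ∈ Set.range (X.fromSpecStalk x) := ⟨q, rfl⟩
  rwa [Scheme.range_fromSpecStalk] at this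

theorem primeOf_fromSpecStalk (x : X) (q : PrimeSpectrum (X.presheaf.stalk x)) :
    primeOf (specializes_of_fromSpecStalk x q) = q :=
  (X.fromSpecStalk x).isEmbedding.injective (fromSpecStalk_primeOf _)

theorem primeOf_eq_closedPoint_iff {x y : X} (h : y ⤳ x) :
    primeOf h = IsLocalRing.closedPoint _ ↔ y = x := by
  constructor
  · intro h'
    rw [← fromSpecStalk_primeOf h, h', Scheme.fromSpecStalk_closedPoint]
  · rintro rfl
    apply (X.fromSpecStalk y).isEmbedding.injective
    exact (fromSpecStalk_primeOf h).trans Scheme.fromSpecStalk_closedPoint.symm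

end PrimeOf

section StalkRange

variable {X : Scheme.{u}} [IsIntegral X]

instance (x : X) : IsFractionRing (X.presheaf.stalk x) (FunField X) :=
  inferInstanceAs (IsFractionRing (X.presheaf.stalk x) X.functionField)

/-- The local ring at `x`, inside the function field. -/
abbrev stalkRange (x : X) : Subring (FunField X) :=
  (algebraMap (X.presheaf.stalk x) (FunField X)).range

theorem unitsAt_eq (x : X) : unitsAt X x = (stalkRange x).unitGroup := by
  ext u
  constructor
  · rintro ⟨v, rfl⟩
    exact ⟨⟨v, rfl⟩, ⟨(v⁻¹ : (X.presheaf.stalk x)ˣ), rfl⟩⟩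
  · rintro ⟨⟨a, ha⟩, ⟨b, hb⟩⟩
    have hab : a * b = 1 := by
      apply IsFractionRing.injective (X.presheaf.stalk x) (FunField X)
      rw [map_mul, ha, hb, map_one, Units.mul_inv]
    refine ⟨⟨a, b, hab, by rw [mul_comm, hab]⟩, ?_⟩
    ext
    exact ha

theorem algebraMap_stalkSpecializes {x y : X} (h : y ⤳ x) (a : X.presheaf.stalk x) :
    algebraMap (X.presheaf.stalk y) (FunField X) (X.presheaf.stalkSpecializes h a) =
      algebraMap (X.presheaf.stalk x) (FunField X) a := by
  change (X.presheaf.stalkSpecializes h ≫ X.presheaf.stalkSpecializes _) a = _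
  rw [TopCat.Presheaf.stalkSpecializes_comp]
  rfl

theorem exists_open_forall_mem_stalkRange {x : X} {f : FunField X} (hf : f ∈ stalkRange x) :
    ∃ U : X.Opens, x ∈ U ∧ ∀ y ∈ U, f ∈ stalkRange y := by
  obtain ⟨a, rfl⟩ := hf
  obtain ⟨U, hxU, s, rfl⟩ := X.presheaf.exists_germ_eq a
  exact ⟨U, hxU, fun y hy => ⟨_, toFunField_eq hy hxU s⟩⟩

/-- Transfers statements about the spectrum of a local ring to generizations of a point of `X`.
Regular functions at `y` are fractions of sections over an affine open containing `x`, which gives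
the harder inclusion. -/
theorem localSubring_primeOf {x y : X} (h : y ⤳ x) :
    localSubring (FunField X) (primeOf h) = stalkRange y := by
  apply le_antisymm
  · rintro f ⟨a, s, hs, e⟩
    rw [notMem_primeOf] at hs
    obtain ⟨v, hv⟩ := hs
    refine ⟨X.presheaf.stalkSpecializes h a * ↑v⁻¹, ?_⟩
    rw [map_mul, algebraMap_stalkSpecializes, ← e, ← algebraMap_stalkSpecializes h s, ← hv,
      mul_assoc, ← map_mul, Units.mul_inv, map_one, mul_one]
  · rintro _ ⟨a, rfl⟩
    obtain ⟨_, ⟨U, hU, rfl⟩, hxU, -⟩ := X.isBasis_affineOpens.exists_subset_of_mem_open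
      (Set.mem_univ x) isOpen_univ
    have hyU : y ∈ U := h.mem_open U.2 hxU
    let := TopCat.Presheaf.algebra_section_stalk X.presheaf (⟨y, hyU⟩ : U)
    have := hU.isLocalization_stalk ⟨y, hyU⟩
    obtain ⟨⟨b, s⟩, hbs⟩ := IsLocalization.surj (hU.primeIdealOf ⟨y, hyU⟩).asIdeal.primeCompl a
    have hu := IsLocalization.map_units (X.presheaf.stalk y) s
    have hbs' : a * X.presheaf.germ U y hyU s.1 = X.presheaf.germ U y hyU b := hbs
    have hspec : ∀ c, X.presheaf.stalkSpecializes h (X.presheaf.germ U x hxU c) =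
        X.presheaf.germ U y hyU c := fun c => X.presheaf.germ_stalkSpecializes_apply hxU h c
    refine ⟨X.presheaf.germ U x hxU b, X.presheaf.germ U x hxU s.1, ?_, ?_⟩
    · rw [notMem_primeOf, hspec]
      exact hu
    · rw [← algebraMap_stalkSpecializes h, ← algebraMap_stalkSpecializes h, hspec, hspec, ← map_mul,
        hbs']

theorem localUnits_primeOf {x y : X} (h : y ⤳ x) :
    localUnits (FunField X) (primeOf h) = unitsAt X y := by
  rw [unitsAt_eq, localUnits, localSubring_primeOf]

/-- A function regular off the zeros of `e` near `x` becomes regular after multiplication by a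
power of `e`. -/
theorem exists_pow_mul_mem_stalkRange {x : X} {e : FunField X} (he : e ∈ stalkRange x)
    {h : FunField X} (H : ∀ y : X, y ⤳ x → e⁻¹ ∈ stalkRange y → h ∈ stalkRange y) :
    ∃ N, e ^ N * h ∈ stalkRange x := by
  obtain ⟨s, rfl⟩ := he
  obtain ⟨N, hN⟩ := exists_pow_mul_mem_range s h fun q hq => by
    rw [← primeOf_fromSpecStalk x q] at hq ⊢
    rw [localSubring_primeOf]
    refine H _ (specializes_of_fromSpecStalk x q) ?_
    rw [← localSubring_primeOf (specializes_of_fromSpecStalk x q)]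
    exact (mk0_mem_localUnits hq).2
  rw [map_pow] at hN
  exact ⟨N, hN⟩

end StalkRange

end CoxRing

end

noncomputable section

namespace CoxRing

universe u

/-! ### Inverse images of ideal sheaves -/

section Comap

open Scheme.IdealSheafData

variable {X Y : Scheme.{u}}

/-- Both inequalities come from the adjunction between inverse and direct image of ideal sheaves;
the first is tested on the ideal sheaf of the extended ideal. -/
theorem ideal_comap_of_isAffine [IsAffine X] [IsAffine Y] (I : Y.IdealSheafData) (f : X ⟶ Y) :
    (I.comap f).ideal ⟨⊤, isAffineOpen_top X⟩ =
      (I.ideal ⟨⊤, isAffineOpen_top Y⟩).map f.appTop.hom := by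
  apply le_antisymm
  · let J : X.IdealSheafData := ofIdealTop ((I.ideal ⟨⊤, isAffineOpen_top Y⟩).map f.appTop.hom)
    have hJ : J.ideal ⟨⊤, isAffineOpen_top X⟩ =
        (I.ideal ⟨⊤, isAffineOpen_top Y⟩).map f.appTop.hom := by simp [J]
    have h : I.comap f ≤ J := by
      rw [← le_map_iff_comap_le]
      apply le_of_isAffine
      rw [ideal_map_of_isAffineHom]
      exact Ideal.map_le_iff_le_comap.mp hJ.ge
    exact (h _).trans hJ.le
  · rw [Ideal.map_le_iff_le_comap]
    have := le_map_comap I f ⟨⊤, isAffineOpen_top Y⟩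
    rwa [ideal_map_of_isAffineHom] at this

theorem ideal_comap_of_isOpenImmersion_of_le (I : Y.IdealSheafData) (f : X ⟶ Y)
    [IsOpenImmersion f] {V : Y.Opens} (hV : IsAffineOpen V) {W : X.Opens} (hW : IsAffineOpen W)
    (h : W ≤ f ⁻¹ᵁ V) :
    (I.comap f).ideal ⟨W, hW⟩ = (I.ideal ⟨V, hV⟩).map (f.appLE V W h).hom := by
  have hle : f ''ᵁ W ≤ V := by
    rintro _ ⟨y, hy, rfl⟩
    exact h hy
  have h0 := I.map_ideal (V := ⟨V, hV⟩) (U := ⟨f ''ᵁ W, hW.image_of_isOpenImmersion f⟩) hle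
  refine (ideal_comap_of_isOpenImmersion I f ⟨W, hW⟩).trans ?_
  have h1 : ∀ J : Ideal Γ(Y, f ''ᵁ W), J.comap (f.appIso W).inv.hom =
      J.map (f.appIso W).hom.hom :=
    fun J => (Ideal.map_comap_of_equiv (f.appIso W).commRingCatIsoToRingEquiv).symm
  refine (h1 _).trans ?_
  refine (congrArg (Ideal.map (f.appIso W).hom.hom) h0.symm).trans ?_
  rw [Ideal.map_map, ← CommRingCat.hom_comp, Scheme.Hom.appIso_hom']
  congr 2
  exact Scheme.Hom.map_appLE _ _ _

/-- Restricting to the affine schemes `W` and `V` combines the affine case with that of open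
immersions. The two restriction maps give an equality after extension along an isomorphism, which
can be undone. -/
theorem ideal_comap_of_le (I : Y.IdealSheafData) (f : X ⟶ Y) {V : Y.Opens} (hV : IsAffineOpen V)
    {W : X.Opens} (hW : IsAffineOpen W) (h : W ≤ f ⁻¹ᵁ V) :
    (I.comap f).ideal ⟨W, hW⟩ = (I.ideal ⟨V, hV⟩).map (f.appLE V W h).hom := by
  have : IsAffine W := hW
  have : IsAffine V := hV
  let i : W.toScheme ⟶ V.toScheme := f.resLE V W h
  have hi : i ≫ V.ι = W.ι ≫ f := f.resLE_comp_ι h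
  have h1 : (⊤ : W.toScheme.Opens) ≤ W.ι ⁻¹ᵁ W := by simp
  have h2 : (⊤ : V.toScheme.Opens) ≤ V.ι ⁻¹ᵁ V := by simp
  have e1 := ideal_comap_of_isOpenImmersion_of_le (I.comap f) W.ι hW
    (isAffineOpen_top W.toScheme) h1
  have e2 : ((I.comap f).comap W.ι).ideal ⟨⊤, isAffineOpen_top _⟩ =
      ((I.ideal ⟨V, hV⟩).map (V.ι.appLE V ⊤ h2).hom).map i.appTop.hom := by
    rw [← comap_comp, ← hi, comap_comp, ideal_comap_of_isAffine,
      ideal_comap_of_isOpenImmersion_of_le _ _ hV (isAffineOpen_top _) h2]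
  have e3 : V.ι.appLE V ⊤ h2 ≫ i.appTop = f.appLE V W h ≫ W.ι.appLE W ⊤ h1 := by
    have h3 : (⊤ : W.toScheme.Opens) ≤ i ⁻¹ᵁ ⊤ := le_of_eq rfl
    have : i.appTop = i.appLE ⊤ ⊤ h3 := by simp [Scheme.Hom.appTop, Scheme.Hom.app_eq_appLE]
    rw [this, Scheme.Hom.appLE_comp_appLE, Scheme.Hom.appLE_comp_appLE]
    simp only [hi]
  rw [e1, Ideal.map_map, ← CommRingCat.hom_comp, e3, CommRingCat.hom_comp, ← Ideal.map_map] at e2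
  have hiso : IsIso (W.ι.appLE W ⊤ h1) := by
    have h4 : W.ι.appLE W ⊤ h1 = W.topIso.inv := by
      simp [Scheme.Opens.topIso]
      rfl
    rw [h4]
    infer_instance
  have h5 : Function.LeftInverse (Ideal.map (inv (W.ι.appLE W ⊤ h1)).hom)
      (Ideal.map (W.ι.appLE W ⊤ h1).hom) := by
    intro J
    rw [Ideal.map_map, ← CommRingCat.hom_comp, IsIso.hom_inv_id]
    exact Ideal.map_id J
  exact h5.injective e2

theorem comap_eq_top_of_forall_notMem (I : Y.IdealSheafData) (f : X ⟶ Y)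
    (h : ∀ x : X, f x ∉ I.support) : I.comap f = ⊤ := by
  rw [← support_eq_bot_iff, support_comap]
  ext x
  simpa using h x

theorem isInvertibleIdeal_top : IsInvertibleIdeal (⊤ : X.IdealSheafData) := by
  intro x
  obtain ⟨_, ⟨U, hU, rfl⟩, hxU, -⟩ := X.isBasis_affineOpens.exists_subset_of_mem_open
    (Set.mem_univ x) isOpen_univ
  exact ⟨⟨U, hU⟩, hxU, 1, one_mem _, by simp⟩

end Comap

section PointIdeal

variable {X Y : Scheme.{u}} {p : Y} (hp : IsClosed ({p} : Set Y))

theorem mem_support_pointIdeal {y : Y} : y ∈ (pointIdeal p hp).support ↔ y = p := by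
  change y ∈ ((Scheme.IdealSheafData.vanishingIdeal ⟨{p}, hp⟩).support : Set Y) ↔ _
  rw [Scheme.IdealSheafData.coe_support_vanishingIdeal]
  rfl

/-- On an affine open the ideal is the prime of `p`, and its localization at `p` is the maximal
ideal. -/
theorem map_germ_ideal_pointIdeal {V : Y.Opens} (hV : IsAffineOpen V) (hpV : p ∈ V) :
    ((pointIdeal p hp).ideal ⟨V, hV⟩).map (Y.presheaf.germ V p hpV).hom =
      IsLocalRing.maximalIdeal (Y.presheaf.stalk p) := by
  let q := hV.primeIdealOf ⟨p, hpV⟩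
  have h1 : (pointIdeal p hp).ideal ⟨V, hV⟩ = q.asIdeal := by
    rw [pointIdeal, Scheme.IdealSheafData.vanishingIdeal_ideal]
    have : hV.fromSpec ⁻¹' ({p} : Set Y) = {q} := by
      ext z
      change hV.fromSpec z = p ↔ z = q
      have hq : hV.fromSpec q = p := hV.fromSpec_primeIdealOf ⟨p, hpV⟩
      constructor
      · intro hz
        exact hV.fromSpec.isOpenEmbedding.injective (hz.trans hq.symm)
      · rintro rfl
        exact hq
    exact (congrArg PrimeSpectrum.vanishingIdeal this).trans
      (PrimeSpectrum.vanishingIdeal_singleton q)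
  rw [h1]
  let := TopCat.Presheaf.algebra_section_stalk Y.presheaf (⟨p, hpV⟩ : V)
  have := hV.isLocalization_stalk ⟨p, hpV⟩
  exact IsLocalization.AtPrime.map_eq_maximalIdeal q.asIdeal (Y.presheaf.stalk p)

theorem map_germ_ideal_of_le (I : X.IdealSheafData) {V W : X.Opens} (hV : IsAffineOpen V)
    (hW : IsAffineOpen W) {x : X} (hx : x ∈ W) (h : W ≤ V) :
    (I.ideal ⟨V, hV⟩).map (X.presheaf.germ V x (h hx)).hom =
      (I.ideal ⟨W, hW⟩).map (X.presheaf.germ W x hx).hom := by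
  have h0 := I.map_ideal (V := ⟨V, hV⟩) (U := ⟨W, hW⟩) h
  rw [← h0, Ideal.map_map, ← CommRingCat.hom_comp]
  congr 2
  exact (X.presheaf.germ_res (homOfLE h) x hx).symm

/-- The stalk of the inverse image of the ideal sheaf of a point. -/
theorem map_stalkMap_maximalIdeal (f : X ⟶ Y) {x : X} (hp : IsClosed ({f x} : Set Y))
    {W : X.Opens} (hW : IsAffineOpen W) (hx : x ∈ W) :
    (IsLocalRing.maximalIdeal (Y.presheaf.stalk (f x))).map (f.stalkMap x).hom =
      (((pointIdeal (f x) hp).comap f).ideal ⟨W, hW⟩).map (X.presheaf.germ W x hx).hom := by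
  obtain ⟨_, ⟨V, hV, rfl⟩, hxV, -⟩ := Y.isBasis_affineOpens.exists_subset_of_mem_open
    (Set.mem_univ (f x)) isOpen_univ
  obtain ⟨_, ⟨W', hW', rfl⟩, hxW', hWV⟩ := X.isBasis_affineOpens.exists_subset_of_mem_open
    (show x ∈ ((W ⊓ f ⁻¹ᵁ V : X.Opens) : Set X) from ⟨hx, hxV⟩) (W ⊓ f ⁻¹ᵁ V).isOpen
  have hle : W' ≤ W := fun y hy => (hWV hy).1
  have hle' : W' ≤ f ⁻¹ᵁ V := fun y hy => (hWV hy).2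
  refine Eq.trans ?_ (map_germ_ideal_of_le _ hW hW' hxW' hle).symm
  rw [ideal_comap_of_le _ f hV hW' hle', Ideal.map_map,
    ← map_germ_ideal_pointIdeal hp hV hxV, Ideal.map_map, ← CommRingCat.hom_comp,
    ← CommRingCat.hom_comp, Scheme.Hom.germ_stalkMap, Scheme.Hom.appLE, Category.assoc,
    TopCat.Presheaf.germ_res]

theorem fromSpecStalk_appLE {V : Y.Opens} (hpV : p ∈ V)
    (h : (⊤ : (Spec (Y.presheaf.stalk p)).Opens) ≤ Y.fromSpecStalk p ⁻¹ᵁ V) :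
    (Y.fromSpecStalk p).appLE V ⊤ h =
      Y.presheaf.germ V p hpV ≫ (Scheme.ΓSpecIso (Y.presheaf.stalk p)).inv := by
  rw [Scheme.Hom.appLE, Scheme.fromSpecStalk_app hpV, Category.assoc, Category.assoc,
    ← Functor.map_comp]
  congr 1

theorem SpecMap_appLE_top {B C : CommRingCat.{u}} (φ : B ⟶ C)
    (h : (⊤ : (Spec C).Opens) ≤ Spec.map φ ⁻¹ᵁ ⊤) :
    (Spec.map φ).appLE ⊤ ⊤ h = (Spec.map φ).appTop := by
  simp [Scheme.Hom.appTop, Scheme.Hom.app_eq_appLE]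

/-- The criterion by which the universal property applies to spectra of domains over the local ring
at `p`. -/
theorem isInvertibleIdeal_comap_Spec {B : CommRingCat.{u}} [IsDomain B]
    (φ : Y.presheaf.stalk p ⟶ B) {b : B} (hb : b ≠ 0)
    (h : (IsLocalRing.maximalIdeal (Y.presheaf.stalk p)).map φ.hom = Ideal.span {b}) :
    IsInvertibleIdeal ((pointIdeal p hp).comap (Spec.map φ ≫ Y.fromSpecStalk p)) := by
  obtain ⟨_, ⟨V, hV, rfl⟩, hpV, -⟩ := Y.isBasis_affineOpens.exists_subset_of_mem_open
    (Set.mem_univ p) isOpen_univ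
  let f := Spec.map φ ≫ Y.fromSpecStalk p
  have hf : (⊤ : (Spec B).Opens) ≤ f ⁻¹ᵁ V := by
    intro t _
    have : f t ∈ Set.range (Y.fromSpecStalk p) := ⟨Spec.map φ t, rfl⟩
    rw [Scheme.range_fromSpecStalk] at this
    exact this.mem_open V.2 hpV
  have h1 : (⊤ : (Spec (Y.presheaf.stalk p)).Opens) ≤ Y.fromSpecStalk p ⁻¹ᵁ V := by
    intro t _
    have : Y.fromSpecStalk p t ∈ Set.range (Y.fromSpecStalk p) := ⟨t, rfl⟩
    rw [Scheme.range_fromSpecStalk] at this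
    exact this.mem_open V.2 hpV
  have happ : f.appLE V ⊤ hf = Y.presheaf.germ V p hpV ≫ φ ≫ (Scheme.ΓSpecIso B).inv := by
    have h2 : (⊤ : (Spec B).Opens) ≤ Spec.map φ ⁻¹ᵁ ⊤ := le_of_eq rfl
    rw [← Scheme.Hom.appLE_comp_appLE _ _ V ⊤ ⊤ h1 h2, SpecMap_appLE_top, fromSpecStalk_appLE hpV h1, Category.assoc,
      ← Scheme.ΓSpecIso_inv_naturality]
  intro t
  refine ⟨⟨⊤, isAffineOpen_top _⟩, trivial, (Scheme.ΓSpecIso B).inv b, ?_, ?_⟩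
  · have : IsDomain Γ(Spec B, ⊤) :=
      (Scheme.ΓSpecIso B).symm.commRingCatIsoToRingEquiv.isDomain_iff.mp inferInstance
    apply mem_nonZeroDivisors_of_ne_zero
    intro h0
    apply hb
    have := congrArg (Scheme.ΓSpecIso B).hom h0
    simpa using this
  · rw [ideal_comap_of_le _ f hV (isAffineOpen_top _) hf, happ, CommRingCat.hom_comp,
      CommRingCat.hom_comp, ← Ideal.map_map, ← Ideal.map_map,
      map_germ_ideal_pointIdeal hp hV hpV, h, Ideal.map_span, Set.image_singleton]

end PointIdeal

end CoxRing

end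

noncomputable section

namespace CoxRing

universe u

/-! ### The blow-up of a point away from the centre -/

section OffCentre

variable {X Y : Scheme.{u}} {p : Y} {hp : IsClosed ({p} : Set Y)} {π : X ⟶ Y}

/-- The complement of a closed point. -/
def compl (p : Y) (hp : IsClosed ({p} : Set Y)) : Y.Opens := ⟨{p}ᶜ, hp.isOpen_compl⟩

theorem isInvertibleIdeal_comap_of_forall_ne {T : Scheme.{u}} (f : T ⟶ Y) (h : ∀ t, f t ≠ p) :
    IsInvertibleIdeal ((pointIdeal p hp).comap f) := by
  rw [comap_eq_top_of_forall_notMem]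
  · exact isInvertibleIdeal_top
  · intro t ht
    exact h t ((mem_support_pointIdeal hp).mp ht)

/-- The inclusion of the complement of `p` pulls the ideal back to the unit ideal, so it lifts to
`X`; uniqueness of lifts makes the lift inverse to `π`. -/
theorem IsBlowUp.isIso_morphismRestrict (hπ : IsBlowUp (pointIdeal p hp) π) :
    IsIso (π ∣_ compl p hp) := by
  let U := compl p hp
  have hU : ∀ t, U.ι t ≠ p := fun t => t.2
  obtain ⟨σ, hσ, -⟩ := hπ.existsUnique_lift U U.ι (isInvertibleIdeal_comap_of_forall_ne _ hU)
  have hV : ∀ t, ((π ⁻¹ᵁ U).ι ≫ π) t ≠ p := fun t => t.2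
  have h1 : (π ∣_ U) ≫ σ = (π ⁻¹ᵁ U).ι := by
    refine (hπ.existsUnique_lift _ ((π ⁻¹ᵁ U).ι ≫ π)
      (isInvertibleIdeal_comap_of_forall_ne _ hV)).unique ?_ rfl
    rw [Category.assoc, hσ, morphismRestrict_ι]
  have hr : Set.range σ ⊆ Set.range (π ⁻¹ᵁ U).ι := by
    rintro _ ⟨t, rfl⟩
    rw [Scheme.Opens.range_ι]
    change π (σ t) ∈ U
    rw [← Scheme.Hom.comp_apply, hσ]
    exact t.2
  refine ⟨IsOpenImmersion.lift (π ⁻¹ᵁ U).ι σ hr, ?_, ?_⟩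
  · rw [← cancel_mono (π ⁻¹ᵁ U).ι, Category.assoc, IsOpenImmersion.lift_fac, h1, Category.id_comp]
  · rw [← cancel_mono U.ι, Category.assoc, morphismRestrict_ι, IsOpenImmersion.lift_fac_assoc, hσ,
      Category.id_comp]

theorem IsBlowUp.isIso_stalkMap (hπ : IsBlowUp (pointIdeal p hp) π) {x : X} (hx : π x ≠ p) :
    IsIso (π.stalkMap x) := by
  have := hπ.isIso_morphismRestrict
  let z : (π ⁻¹ᵁ compl p hp).toScheme := ⟨x, hx⟩
  have h : IsIso ((π ∣_ compl p hp).stalkMap z) := inferInstance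
  exact ((MorphismProperty.isomorphisms _).arrow_mk_iso_iff
    (morphismRestrictStalkMap π (compl p hp) z)).mp h

theorem IsBlowUp.exists_eq (hπ : IsBlowUp (pointIdeal p hp) π) {y : Y} (hy : y ≠ p) :
    ∃ x, π x = y := by
  have := hπ.isIso_morphismRestrict
  obtain ⟨x, hx⟩ := (π ∣_ compl p hp).homeomorph.surjective ⟨y, hy⟩
  exact ⟨x.1, (morphismRestrict_base_coe π _ x).symm.trans (congrArg Subtype.val hx)⟩

/-- Away from the centre, the blow-up is injective and open. -/
theorem IsBlowUp.exists_open (hπ : IsBlowUp (pointIdeal p hp) π) {x : X} (hx : π x ≠ p)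
    {W : X.Opens} (hxW : x ∈ W) :
    ∃ V : Y.Opens, π x ∈ V ∧ p ∉ V ∧ ∀ x', π x' ∈ V → x' ∈ W := by
  have := hπ.isIso_morphismRestrict
  let U := compl p hp
  let e := (π ∣_ U).homeomorph
  have he : ∀ z, (e z).1 = π z.1 := fun z => morphismRestrict_base_coe π _ z
  let W' : Set (π ⁻¹ᵁ U) := {z | z.1 ∈ W}
  have hW' : IsOpen W' := W.2.preimage continuous_subtype_val
  have hV : IsOpen (Subtype.val '' (e '' W')) :=
    U.2.isOpenMap_subtype_val _ (e.isOpenMap _ hW')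
  refine ⟨⟨_, hV⟩, ⟨e ⟨x, hx⟩, ⟨⟨x, hx⟩, hxW, rfl⟩, he _⟩, ?_, ?_⟩
  · rintro ⟨z, -, hz⟩
    exact z.2 hz
  · rintro x' ⟨_, ⟨z, hz, rfl⟩, hz'⟩
    have hx' : π x' ∈ U := by rw [← hz']; exact (e z).2
    have : e z = e ⟨x', hx'⟩ := Subtype.ext (hz'.trans (he ⟨x', hx'⟩).symm)
    have := e.injective this
    subst this
    exact hz

end OffCentre

/-! ### The isomorphism of function fields -/

section FunctionField

variable {X Y : Scheme.{u}} [IsIntegral X] {p : Y} {hp : IsClosed ({p} : Set Y)}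
  {π : X ⟶ Y}

/-- Otherwise `π` would map all of `X` into the closed set `{p}`, although it hits every other
point. -/
theorem IsBlowUp.genericPoint_ne (hπ : IsBlowUp (pointIdeal p hp) π) (hne : ∃ y, y ≠ p) :
    π (genericPoint X) ≠ p := by
  obtain ⟨y, hy⟩ := hne
  obtain ⟨x, rfl⟩ := hπ.exists_eq hy
  intro h
  have h1 : π (genericPoint X) ⤳ π x :=
    (genericPoint_specializes x).map π.continuous
  rw [h] at h1
  exact hy (h1.mem_closed hp rfl)

/-- The isomorphism of function fields defined by the blow-up of a point. -/
theorem IsBlowUp.exists_funFieldEquiv [IsIntegral Y] (hπ : IsBlowUp (pointIdeal p hp) π) (hne : ∃ y, y ≠ p) :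
    ∃ φ : FunField Y ≃+* FunField X, ∀ (x : X) (a : Y.presheaf.stalk (π x)),
      φ (algebraMap _ _ a) = algebraMap _ _ (π.stalkMap x a) := by
  have := hπ.isIso_stalkMap (hπ.genericPoint_ne hne)
  let ξ := genericPoint X
  let e : Y.presheaf.stalk (π ξ) ≃+* X.presheaf.stalk ξ :=
    (asIso (π.stalkMap ξ)).commRingCatIsoToRingEquiv
  refine ⟨IsFractionRing.ringEquivOfRingEquiv e, fun x a => ?_⟩
  have hs : ξ ⤳ x := genericPoint_specializes x
  rw [← algebraMap_stalkSpecializes (hs.map π.continuous) a]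
  refine (IsFractionRing.ringEquivOfRingEquiv_algebraMap e _).trans ?_
  rw [← algebraMap_stalkSpecializes hs]
  exact congrArg _ (Scheme.Hom.stalkSpecializes_stalkMap_apply π ξ x hs a)

end FunctionField

end CoxRing

end

noncomputable section

/-! ### Fractions with denominators of minimal order -/

section BlowUpSubring

open IsLocalRing

variable {A O : Type*} [CommRing A] [IsLocalRing A] [CommRing O] (ψ : A →+* O) (e : O)

/-- The fractions `ψ y / ψ z` with `y, z ∈ 𝔪ⁱ` and `ψ z` associated to `eⁱ`. -/
def blowUpSubring : Subring O where
  carrier := {w | ∃ (i : ℕ) (y z : A), y ∈ maximalIdeal A ^ i ∧ z ∈ maximalIdeal A ^ i ∧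
    Associated (ψ z) (e ^ i) ∧ w * ψ z = ψ y}
  zero_mem' := ⟨0, 0, 1, by simp, by simp, by simp, by simp⟩
  one_mem' := ⟨0, 1, 1, by simp, by simp, by simp, by simp⟩
  add_mem' := by
    rintro w w' ⟨i, y, z, hy, hz, h, e₁⟩ ⟨i', y', z', hy', hz', h', e₂⟩
    refine ⟨i + i', y * z' + z * y', z * z', ?_, ?_, ?_, ?_⟩
    · rw [pow_add]
      exact add_mem (Ideal.mul_mem_mul hy hz') (Ideal.mul_mem_mul hz hy')
    · rw [pow_add]
      exact Ideal.mul_mem_mul hz hz'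
    · rw [map_mul, pow_add]
      exact h.mul_mul h'
    · simp only [map_add, map_mul, ← e₁, ← e₂]
      ring
  mul_mem' := by
    rintro w w' ⟨i, y, z, hy, hz, h, e₁⟩ ⟨i', y', z', hy', hz', h', e₂⟩
    refine ⟨i + i', y * y', z * z', ?_, ?_, ?_, ?_⟩
    · rw [pow_add]
      exact Ideal.mul_mem_mul hy hy'
    · rw [pow_add]
      exact Ideal.mul_mem_mul hz hz'
    · rw [map_mul, pow_add]
      exact h.mul_mul h'
    · simp only [map_mul, ← e₁, ← e₂]
      ring
  neg_mem' := by
    rintro w ⟨i, y, z, hy, hz, h, e₁⟩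
    exact ⟨i, -y, z, neg_mem hy, hz, h, by rw [map_neg, ← e₁, neg_mul]⟩

variable {ψ e}

theorem map_mem_blowUpSubring (a : A) : ψ a ∈ blowUpSubring ψ e :=
  ⟨0, a, 1, by simp, by simp, by simp, by simp⟩

/-- If `y / z` is a unit of `O`, then the image of `y` is also associated to `e ^ i`, so `z / y` is
an admissible fraction. -/
theorem isLocalHom_subtype_blowUpSubring : IsLocalHom (blowUpSubring ψ e).subtype where
  map_nonunit := by
    rintro ⟨w, i, y, z, hy, hz, h, e₁⟩ hw
    obtain ⟨u, hu⟩ := hw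
    replace hu : (u : O) = w := hu
    have e₂ : (↑u⁻¹ : O) * ψ y = ψ z := by rw [← e₁, ← hu, Units.inv_mul_cancel_left]
    refine IsUnit.of_mul_eq_one (⟨(↑u⁻¹ : O), i, z, y, hz, hy, ?_, e₂⟩ : blowUpSubring ψ e) ?_
    · refine Associated.trans ?_ h
      exact ⟨u⁻¹, by rw [← e₂, mul_comm]⟩
    · ext
      change w * (↑u⁻¹ : O) = 1
      rw [← hu, Units.mul_inv]

/-- Every `y` in the maximal ideal is `a` times `y / a`, an admissible fraction with `i = 1`. Hence
the subring already makes the maximal ideal principal. -/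
theorem map_codRestrict_blowUpSubring (h : (maximalIdeal A).map ψ = Ideal.span {e}) {a : A}
    (ha : a ∈ maximalIdeal A) (hae : Associated (ψ a) e) :
    (maximalIdeal A).map (ψ.codRestrict (blowUpSubring ψ e) map_mem_blowUpSubring) =
      Ideal.span {ψ.codRestrict (blowUpSubring ψ e) map_mem_blowUpSubring a} := by
  apply le_antisymm
  · rw [Ideal.map_le_iff_le_comap]
    intro y hy
    have hy' : ψ y ∈ Ideal.span {e} := h ▸ Ideal.mem_map_of_mem ψ hy
    rw [Ideal.mem_span_singleton, ← hae.dvd_iff_dvd_left] at hy'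
    obtain ⟨c, hc'⟩ := hy'
    have hc : c * ψ a = ψ y := by rw [hc', mul_comm]
    rw [Ideal.mem_comap, Ideal.mem_span_singleton']
    exact ⟨⟨c, 1, y, a, by simpa using hy, by simpa using ha, by simpa using hae, hc⟩,
      Subtype.ext hc⟩
  · rw [Ideal.span_singleton_le_iff_mem]
    exact Ideal.mem_map_of_mem _ ha

theorem pow_dvd_of_mem_pow (h : (maximalIdeal A).map ψ = Ideal.span {e}) {y : A} {i : ℕ}
    (hy : y ∈ maximalIdeal A ^ i) : e ^ i ∣ ψ y := by
  have := Ideal.mem_map_of_mem ψ hy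
  rwa [Ideal.map_pow, h, Ideal.span_singleton_pow, Ideal.mem_span_singleton] at this

open WithZero in
theorem le_exp_sub_one_of_lt {c : WithZero (Multiplicative ℤ)} {k : ℤ} (h : c < exp k) :
    c ≤ exp (k - 1) := by
  rcases eq_or_ne c 0 with rfl | hc
  · exact zero_le
  · rw [← exp_log hc, exp_lt_exp] at h
    rw [← exp_log hc, exp_le_exp]
    omega

variable [IsDomain O] [IsLocalRing O]

/-- Otherwise the extension `(e)` of the maximal ideal would lie in `𝔪_O e`, and cancelling `e`
would put 1 in `𝔪_O`. -/
theorem exists_associated (he : e ≠ 0) (h : (maximalIdeal A).map ψ = Ideal.span {e}) :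
    ∃ a ∈ maximalIdeal A, Associated (ψ a) e := by
  by_contra! H
  have hle : (maximalIdeal A).map ψ ≤ maximalIdeal O * Ideal.span {e} := by
    rw [Ideal.map_le_iff_le_comap]
    intro a ha
    have h1 : ψ a ∈ Ideal.span {e} := h ▸ Ideal.mem_map_of_mem ψ ha
    obtain ⟨c, hc⟩ := Ideal.mem_span_singleton'.mp h1
    rw [Ideal.mem_comap, ← hc]
    refine Ideal.mul_mem_mul ?_ (Ideal.mem_span_singleton_self e)
    intro hu
    exact H a ha (by rw [← hc]; exact (associated_isUnit_mul_left_iff hu).mpr (Associated.refl e))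
  rw [h, Ideal.span_singleton_le_iff_mem, Ideal.mem_mul_span_singleton] at hle
  obtain ⟨c, hc, hce⟩ := hle
  have : c = 1 := mul_right_cancel₀ he (by rw [hce, one_mul])
  rw [this] at hc
  exact hc isUnit_one

open WithZero in
/-- If every element of `O` is a fraction as above, then the order of vanishing at the closed
point of `A` extends to `O`, and `e` generates the elements of positive order. -/
theorem valuation_of_blowUpSubring_eq_top (he : e ≠ 0) (he' : ¬ IsUnit e)
    (h : (maximalIdeal A).map ψ = Ideal.span {e}) (htop : blowUpSubring ψ e = ⊤)
    (v : Valuation O (WithZero (Multiplicative ℤ)))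
    (hv : ∀ (a : A) (i : ℕ), v (ψ a) ≤ exp (-(i : ℤ)) ↔ a ∈ maximalIdeal A ^ i) :
    (∀ w, v w ≤ 1) ∧ (∀ w, v w < 1 → e ∣ w) ∧ v e = exp (-1) := by
  -- A denominator has order exactly `i`: a larger order would give `e ^ (i + 1) ∣ e ^ i` and make
  -- `e` a unit.
  have hval : ∀ (z : A) (i : ℕ), z ∈ maximalIdeal A ^ i → Associated (ψ z) (e ^ i) →
      v (ψ z) = exp (-(i : ℤ)) := by
    intro z i hz hze
    refine le_antisymm ((hv z i).mpr hz) ?_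
    by_contra! hlt
    have h1 := le_exp_sub_one_of_lt hlt
    rw [show -(i : ℤ) - 1 = -((i + 1 : ℕ) : ℤ) by push_cast; ring, hv] at h1
    have h2 := (pow_dvd_of_mem_pow h h1).trans hze.dvd
    rw [pow_succ] at h2
    exact he' (isUnit_of_dvd_one
      ((mul_dvd_mul_iff_left (pow_ne_zero i he)).mp (by rwa [mul_one])))
  have hfrac : ∀ w : O, ∃ (i : ℕ) (y z : A), y ∈ maximalIdeal A ^ i ∧ z ∈ maximalIdeal A ^ i ∧
      Associated (ψ z) (e ^ i) ∧ w * ψ z = ψ y := fun w =>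
    show w ∈ blowUpSubring ψ e from htop ▸ trivial
  have hle : ∀ w, v w ≤ 1 := by
    intro w
    obtain ⟨i, y, z, hy, hz, hze, hw⟩ := hfrac w
    have h1 := (hv y i).mpr hy
    rw [← hw, map_mul, hval z i hz hze] at h1
    exact le_of_mul_le_mul_right (by rwa [one_mul]) (exp_pos (a := -(i : ℤ)))
  refine ⟨hle, fun w hw => ?_, ?_⟩
  -- Positive order of `y / z` puts `y` into the power `i + 1`, so `e ^ (i + 1)` divides its image,
  -- which is `w * e ^ i` up to a unit.
  · obtain ⟨i, y, z, hy, hz, hze, hwz⟩ := hfrac w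
    have h1 : v (ψ y) < exp (-(i : ℤ)) := by
      rw [← hwz, map_mul, hval z i hz hze]
      exact mul_lt_of_lt_one_left exp_pos hw
    have h2 := le_exp_sub_one_of_lt h1
    rw [show -(i : ℤ) - 1 = -((i + 1 : ℕ) : ℤ) by push_cast; ring, hv] at h2
    have h3 := pow_dvd_of_mem_pow h h2
    rw [← hwz] at h3
    have h4 : e ^ (i + 1) ∣ w * e ^ i := h3.trans (mul_dvd_mul_left w hze.dvd)
    rw [pow_succ', mul_dvd_mul_iff_right (pow_ne_zero i he)] at h4
    exact h4
  · obtain ⟨a, ha, u, hu⟩ := exists_associated he h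
    have h1 := hval a 1 (by simpa using ha) (by simpa using ⟨u, hu⟩)
    have h2 : v (u : O) = 1 := by
      refine le_antisymm (hle _) ?_
      have h3 : v (u : O) * v (↑u⁻¹ : O) = 1 := by rw [← map_mul, Units.mul_inv, map_one]
      calc (1 : WithZero (Multiplicative ℤ)) = v (u : O) * v (↑u⁻¹ : O) := h3.symm
        _ ≤ v (u : O) * 1 := mul_le_mul_right (hle _) _
        _ = _ := mul_one _
    rw [← hu, map_mul, h1, h2, mul_one]
    rfl

end BlowUpSubring

namespace CoxRing

universe u

/-! ### The local rings of the blow-up over the centre -/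

section OverCentre

variable {X Y : Scheme.{u}} [IsIntegral X] {π : X ⟶ Y}

/-- A local subring of a local ring of the blow-up over the centre, in which the maximal ideal of
the centre becomes principal, is the whole local ring. -/
theorem IsBlowUp.subring_eq_top {x : X} {hp : IsClosed ({π x} : Set Y)}
    (hπ : IsBlowUp (pointIdeal (π x) hp) π) (B : Subring (X.presheaf.stalk x))
    [IsLocalHom B.subtype] (hB : ∀ a, (π.stalkMap x).hom a ∈ B) {b : B} (hb : b ≠ 0)
    (h : (IsLocalRing.maximalIdeal (Y.presheaf.stalk (π x))).map
      ((π.stalkMap x).hom.codRestrict B hB) = Ideal.span {b}) : B = ⊤ := by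
  have : IsLocalRing B := RingHom.domain_isLocalRing B.subtype
  let φ : Y.presheaf.stalk (π x) ⟶ CommRingCat.of B :=
    CommRingCat.ofHom ((π.stalkMap x).hom.codRestrict B hB)
  let ι : CommRingCat.of B ⟶ X.presheaf.stalk x := CommRingCat.ofHom B.subtype
  have hφι : φ ≫ ι = π.stalkMap x := by
    ext a
    rfl
  -- The universal property lifts `Spec B ⟶ Y` to `X`, since the centre is principal in `B`.
  obtain ⟨g, hg, -⟩ := hπ.existsUnique_lift _ (Spec.map φ ≫ Y.fromSpecStalk (π x))
    (isInvertibleIdeal_comap_Spec hp φ hb h)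
  have hιb : ι b ≠ 0 := fun h0 => hb (Subtype.ext h0)
  have hinv := isInvertibleIdeal_comap_Spec hp (φ ≫ ι) hιb (by
    rw [CommRingCat.hom_comp, ← Ideal.map_map]
    refine (congrArg (Ideal.map ι.hom) h).trans ?_
    rw [Ideal.map_span, Set.image_singleton])
  -- Both sides lift the same morphism from the spectrum of the local ring at `x`, so they agree.
  have hfac : Spec.map ι ≫ g = X.fromSpecStalk x := by
    refine (hπ.existsUnique_lift _ _ hinv).unique ?_ ?_
    · rw [Category.assoc, hg, Spec.map_comp, Category.assoc]
    · rw [hφι, Scheme.SpecMap_stalkMap_fromSpecStalk]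
  have hgx : g (IsLocalRing.closedPoint B) = x := by
    have h1 := Scheme.fromSpecStalk_closedPoint (x := x)
    rw [← hfac] at h1
    have h2 : PrimeSpectrum.comap B.subtype (IsLocalRing.closedPoint (X.presheaf.stalk x)) =
        IsLocalRing.closedPoint B := IsLocalRing.comap_closedPoint B.subtype
    rw [← h2]
    exact h1
  rw [eq_top_iff]
  -- As `g` sends the closed point to `x`, all of `Spec B` maps into any neighbourhood of `x`; every
  -- germ at `x` therefore comes from `B`.
  rintro a -
  obtain ⟨U, hxU, s, rfl⟩ := X.presheaf.exists_germ_eq a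
  have h1 : (⊤ : (Spec (CommRingCat.of B)).Opens) ≤ g ⁻¹ᵁ U :=
    (Scheme.preimage_eq_top_of_closedPoint_mem g
      (show g (IsLocalRing.closedPoint B) ∈ U by rw [hgx]; exact hxU)).ge
  have h2 : (⊤ : (Spec (X.presheaf.stalk x)).Opens) ≤ Spec.map ι ⁻¹ᵁ ⊤ := le_of_eq rfl
  have h3 : (⊤ : (Spec (X.presheaf.stalk x)).Opens) ≤ X.fromSpecStalk x ⁻¹ᵁ U := by
    rw [← hfac]
    exact fun t _ => h1 trivial
  have h4 : g.appLE U ⊤ h1 ≫ (Spec.map ι).appLE ⊤ ⊤ h2 =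
      X.presheaf.germ U x hxU ≫ (Scheme.ΓSpecIso _).inv := by
    rw [Scheme.Hom.appLE_comp_appLE, ← fromSpecStalk_appLE hxU h3]
    simp only [hfac]
  have h5 : g.appLE U ⊤ h1 ≫ (Scheme.ΓSpecIso _).hom ≫ ι = X.presheaf.germ U x hxU := by
    rw [← Scheme.ΓSpecIso_naturality, ← SpecMap_appLE_top ι h2, ← Category.assoc, h4,
      Category.assoc, Iso.inv_hom_id, Category.comp_id]
  rw [← h5]
  exact (((g.appLE U ⊤ h1 ≫ (Scheme.ΓSpecIso _).hom) s : B)).2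

end OverCentre

end CoxRing

end

noncomputable section

namespace CoxRing

universe u

/-! ### Local equations of the exceptional divisor and the centre of a valuation -/

section LocalGenerators

variable {X Y : Scheme.{u}} [IsIntegral X] {π : X ⟶ Y}

theorem IsLocalGenerator.exists_open {I : X.IdealSheafData} {x : X} {e : (FunField X)ˣ}
    (he : IsLocalGenerator I x e) : ∃ U : X.Opens, x ∈ U ∧ ∀ y ∈ U, IsLocalGenerator I y e := by
  obtain ⟨U, hx, g, hg, h⟩ := he
  exact ⟨U.1, hx, fun y hy => ⟨U, hy, g, hg, h.trans (toFunField_eq hx hy g)⟩⟩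

/-- Away from the centre the inverse image ideal is the unit ideal, so its generator is invertible.
-/
theorem IsLocalGenerator.mem_unitsAt {p : Y} {hp : IsClosed ({p} : Set Y)} {x : X}
    {e : (FunField X)ˣ} (he : IsLocalGenerator ((pointIdeal p hp).comap π) x e) (hx : π x ≠ p) :
    e ∈ unitsAt X x := by
  obtain ⟨⟨U, hU⟩, hxU, g, hg, h⟩ := he
  have h1 : x ∉ ((pointIdeal p hp).comap π).support := by
    rw [Scheme.IdealSheafData.support_comap]
    exact fun h => hx ((mem_support_pointIdeal hp).mp h)
  rw [Scheme.IdealSheafData.mem_support_iff_of_mem (U := ⟨U, hU⟩) hxU, hg] at h1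
  have h2 : x ∈ X.basicOpen g := by
    by_contra h3
    apply h1
    rw [Scheme.zeroLocus_span, Scheme.zeroLocus_singleton]
    exact h3
  obtain ⟨u, hu⟩ := (X.mem_basicOpen g x hxU).mp h2
  refine ⟨u, ?_⟩
  ext
  rw [h, toFunField, ← hu]
  rfl

open WithZero in
/-- The local rings of the blow-up over the centre, in terms of the order of vanishing along the
exceptional divisor. -/
theorem IsBlowUp.valuation_of_eq [IsIntegral Y] {p : Y} {hp : IsClosed ({p} : Set Y)}
    (hπ : IsBlowUp (pointIdeal p hp) π) {φ : FunField Y ≃+* FunField X}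
    (hφ : ∀ (x : X) (a : Y.presheaf.stalk (π x)),
      φ (algebraMap _ _ a) = algebraMap _ _ (π.stalkMap x a))
    {v : Valuation (FunField X) (WithZero (Multiplicative ℤ))}
    (hv : ∀ (a : Y.presheaf.stalk p) (i : ℕ), v (φ (algebraMap _ _ a)) ≤ exp (-(i : ℤ)) ↔
      a ∈ IsLocalRing.maximalIdeal (Y.presheaf.stalk p) ^ i)
    {x : X} (hx : π x = p) {e : (FunField X)ˣ}
    (he : IsLocalGenerator ((pointIdeal p hp).comap π) x e) :
    (∀ f ∈ stalkRange x, v f ≤ 1) ∧ (∀ f ∈ stalkRange x, v f < 1 → f * ↑e⁻¹ ∈ stalkRange x) ∧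
      v e = exp (-1) ∧ (e : FunField X) ∈ stalkRange x := by
  subst hx
  obtain ⟨⟨U, hU⟩, hxU, g, hg, h⟩ := he
  let e₀ := X.presheaf.germ U x hxU g
  have he₀ : algebraMap _ (FunField X) e₀ = (e : FunField X) := h.symm
  have hmax : (IsLocalRing.maximalIdeal (Y.presheaf.stalk (π x))).map (π.stalkMap x).hom =
      Ideal.span {e₀} := by
    rw [map_stalkMap_maximalIdeal π hp hU hxU, hg, Ideal.map_span, Set.image_singleton]
  have hne : e₀ ≠ 0 := by
    intro h0
    rw [h0, map_zero] at he₀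
    exact e.ne_zero he₀.symm
  have hnu : ¬ IsUnit e₀ := by
    have h1 : (IsLocalRing.maximalIdeal (Y.presheaf.stalk (π x))).map (π.stalkMap x).hom ≤
        IsLocalRing.maximalIdeal (X.presheaf.stalk x) :=
      (((IsLocalRing.local_hom_TFAE (π.stalkMap x).hom).out 0 2 :
        IsLocalHom (π.stalkMap x).hom ↔ _)).mp inferInstance
    rw [hmax, Ideal.span_singleton_le_iff_mem] at h1
    exact h1
  obtain ⟨a, ha, hae⟩ := exists_associated hne hmax
  have := isLocalHom_subtype_blowUpSubring (ψ := (π.stalkMap x).hom) (e := e₀)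
  have htop := hπ.subring_eq_top (blowUpSubring (π.stalkMap x).hom e₀) map_mem_blowUpSubring
    (b := (π.stalkMap x).hom.codRestrict (blowUpSubring _ e₀) map_mem_blowUpSubring a)
    (by
      intro h0
      have h1 : (π.stalkMap x).hom a = 0 := congrArg Subtype.val h0
      rw [h1] at hae
      exact hne (hae.eq_zero_iff.mp rfl))
    (map_codRestrict_blowUpSubring hmax ha hae)
  obtain ⟨h1, h2, h3⟩ := valuation_of_blowUpSubring_eq_top hne hnu hmax htop
    (v.comap (algebraMap (X.presheaf.stalk x) (FunField X))) (fun a i => by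
      rw [← hv a i, hφ]
      rfl)
  refine ⟨?_, ?_, ?_, ⟨e₀, he₀⟩⟩
  · rintro _ ⟨f, rfl⟩
    exact h1 f
  · rintro _ ⟨f, rfl⟩ hf
    obtain ⟨c, rfl⟩ := h2 f hf
    refine ⟨c, ?_⟩
    rw [map_mul, he₀, mul_right_comm, Units.mul_inv, one_mul]
  · rw [← he₀]
    exact h3

/-- The centre on the blow-up of a local ring that dominates the local ring of the centre. -/
theorem IsBlowUp.exists_specializes [IsIntegral Y] {p : Y} {hp : IsClosed ({p} : Set Y)}
    (hπ : IsBlowUp (pointIdeal p hp) π) {φ : FunField Y ≃+* FunField X}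
    (hφ : ∀ (x : X) (a : Y.presheaf.stalk (π x)),
      φ (algebraMap _ _ a) = algebraMap _ _ (π.stalkMap x a))
    (B : Subring (FunField X)) [IsLocalRing B]
    (hB : ∀ a : Y.presheaf.stalk p, (φ.toRingHom.comp (algebraMap _ _)) a ∈ B)
    [IsLocalHom ((φ.toRingHom.comp (algebraMap (Y.presheaf.stalk p) _)).codRestrict B hB)]
    {b : B} (hb : b ≠ 0)
    (h : (IsLocalRing.maximalIdeal (Y.presheaf.stalk p)).map
      ((φ.toRingHom.comp (algebraMap _ _)).codRestrict B hB) = Ideal.span {b}) :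
    ∃ η : X, π η = p ∧ ∀ x, π x = p → stalkRange x ≤ B → η ⤳ x := by
  let φ' : Y.presheaf.stalk p ⟶ CommRingCat.of B :=
    CommRingCat.ofHom
      ((φ.toRingHom.comp (algebraMap (Y.presheaf.stalk p) _)).codRestrict B hB)
  have hinv := isInvertibleIdeal_comap_Spec hp φ' hb h
  -- The point sought is the image of the closed point under the lift of `Spec B` to `X`.
  obtain ⟨g, hg, -⟩ := hπ.existsUnique_lift _ (Spec.map φ' ≫ Y.fromSpecStalk p) hinv
  refine ⟨g (IsLocalRing.closedPoint B), ?_, ?_⟩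
  · refine (congrArg (fun f => f.base (IsLocalRing.closedPoint B)) hg).trans ?_
    have h1 := Scheme.fromSpecStalk_closedPoint (x := p)
    have h2 : PrimeSpectrum.comap φ'.hom (IsLocalRing.closedPoint B) =
        IsLocalRing.closedPoint (Y.presheaf.stalk p) := IsLocalRing.comap_closedPoint φ'.hom
    rw [← h2] at h1
    exact h1
  · rintro x rfl hxB
    let ι : X.presheaf.stalk x ⟶ CommRingCat.of B :=
      CommRingCat.ofHom ((algebraMap (X.presheaf.stalk x) (FunField X)).codRestrict B fun a => hxB ⟨a, rfl⟩)
    have h1 : π.stalkMap x ≫ ι = φ' := by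
      ext a
      exact (hφ x a).symm
    -- By uniqueness the lift factors through the spectrum of every local ring contained in `B`, so
    -- its values are generizations of `x`.
    have h2 : Spec.map ι ≫ X.fromSpecStalk x = g := by
      refine (hπ.existsUnique_lift _ _ hinv).unique ?_ hg
      rw [Category.assoc, ← Scheme.SpecMap_stalkMap_fromSpecStalk, ← Spec.map_comp_assoc, h1]
    rw [← h2]
    exact specializes_of_fromSpecStalk x (Spec.map ι (IsLocalRing.closedPoint B))

end LocalGenerators

end CoxRing

end

noncomputable section

/-! ### The order of vanishing on the function field -/

section ExtendValuation

open IsLocalRing WithZero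

variable {A K : Type*} [CommRing A] [IsLocalRing A] [IsNoetherianRing A]
  [Infinite (ResidueField A)] [Field K] [Algebra A K] [IsFractionRing A K] {n : ℕ} {x : Fin n → A}

/-- The order of vanishing at the closed point, as a valuation of the field of fractions. -/
theorem IsRegularSystem.exists_valuation_fractionRing (hx : IsRegularSystem x) :
    ∃ v : Valuation K (WithZero (Multiplicative ℤ)),
      ∀ (y : A) (i : ℕ), v (algebraMap A K y) ≤ exp (-(i : ℤ)) ↔ y ∈ maximalIdeal A ^ i := by
  have := hx.isDomain
  obtain ⟨v, hv⟩ := hx.exists_valuation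
  -- Only 0 has infinite order, by Krull's intersection theorem, so the valuation extends to
  -- fractions.
  have hS : nonZeroDivisors A ≤ v.supp.primeCompl := by
    intro a ha h0
    have h0' : v a = 0 := h0
    have h1 : a ∈ ⨅ i : ℕ, maximalIdeal A ^ i := by
      rw [Ideal.mem_iInf]
      intro i
      rw [← hv a i, h0']
      exact zero_le
    rw [Ideal.iInf_pow_eq_bot_of_isLocalRing _ (Ideal.IsPrime.ne_top inferInstance)] at h1
    exact nonZeroDivisors.ne_zero ha h1
  refine ⟨v.extendToLocalization hS K, fun y i => ?_⟩
  rw [Valuation.extendToLocalization_apply_map_apply, hv]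

end ExtendValuation

/-! ### What the universal property yields about the blow-up of a regular point -/

namespace CoxRing

universe u

variable {X Y : Scheme.{u}} [IsIntegral X] [IsIntegral Y]

open WithZero in
/-- The properties of the blow-up `π` of a regular point `p` that determine its divisors: `I` is
the ideal sheaf of the exceptional divisor, `η` its generic point, `v` the valuation of order of
vanishing along it, and `φ` identifies the function fields. -/
structure IsBlowUpModel (π : X ⟶ Y) (p : Y) (I : X.IdealSheafData)
    (φ : FunField Y ≃+* FunField X) (v : Valuation (FunField X) (WithZero (Multiplicative ℤ)))
    (η : X) : Prop where
  map_mem : ∀ {x : X} {f : FunField Y}, f ∈ stalkRange (π x) → φ f ∈ stalkRange x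
  mem_of_map_mem : ∀ {x : X} {f : FunField Y}, π x ≠ p → φ f ∈ stalkRange x → f ∈ stalkRange (π x)
  exists_eq : ∀ {y : Y}, y ≠ p → ∃ x, π x = y
  exists_open : ∀ {x : X}, π x ≠ p → ∀ {W : X.Opens}, x ∈ W →
    ∃ V : Y.Opens, π x ∈ V ∧ p ∉ V ∧ ∀ x', π x' ∈ V → x' ∈ W
  map_center : π η = p
  specializes : ∀ {x : X}, π x = p → η ⤳ x
  mem_unitsAt : ∀ {x : X} {e : (FunField X)ˣ}, IsLocalGenerator I x e → π x ≠ p → e ∈ unitsAt X x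
  valuation_le_one : ∀ {x : X}, π x = p → ∀ {f : FunField X}, f ∈ stalkRange x → v f ≤ 1
  mul_inv_mem : ∀ {x : X} {e : (FunField X)ˣ}, IsLocalGenerator I x e → π x = p →
    ∀ {f : FunField X}, f ∈ stalkRange x → v f < 1 → f * ↑e⁻¹ ∈ stalkRange x
  valuation_generator : ∀ {x : X} {e : (FunField X)ˣ}, IsLocalGenerator I x e → π x = p →
    v e = exp (-1)
  generator_mem : ∀ {x : X} {e : (FunField X)ˣ}, IsLocalGenerator I x e → π x = p →
    (e : FunField X) ∈ stalkRange x

-- The generic point of the exceptional divisor is obtained as the centre on `X` of the valuation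
-- ring of `v`: it specializes to every point over `p`, since the local rings there lie in that
-- valuation ring.
open WithZero in
theorem IsBlowUp.exists_isBlowUpModel {π : X ⟶ Y} {p : Y} {hp : IsClosed ({p} : Set Y)}
    (hπ : IsBlowUp (pointIdeal p hp) π) [IsNoetherianRing (Y.presheaf.stalk p)]
    [Infinite (IsLocalRing.ResidueField (Y.presheaf.stalk p))] {n : ℕ}
    {x : Fin (n + 1) → Y.presheaf.stalk p} (hx : IsRegularSystem x) :
    ∃ φ v η, IsBlowUpModel π p ((pointIdeal p hp).comap π) φ v η := by
  have hmem : x 0 ∈ IsLocalRing.maximalIdeal (Y.presheaf.stalk p) := by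
    rw [← hx.span_eq]
    exact Ideal.subset_span ⟨0, rfl⟩
  have hx0 : x 0 ≠ 0 := fun h0 => hx.notMem_sq 0 (h0 ▸ zero_mem _)
  have hne : ∃ y, y ≠ p := by
    -- The witness is the generic point; the nonzero element `x 0` of the maximal ideal
    -- distinguishes it from `p`.
    refine ⟨Y.fromSpecStalk p ⟨⊥, Ideal.isPrime_bot⟩, fun h => hx0 ?_⟩
    have h1 := (primeOf_eq_closedPoint_iff (specializes_of_fromSpecStalk p _)).mpr h
    rw [primeOf_fromSpecStalk] at h1
    have h2 : (⊥ : Ideal (Y.presheaf.stalk p)) = IsLocalRing.maximalIdeal _ :=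
      congrArg PrimeSpectrum.asIdeal h1
    rw [← h2] at hmem
    exact hmem
  obtain ⟨φ, hφ⟩ := hπ.exists_funFieldEquiv hne
  obtain ⟨v₀, hv₀⟩ := hx.exists_valuation_fractionRing (K := FunField Y)
  let v := v₀.comap φ.symm.toRingHom
  have hvφ : ∀ f, v (φ f) = v₀ f := fun f => congrArg v₀ (φ.symm_apply_apply f)
  have hv : ∀ (a : Y.presheaf.stalk p) (i : ℕ), v (φ (algebraMap _ _ a)) ≤ exp (-(i : ℤ)) ↔
      a ∈ IsLocalRing.maximalIdeal (Y.presheaf.stalk p) ^ i := fun a i => by rw [hvφ, hv₀]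
  have hvx : v (φ (algebraMap _ _ (x 0))) = exp (-1) := by
    refine le_antisymm ((hv _ 1).mpr (by simpa using hmem)) ?_
    by_contra! hlt
    exact hx.notMem_sq 0 ((hv _ 2).mp (le_exp_sub_one_of_lt hlt))
  have hvle : ∀ a : Y.presheaf.stalk p, v (φ (algebraMap _ _ a)) ≤ 1 := fun a =>
    (hv a 0).mpr (by simp)
  let B : Subring (FunField X) := v.valuationSubring.toSubring
  have hB : ∀ a : Y.presheaf.stalk p, (φ.toRingHom.comp (algebraMap _ _)) a ∈ B := hvle
  have hlocalB : IsLocalRing B := inferInstanceAs (IsLocalRing v.valuationSubring)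
  let ψ := (φ.toRingHom.comp (algebraMap (Y.presheaf.stalk p) _)).codRestrict B hB
  have hlocal : IsLocalHom ψ := by
    refine ⟨fun a ha => ?_⟩
    by_contra hna
    have h1 : v (φ (algebraMap _ _ a)) ≤ exp (-1) := (hv a 1).mpr (by simpa using hna)
    obtain ⟨c, hc⟩ := ha.exists_right_inv
    have h2 : φ (algebraMap _ _ a) * (c : FunField X) = 1 := congrArg Subtype.val hc
    have h3 : v (c : FunField X) ≤ 1 := c.2
    have h4 := congrArg v h2
    rw [map_mul, map_one] at h4
    have h5 : (1 : WithZero (Multiplicative ℤ)) ≤ exp (-1) := by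
      rw [← h4]
      calc _ ≤ exp (-1) * (1 : WithZero (Multiplicative ℤ)) := mul_le_mul' h1 h3
        _ = _ := mul_one _
    rw [← exp_zero, exp_le_exp] at h5
    omega
  have hφ0 : φ (algebraMap _ _ (x 0)) ≠ 0 := by
    intro h0
    rw [h0, map_zero] at hvx
    exact exp_ne_zero hvx.symm
  -- As `x 0` has order exactly one, it divides the whole maximal ideal inside the valuation ring.
  obtain ⟨η, hη, hηs⟩ := hπ.exists_specializes hφ B hB (b := ψ (x 0))
    (fun h0 => hφ0 (congrArg Subtype.val h0)) (by
      apply le_antisymm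
      · rw [Ideal.map_le_iff_le_comap]
        intro y hy
        rw [Ideal.mem_comap, Ideal.mem_span_singleton']
        have h1 : v (φ (algebraMap _ _ y) / φ (algebraMap _ _ (x 0))) ≤ 1 := by
          rw [map_div₀, hvx]
          exact div_le_one_of_le₀ ((hv y 1).mpr (by simpa using hy)) zero_le
        exact ⟨⟨_, h1⟩, Subtype.ext (div_mul_cancel₀ _ hφ0)⟩
      · rw [Ideal.span_singleton_le_iff_mem]
        exact Ideal.mem_map_of_mem _ hmem)
  have hval := fun {z : X} (hz : π z = p) {e : (FunField X)ˣ} he =>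
    hπ.valuation_of_eq hφ hv (x := z) hz (e := e) he
  have hle : ∀ {z : X}, π z = p → ∀ {f : FunField X}, f ∈ stalkRange z → v f ≤ 1 := by
    intro z hz f hf
    obtain ⟨e, he⟩ := exists_isLocalGenerator hπ.isInvertible z
    exact (hval hz he).1 f hf
  refine ⟨φ, v, η, ?_, ?_, hπ.exists_eq, fun hx _ hW => hπ.exists_open hx hW, hη, ?_,
    IsLocalGenerator.mem_unitsAt, hle, ?_, fun he hz => (hval hz he).2.2.1,
    fun he hz => (hval hz he).2.2.2⟩
  · rintro z _ ⟨a, rfl⟩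
    exact ⟨_, (hφ z a).symm⟩
  · rintro z f hz ⟨a, ha⟩
    have := hπ.isIso_stalkMap hz
    refine ⟨(inv (π.stalkMap z)) a, φ.injective ?_⟩
    rw [hφ, ← ha]
    congr 1
    rw [← CommRingCat.comp_apply, IsIso.inv_hom_id]
    rfl
  · intro z hz
    exact hηs z hz fun f hf => hle hz hf
  · intro z e he hz f hf hf1
    exact (hval hz he).2.1 f hf hf1

end CoxRing

end

noncomputable section

namespace CoxRing

universe u

/-! ### Cartier divisors and their local equations -/

section LocalEquations

variable {X : Scheme.{u}} [IsIntegral X]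

theorem CaDiv.ext {D D' : CaDiv X} (h : ∀ x, D.germ x = D'.germ x) : D = D' :=
  Subtype.ext (funext h)

/-- The Cartier divisor with prescribed local equations. -/
def CaDiv.mk (g : X → (FunField X)ˣ)
    (h : ∀ x, ∃ U : X.Opens, x ∈ U ∧ ∀ y ∈ U, g x / g y ∈ unitsAt X y) : CaDiv X :=
  Additive.ofMul (α := cartierSubgroup X) ⟨fun x => QuotientGroup.mk (g x), fun x => by
    obtain ⟨U, hx, hU⟩ := h x
    refine ⟨U, hx, g x, fun y hy => ?_⟩
    rw [QuotientGroup.eq, mul_comm, ← div_eq_mul_inv]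
    exact hU y hy⟩

theorem isLocalEq_mk (g : X → (FunField X)ˣ) (h) (x : X) : IsLocalEq (CaDiv.mk g h) x (g x) := rfl

theorem exists_isLocalEq (D : CaDiv X) (x : X) :
    ∃ U : X.Opens, x ∈ U ∧ ∃ g, ∀ y ∈ U, IsLocalEq D y g :=
  (Additive.toMul (α := cartierSubgroup X) D).2 x

variable {D D' : CaDiv X} {x : X} {g g' : (FunField X)ˣ}

theorem IsLocalEq.add (h : IsLocalEq D x g) (h' : IsLocalEq D' x g') :
    IsLocalEq (D + D') x (g * g') := by
  rw [IsLocalEq, CaDiv.germ_add, h, h']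
  rfl

theorem CaDiv.germ_neg (D : CaDiv X) (x : X) : (-D).germ x = (D.germ x)⁻¹ := rfl

theorem IsLocalEq.neg (h : IsLocalEq D x g) : IsLocalEq (-D) x g⁻¹ := by
  rw [IsLocalEq, CaDiv.germ_neg, h]
  rfl

/-- The germ of a Cartier divisor, as a homomorphism. -/
def CaDiv.germHom (x : X) : CaDiv X →+ Additive ((FunField X)ˣ ⧸ unitsAt X x) where
  toFun D := Additive.ofMul (D.germ x)
  map_zero' := rfl
  map_add' _ _ := rfl

theorem IsLocalEq.zsmul (h : IsLocalEq D x g) (k : ℤ) : IsLocalEq (k • D) x (g ^ k) := by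
  have h1 := map_zsmul (CaDiv.germHom x) k D
  have h2 : (k • D).germ x = (D.germ x) ^ k := h1
  rw [IsLocalEq, h2, h]
  rfl

theorem isLocalEq_principal (f : (FunField X)ˣ) (x : X) :
    IsLocalEq (principal X (Additive.ofMul f)) x f := rfl

theorem IsLocalEq.iff_div_mem (h : IsLocalEq D x g) :
    IsLocalEq D x g' ↔ g' / g ∈ unitsAt X x := by
  rw [IsLocalEq, h, QuotientGroup.eq, mul_comm, ← div_eq_mul_inv]

theorem IsLocalEq.germ_eq_one_iff (h : IsLocalEq D x g) : D.germ x = 1 ↔ g ∈ unitsAt X x := by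
  rw [h, QuotientGroup.eq_one_iff]

theorem mem_unitsAt_iff : g ∈ unitsAt X x ↔
    (g : FunField X) ∈ stalkRange x ∧ ((g⁻¹ : (FunField X)ˣ) : FunField X) ∈ stalkRange x := by
  rw [unitsAt_eq]
  rfl

theorem exists_open_forall_mem_unitsAt (hg : g ∈ unitsAt X x) :
    ∃ U : X.Opens, x ∈ U ∧ ∀ y ∈ U, g ∈ unitsAt X y := by
  obtain ⟨h1, h2⟩ := mem_unitsAt_iff.mp hg
  obtain ⟨V, hxV, hV⟩ := exists_open_forall_mem_stalkRange h1
  obtain ⟨V', hxV', hV'⟩ := exists_open_forall_mem_stalkRange h2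
  exact ⟨V ⊓ V', ⟨hxV, hxV'⟩, fun y hy => mem_unitsAt_iff.mpr ⟨hV y hy.1, hV' y hy.2⟩⟩

theorem IsLocalEq.exists_open (h : IsLocalEq D x g) :
    ∃ U : X.Opens, x ∈ U ∧ ∀ y ∈ U, IsLocalEq D y g := by
  obtain ⟨U, hxU, g₀, hg₀⟩ := exists_isLocalEq D x
  obtain ⟨V, hxV, hV⟩ := exists_open_forall_mem_unitsAt ((hg₀ x hxU).iff_div_mem.mp h)
  exact ⟨U ⊓ V, ⟨hxU, hxV⟩, fun y hy => (hg₀ y hy.1).iff_div_mem.mpr (hV y hy.2)⟩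

/-- It suffices to test sections of a divisor on one local equation at each point. -/
theorem mem_H0_iff_exists {f : FunField X} :
    f ∈ H0 D ↔ ∀ x, ∃ g, IsLocalEq D x g ∧ f * g ∈ stalkRange x := by
  constructor
  · intro hf x
    obtain ⟨U, hx, g, hg⟩ := exists_isLocalEq D x
    exact ⟨g, hg x hx, hf x g (hg x hx)⟩
  · intro h x g hg
    obtain ⟨g', hg', h'⟩ := h x
    have h1 := (mem_unitsAt_iff.mp (hg'.iff_div_mem.mp hg)).1
    have h2 : f * g = f * g' * (g / g' : (FunField X)ˣ) := by
      rw [mul_assoc, ← Units.val_mul, mul_div_cancel]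
    rw [h2]
    exact mul_mem h' h1

theorem mul_mem_H0_iff {f : FunField X} (h : (FunField X)ˣ) :
    f * h ∈ H0 D ↔ f ∈ H0 (D + principal X (Additive.ofMul h)) := by
  rw [mem_H0_iff_exists, mem_H0_iff_exists]
  constructor
  · intro H x
    obtain ⟨g, hg, hf⟩ := H x
    refine ⟨g * h, hg.add (isLocalEq_principal h x), ?_⟩
    rwa [Units.val_mul, mul_comm (g : FunField X), ← mul_assoc]
  · intro H x
    obtain ⟨g, hg, hf⟩ := H x
    refine ⟨g * h⁻¹, ?_, ?_⟩
    · have := hg.add (isLocalEq_principal h x).neg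
      rwa [add_neg_cancel_right] at this
    · rwa [Units.val_mul, mul_comm (g : FunField X), mul_assoc, Units.mul_inv_cancel_left]

theorem isLocalEq_divisorOfIdeal {I : X.IdealSheafData} (hI : IsInvertibleIdeal I)
    (hg : IsLocalGenerator I x g) : IsLocalEq (divisorOfIdeal I hI) x g :=
  (exists_isLocalGenerator hI x).choose_spec.mk_eq hg

end LocalEquations

/-! ### Pulling back Cartier divisors along the blow-up -/

section Pullback

open WithZero

variable {X Y : Scheme.{u}} [IsIntegral X] [IsIntegral Y] {π : X ⟶ Y} {p : Y}
  {I : X.IdealSheafData} {φ : FunField Y ≃+* FunField X}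
  {v : Valuation (FunField X) (WithZero (Multiplicative ℤ))} {η : X}

namespace IsBlowUpModel

variable (M : IsBlowUpModel π p I φ v η)

include M

theorem map_mem_unitsAt {x : X} {f : (FunField Y)ˣ} (hf : f ∈ unitsAt Y (π x)) :
    Units.mapEquiv φ.toMulEquiv f ∈ unitsAt X x := by
  rw [mem_unitsAt_iff] at hf ⊢
  exact ⟨M.map_mem hf.1, by rw [← map_inv]; exact M.map_mem hf.2⟩

theorem mem_unitsAt_of_map_mem {x : X} (hx : π x ≠ p) {f : (FunField Y)ˣ}
    (hf : Units.mapEquiv φ.toMulEquiv f ∈ unitsAt X x) : f ∈ unitsAt Y (π x) := by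
  rw [mem_unitsAt_iff] at hf ⊢
  rw [← map_inv] at hf
  exact ⟨M.mem_of_map_mem hx hf.1, M.mem_of_map_mem hx hf.2⟩

/-- The pullback of Cartier divisors along a blow-up. -/
def pullback : CaDiv Y →+ CaDiv X where
  toFun D := Additive.ofMul (α := cartierSubgroup X)
    ⟨fun x => QuotientGroup.map (unitsAt Y (π x)) (unitsAt X x)
      (Units.mapEquiv φ.toMulEquiv).toMonoidHom (fun _ h => M.map_mem_unitsAt h) (D.germ (π x)),
    fun x => by
      obtain ⟨U, hx, g, hg⟩ := exists_isLocalEq D (π x)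
      refine ⟨π ⁻¹ᵁ U, hx, Units.mapEquiv φ.toMulEquiv g, fun y hy =>
        congrArg (QuotientGroup.map (unitsAt Y (π y)) (unitsAt X y)
          (Units.mapEquiv φ.toMulEquiv).toMonoidHom fun _ h => M.map_mem_unitsAt h) (hg (π y) hy)⟩⟩
  map_zero' := CaDiv.ext fun x => by
    change QuotientGroup.map _ _ _ _ _ = _
    rw [CaDiv.germ_zero, map_one]
    rfl
  map_add' D D' := CaDiv.ext fun x => by
    change QuotientGroup.map _ _ _ _ _ = _
    rw [CaDiv.germ_add, map_mul]
    rfl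

theorem isLocalEq_pullback {D : CaDiv Y} {x : X} {g : (FunField Y)ˣ} (hg : IsLocalEq D (π x) g) :
    IsLocalEq (M.pullback D) x (Units.mapEquiv φ.toMulEquiv g) := by
  change QuotientGroup.map _ _ _ _ _ = _
  rw [hg]
  rfl

theorem pullback_principal (f : (FunField Y)ˣ) :
    M.pullback (principal Y (Additive.ofMul f)) =
      principal X (Additive.ofMul (Units.mapEquiv φ.toMulEquiv f)) :=
  rfl

theorem valuation_eq_one {x : X} (hx : π x = p) {f : (FunField X)ˣ} (hf : f ∈ unitsAt X x) :
    v f = 1 := by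
  rw [mem_unitsAt_iff] at hf
  refine le_antisymm (M.valuation_le_one hx hf.1) ?_
  have h := M.valuation_le_one hx hf.2
  have h1 : v (f : FunField X) * v ((f⁻¹ : (FunField X)ˣ) : FunField X) = 1 := by
    rw [← map_mul, Units.mul_inv, map_one]
  calc (1 : WithZero (Multiplicative ℤ)) = _ := h1.symm
    _ ≤ v (f : FunField X) * 1 := mul_le_mul_right h _
    _ = _ := mul_one _

/-- As long as a power of `e` is present the product has positive order, so one factor `e` can be
divided out. -/
theorem mem_stalkRange_of_pow_mul_mem {x : X} (hx : π x = p) {e : (FunField X)ˣ}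
    (he : IsLocalGenerator I x e) {f : FunField X} (hf : v f ≤ 1) {N : ℕ}
    (h : (e : FunField X) ^ N * f ∈ stalkRange x) : f ∈ stalkRange x := by
  induction N with
  | zero => simpa using h
  | succ N ih =>
    apply ih
    have h1 : v ((e : FunField X) ^ (N + 1) * f) < 1 := by
      have h2 : v ((e : FunField X) ^ (N + 1)) < 1 := by
        rw [map_pow, M.valuation_generator he hx]
        refine pow_lt_one₀ zero_le ?_ (Nat.succ_ne_zero N)
        rw [← exp_zero, exp_lt_exp]
        omega
      rw [map_mul]
      calc _ ≤ v ((e : FunField X) ^ (N + 1)) * 1 := mul_le_mul_right hf _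
        _ = _ := mul_one _
        _ < 1 := h2
    have h3 := M.mul_inv_mem he hx h h1
    rwa [pow_succ, mul_right_comm, mul_assoc _ (e : FunField X), Units.mul_inv, mul_one] at h3

/-- A function regular off the exceptional divisor and of nonnegative order along it is
regular. -/
theorem mem_stalkRange_of_forall {x : X} (hx : π x = p) {e : (FunField X)ˣ}
    (he : IsLocalGenerator I x e) {f : FunField X} (hf : v f ≤ 1)
    (H : ∀ y, y ⤳ x → π y ≠ p → f ∈ stalkRange y) : f ∈ stalkRange x := by
  obtain ⟨N, hN⟩ := exists_pow_mul_mem_stalkRange (M.generator_mem he hx) (h := f)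
    -- At a point over `p` the inverse of `e` has negative order and is not regular; so only points
    -- off the exceptional divisor need testing.
    fun y hy hey => H y hy fun hpy => by
      obtain ⟨U, hxU, hU⟩ := he.exists_open
      have h1 := M.valuation_generator (hU y (hy.mem_open U.2 hxU)) hpy
      have h2 := M.valuation_le_one hpy hey
      rw [map_inv₀, h1, ← exp_neg, ← exp_zero, exp_le_exp] at h2
      omega
  exact M.mem_stalkRange_of_pow_mul_mem hx he hf hN

/-- A divisor that is trivial off the exceptional divisor is a multiple of it. -/
theorem exists_eq_zsmul (hI : IsInvertibleIdeal I) {D : CaDiv X}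
    (hD : ∀ x, π x ≠ p → D.germ x = 1) : ∃ k : ℤ, D = k • divisorOfIdeal I hI := by
  obtain ⟨_, hηU, gη, hgη⟩ := exists_isLocalEq D η
  replace hgη := hgη η hηU
  -- The multiplicity is the order of the local equation at `η`; the sign appears because order `k`
  -- means value `exp (-k)`.
  refine ⟨-log (v gη), CaDiv.ext fun x => ?_⟩
  obtain ⟨e, he⟩ := exists_isLocalGenerator hI x
  have hE := (isLocalEq_divisorOfIdeal hI he).zsmul (-log (v gη))
  by_cases hx : π x = p
  · obtain ⟨U, hxU, g, hg⟩ := exists_isLocalEq D x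
    obtain ⟨U', hxU', hU'⟩ := he.exists_open
    have hη := M.specializes hx
    -- A local equation at `x` is also one at its generization `η`, so the order does not depend on
    -- `x`.
    have hv : v g = v gη := by
      have h1 := M.valuation_eq_one M.map_center
        (hgη.iff_div_mem.mp (hg η (hη.mem_open U.2 hxU)))
      rw [Units.val_div_eq_div_val, map_div₀] at h1
      exact (div_eq_one_iff_eq ((Valuation.ne_zero_iff v).mpr gη.ne_zero)).mp h1
    -- The quotient has order zero and is a unit off the exceptional divisor, so it and its inverse
    -- are regular at `x`.
    have key : g / e ^ (-log (v gη)) ∈ unitsAt X x := by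
      have hvh : v ((g / e ^ (-log (v gη)) : (FunField X)ˣ) : FunField X) = 1 := by
        rw [Units.val_div_eq_div_val, map_div₀, Units.val_zpow_eq_zpow_val, map_zpow₀,
          M.valuation_generator he hx, ← exp_zsmul, hv]
        have : (-log (v gη)) • (-1 : ℤ) = log (v (gη : FunField X)) := by simp
        rw [this, exp_log ((Valuation.ne_zero_iff v).mpr gη.ne_zero),
          div_self ((Valuation.ne_zero_iff v).mpr gη.ne_zero)]
      have hoff : ∀ y, y ⤳ x → π y ≠ p → g / e ^ (-log (v gη)) ∈ unitsAt X y := by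
        intro y hy hpy
        refine div_mem ?_ (zpow_mem (M.mem_unitsAt (hU' y (hy.mem_open U'.2 hxU')) hpy) _)
        exact (hg y (hy.mem_open U.2 hxU)).germ_eq_one_iff.mp (hD y hpy)
      rw [mem_unitsAt_iff]
      refine ⟨M.mem_stalkRange_of_forall hx he hvh.le fun y hy hpy =>
          (mem_unitsAt_iff.mp (hoff y hy hpy)).1,
        M.mem_stalkRange_of_forall hx he ?_ fun y hy hpy =>
          (mem_unitsAt_iff.mp (hoff y hy hpy)).2⟩
      rw [Units.val_inv_eq_inv_val, map_inv₀, hvh, inv_one]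
    have h3 := hE.iff_div_mem.mpr key
    rw [h3, hg x hxU]
  · rw [hD x hx, eq_comm, hE.germ_eq_one_iff]
    exact zpow_mem (M.mem_unitsAt he hx) _

end IsBlowUpModel

end Pullback

end CoxRing

end

/-! ### Extending functions and Cartier divisors over a regular point -/

noncomputable section

open TopologicalSpace in
/-- In a noetherian sober space, a set `Z` with `Z ∪ {p}` closed that contains no generization of
the closed point `p` misses a neighbourhood of `p`. -/
theorem TopologicalSpace.exists_isOpen_disjoint_of_not_specializes {T : Type*} [TopologicalSpace T]
    [NoetherianSpace T] [QuasiSober T] {Z : Set T} {p : T} (hp : IsClosed ({p} : Set T))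
    (hZ : IsClosed (Z ∪ {p})) (h : ∀ z ∈ Z, ¬ z ⤳ p) :
    ∃ W : Set T, IsOpen W ∧ p ∈ W ∧ Disjoint W Z := by
  obtain ⟨S, hS, hSc, hSi, hSZ⟩ := NoetherianSpace.exists_finite_set_isClosed_irreducible hZ
  -- The irreducible pieces of `Z ∪ {p}` that miss `p`; the complement of their union is the
  -- neighbourhood.
  let N : Set T := ⋃₀ {C ∈ S | p ∉ C}
  have hN : IsClosed N := by
    rw [show N = ⋃ C ∈ {C ∈ S | p ∉ C}, C from Set.sUnion_eq_biUnion]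
    exact (hS.subset (Set.sep_subset _ _)).isClosed_biUnion fun C hC => hSc C hC.1
  refine ⟨Nᶜ, hN.isOpen_compl, ?_, Set.disjoint_left.mpr fun z hz hzZ => ?_⟩
  · rintro ⟨C, hC, hpC⟩
    exact hC.2 hpC
  · have h1 : z ∈ ⋃₀ S := hSZ ▸ Or.inl hzZ
    obtain ⟨C, hC, hzC⟩ := h1
    have hpC : p ∈ C := by
      by_contra hpC
      exact hz ⟨C, ⟨hC, hpC⟩, hzC⟩
    -- The generic point of a piece through `p` generizes `p`, hence is not in `Z`; so it is `p`,
    -- and the piece contains no point of `Z`.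
    obtain ⟨c, hc⟩ := QuasiSober.sober (hSi C hC) (hSc C hC)
    have hcp : c ⤳ p := hc.specializes hpC
    have hcz : c ⤳ z := hc.specializes hzC
    have hcm : c ∈ Z ∪ {p} := by
      rw [hSZ]
      exact ⟨C, hC, hc.mem⟩
    rcases hcm with hcZ | rfl
    · exact h c hcZ hcp
    · have hzc : z = c := hcz.mem_closed hp rfl
      exact h z hzZ (hzc ▸ specializes_rfl)

namespace CoxRing

universe u

section Extension

variable {Y : Scheme.{u}} [IsIntegral Y] {p : Y} [IsNoetherianRing (Y.presheaf.stalk p)]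
  [Infinite (IsLocalRing.ResidueField (Y.presheaf.stalk p))] {n : ℕ}
  {x : Fin (n + 2) → Y.presheaf.stalk p}

/-- A rational function regular at the proper generizations of a regular point of dimension at
least two is regular at the point. -/
theorem mem_stalkRange_of_forall_specializes (hx : IsRegularSystem x) {f : FunField Y}
    (hf : ∀ y, y ⤳ p → y ≠ p → f ∈ stalkRange y) : f ∈ stalkRange p := by
  refine hx.mem_range_of_forall_mem fun q hq => ?_
  rw [← primeOf_fromSpecStalk p q] at hq ⊢
  rw [localSubring_primeOf]
  refine hf _ (specializes_of_fromSpecStalk p q) fun h => hq ?_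
  rwa [primeOf_eq_closedPoint_iff]

/-- Local equations off a regular point of dimension at least two extend to a Cartier divisor. -/
theorem exists_caDiv_isLocalEq [TopologicalSpace.NoetherianSpace Y] (hp : IsClosed ({p} : Set Y))
    (hx : IsRegularSystem x) (g : Y → (FunField Y)ˣ)
    (hg : ∀ y, y ≠ p → ∃ U : Y.Opens, y ∈ U ∧ p ∉ U ∧ ∀ z ∈ U, g y / g z ∈ unitsAt Y z) :
    ∃ D : CaDiv Y, ∀ y, y ≠ p → IsLocalEq D y (g y) := by
  classical
  have hne : ∀ {q : PrimeSpectrum (Y.presheaf.stalk p)}, q ≠ IsLocalRing.closedPoint _ →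
      Y.fromSpecStalk p q ≠ p := fun {q} hq h => hq (by
    rw [← primeOf_fromSpecStalk p q, primeOf_eq_closedPoint_iff, h])
  -- On the punctured spectrum at `p` the divisor is principal, with equation `f⁻¹`.
  obtain ⟨f, hf⟩ := hx.exists_mul_mem_localUnits (K := FunField Y)
    (fun q => g (Y.fromSpecStalk p q)) fun q hq => by
      obtain ⟨U, hqU, -, hU⟩ := hg _ (hne hq)
      have hopen : IsOpen ((Y.fromSpecStalk p) ⁻¹' (U : Set Y)) :=
        U.2.preimage (Y.fromSpecStalk p).continuous
      obtain ⟨_, ⟨s, rfl⟩, hqs, hsU⟩ :=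
        PrimeSpectrum.isTopologicalBasis_basic_opens.exists_subset_of_mem_open
          (show q ∈ (Y.fromSpecStalk p) ⁻¹' (U : Set Y) from hqU) hopen
      refine ⟨s, hqs, fun q' _ hs => ?_⟩
      have h1 := hU _ (hsU hs)
      rwa [← localUnits_primeOf (specializes_of_fromSpecStalk p q'), primeOf_fromSpecStalk] at h1
  replace hf : ∀ y, y ⤳ p → y ≠ p → f * g y ∈ unitsAt Y y := by
    intro y hy hyp
    have h1 := hf (primeOf hy) (by rwa [Ne, primeOf_eq_closedPoint_iff])
    rwa [localUnits_primeOf, fromSpecStalk_primeOf] at h1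
  let Z : Set Y := {y | y ≠ p ∧ f * g y ∉ unitsAt Y y}
  have hZ : IsClosed (Z ∪ {p}) := by
    rw [← isOpen_compl_iff, isOpen_iff_forall_mem_open]
    intro y hy
    have hyp : y ≠ p := fun h => hy (Or.inr h)
    have hyu : f * g y ∈ unitsAt Y y := by
      by_contra h
      exact hy (Or.inl ⟨hyp, h⟩)
    obtain ⟨U, hyU, hpU, hU⟩ := hg y hyp
    obtain ⟨V, hyV, hV⟩ := exists_open_forall_mem_unitsAt hyu
    refine ⟨(U ⊓ V : Y.Opens), ?_, (U ⊓ V).2, ⟨hyU, hyV⟩⟩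
    rintro z ⟨hzU, hzV⟩ (hz | rfl)
    · refine hz.2 ?_
      have h3 := div_mem (hV z hzV) (hU z hzU)
      rwa [mul_div_assoc, div_div_cancel] at h3
    · exact hpU hzU
  -- `Z` collects the points where `f⁻¹` is not a local equation. None generizes `p`, so a
  -- neighbourhood of `p` avoids them and `f⁻¹` can serve as equation at `p`.
  obtain ⟨W, hW, hpW, hdisj⟩ := TopologicalSpace.exists_isOpen_disjoint_of_not_specializes hp hZ
    fun z hz hzp => hz.2 (hf z hzp hz.1)
  refine ⟨CaDiv.mk (fun y => if y = p then f⁻¹ else g y) fun y => ?_, fun y hy => ?_⟩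
  · by_cases hy : y = p
    · subst hy
      refine ⟨⟨W, hW⟩, hpW, fun z hz => ?_⟩
      by_cases hzp : z = y
      · rw [hzp, div_self']
        exact one_mem _
      · have h1 : f * g z ∈ unitsAt Y z := by
          by_contra h
          exact Set.disjoint_left.mp hdisj hz ⟨hzp, h⟩
        simp only [if_pos, if_neg hzp]
        rw [div_eq_mul_inv, ← mul_inv]
        exact inv_mem h1
    · obtain ⟨U, hyU, hpU, hU⟩ := hg y hy
      refine ⟨U, hyU, fun z hz => ?_⟩
      have hzp : z ≠ p := by
        rintro rfl
        exact hpU hz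
      simp only [if_neg hy, if_neg hzp]
      exact hU z hz
  · have := isLocalEq_mk (X := Y) (fun y => if y = p then f⁻¹ else g y)
    simp only [IsLocalEq] at this ⊢
    rw [this, if_neg hy]

end Extension

/-! ### Divisors and sections of the blow-up in terms of the base -/

section Decomposition

variable {X Y : Scheme.{u}} [IsIntegral X] [IsIntegral Y] {π : X ⟶ Y} {p : Y}
  {I : X.IdealSheafData} {φ : FunField Y ≃+* FunField X}
  {v : Valuation (FunField X) (WithZero (Multiplicative ℤ))} {η : X}

namespace IsBlowUpModel

open WithZero

/-- Off the centre neighbourhoods come from the base, so points with the same image have the same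
neighbourhoods, and schemes are T₀. -/
theorem injective_off_center (M : IsBlowUpModel π p I φ v η) {z z' : X} (h : π z = π z')
    (hz : π z' ≠ p) : z = z' := by
  have key : ∀ {a b : X}, π a = π b → π b ≠ p → a ⤳ b := fun {a b} hab hb => by
    rw [specializes_iff_forall_open]
    intro W hW hbW
    obtain ⟨V, hbV, -, hV⟩ := M.exists_open hb (W := ⟨W, hW⟩) hbW
    exact hV a (hab ▸ hbV)
  exact ((key h hz).antisymm (key h.symm (h ▸ hz))).eq

/-- Pulled-back sections are regular, and multiplying by `e ^ k` with `k ≥ 0` keeps them so. -/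
theorem map_mem_H0 (M : IsBlowUpModel π p I φ v η) (hI : IsInvertibleIdeal I)
    {D' : CaDiv Y} {k : ℤ} (hk : 0 ≤ k) {f : FunField Y} (hf : f ∈ H0 D') :
    φ f ∈ H0 (M.pullback D' + k • divisorOfIdeal I hI) := by
  rw [mem_H0_iff_exists]
  intro z
  obtain ⟨_, hU, g, hg⟩ := exists_isLocalEq D' (π z)
  replace hg := hg _ hU
  obtain ⟨e, he⟩ := exists_isLocalGenerator hI z
  refine ⟨_, (M.isLocalEq_pullback hg).add ((isLocalEq_divisorOfIdeal hI he).zsmul k), ?_⟩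
  rw [Units.val_mul, ← mul_assoc]
  refine mul_mem ?_ ?_
  · have := M.map_mem (hf _ g hg)
    rwa [map_mul] at this
  · lift k to ℕ using hk
    rw [zpow_natCast, Units.val_pow_eq_pow_val]
    refine pow_mem ?_ k
    by_cases hz : π z = p
    · exact M.generator_mem he hz
    · exact (mem_unitsAt_iff.mp (M.mem_unitsAt he hz)).1

variable [IsNoetherianRing (Y.presheaf.stalk p)]
  [Infinite (IsLocalRing.ResidueField (Y.presheaf.stalk p))] {n : ℕ}
  {x : Fin (n + 2) → Y.presheaf.stalk p}

/-- The divisor is carried to the complement of `p`, where `π` is an isomorphism, and extended over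
`p`. -/
theorem exists_pullback_germ_eq [TopologicalSpace.NoetherianSpace Y]
    (M : IsBlowUpModel π p I φ v η) (hp : IsClosed ({p} : Set Y)) (hx : IsRegularSystem x)
    (D : CaDiv X) : ∃ D' : CaDiv Y, ∀ z, π z ≠ p → (M.pullback D').germ z = D.germ z := by
  let ψ := Units.mapEquiv φ.toMulEquiv
  choose σ hσ using fun (y : Y) (hy : y ≠ p) => M.exists_eq hy
  choose g hg using fun z : X => show ∃ g, IsLocalEq D z g by
    obtain ⟨U, hz, g, hg⟩ := exists_isLocalEq D z
    exact ⟨g, hg z hz⟩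
  classical
  let g' : Y → (FunField Y)ˣ := fun y => if hy : y ≠ p then ψ.symm (g (σ y hy)) else 1
  have hg' : ∀ z, π z ≠ p → IsLocalEq D z (ψ (g' (π z))) := by
    intro z hz
    simp only [g', dif_pos hz, MulEquiv.apply_symm_apply]
    rw [M.injective_off_center (hσ (π z) hz) hz]
    exact hg z
  obtain ⟨D', hD'⟩ := exists_caDiv_isLocalEq hp hx g' fun y hy => by
    obtain ⟨z, rfl⟩ := M.exists_eq hy
    obtain ⟨W, hzW, hW⟩ := (hg' z hy).exists_open
    obtain ⟨V, hzV, hpV, hV⟩ := M.exists_open hy hzW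
    refine ⟨V, hzV, hpV, fun y' hy' => ?_⟩
    have hyp' : y' ≠ p := by
      rintro rfl
      exact hpV hy'
    obtain ⟨z', rfl⟩ := M.exists_eq hyp'
    apply M.mem_unitsAt_of_map_mem hyp'
    rw [map_div]
    exact (hg' z' hyp').iff_div_mem.mp (hW z' (hV z' hy'))
  refine ⟨D', fun z hz => ?_⟩
  rw [M.isLocalEq_pullback (hD' _ hz), hg' z hz]

/-- The difference from the pullback just constructed is trivial off the exceptional divisor, hence
a multiple of it. -/
theorem exists_eq_pullback_add [TopologicalSpace.NoetherianSpace Y]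
    (M : IsBlowUpModel π p I φ v η) (hI : IsInvertibleIdeal I) (hp : IsClosed ({p} : Set Y))
    (hx : IsRegularSystem x) (D : CaDiv X) :
    ∃ (D' : CaDiv Y) (k : ℤ), D = M.pullback D' + k • divisorOfIdeal I hI := by
  obtain ⟨D', hD'⟩ := M.exists_pullback_germ_eq hp hx D
  obtain ⟨k, hk⟩ := M.exists_eq_zsmul hI (D := -M.pullback D' + D) fun z hz => by
    rw [CaDiv.germ_add, CaDiv.germ_neg, hD' z hz, inv_mul_cancel]
  exact ⟨D', k, eq_add_of_neg_add_eq hk⟩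

/-- Off `p` the local equations of `D'` are units; they and their inverses extend over `p`, so `D' =
0`. The order along the exceptional divisor then gives `k = 0`. -/
theorem eq_zero_of_pullback_add_eq_zero (M : IsBlowUpModel π p I φ v η) (hI : IsInvertibleIdeal I)
    (hx : IsRegularSystem x) {D' : CaDiv Y} {k : ℤ}
    (h : M.pullback D' + k • divisorOfIdeal I hI = 0) : D' = 0 ∧ k = 0 := by
  have hoff : ∀ y, y ≠ p → D'.germ y = 1 := by
    intro y hy
    obtain ⟨z, rfl⟩ := M.exists_eq hy
    obtain ⟨_, hU, g, hg⟩ := exists_isLocalEq D' (π z)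
    replace hg := hg _ hU
    obtain ⟨e, he⟩ := exists_isLocalGenerator hI z
    have h1 := (M.isLocalEq_pullback hg).add ((isLocalEq_divisorOfIdeal hI he).zsmul k)
    rw [h] at h1
    have h2 := h1.germ_eq_one_iff.mp rfl
    rw [mul_mem_cancel_right (zpow_mem (M.mem_unitsAt he hy) k)] at h2
    exact hg.germ_eq_one_iff.mpr (M.mem_unitsAt_of_map_mem hy h2)
  have hD' : D' = 0 := by
    refine CaDiv.ext fun y => ?_
    by_cases hy : y = p
    · subst hy
      obtain ⟨U, hyU, g, hg⟩ := exists_isLocalEq D' y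
      refine (hg y hyU).germ_eq_one_iff.mpr ?_
      have hu : ∀ z, z ⤳ y → z ≠ y → g ∈ unitsAt Y z := fun z hz hzy =>
        (hg z (hz.mem_open U.2 hyU)).germ_eq_one_iff.mp (hoff z hzy)
      rw [mem_unitsAt_iff]
      exact ⟨mem_stalkRange_of_forall_specializes hx fun z hz hzy =>
          (mem_unitsAt_iff.mp (hu z hz hzy)).1,
        mem_stalkRange_of_forall_specializes hx fun z hz hzy =>
          (mem_unitsAt_iff.mp (hu z hz hzy)).2⟩
    · exact hoff y hy
  refine ⟨hD', ?_⟩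
  rw [hD', map_zero, zero_add] at h
  obtain ⟨e, he⟩ := exists_isLocalGenerator hI η
  have h1 := (isLocalEq_divisorOfIdeal hI he).zsmul k
  rw [h] at h1
  have h2 := M.valuation_eq_one M.map_center (h1.germ_eq_one_iff.mp rfl)
  rw [Units.val_zpow_eq_zpow_val, map_zpow₀, M.valuation_generator he M.map_center, ← exp_zsmul,
    ← exp_zero, exp_inj] at h2
  simpa using h2

/-- Sections of a divisor on the blow-up are sections of a divisor on the base. -/
theorem symm_mem_H0 (M : IsBlowUpModel π p I φ v η) (hI : IsInvertibleIdeal I)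
    (hx : IsRegularSystem x) {D' : CaDiv Y} {k : ℤ} {f : FunField X}
    (hf : f ∈ H0 (M.pullback D' + k • divisorOfIdeal I hI)) : φ.symm f ∈ H0 D' := by
  -- Off the centre `e ^ k` is a unit, so the sign of `k` plays no role; the point `p` is then
  -- reached by extension.
  have hoff : ∀ y, y ≠ p → ∀ g, IsLocalEq D' y g → φ.symm f * g ∈ stalkRange y := by
    intro y hy g hg
    obtain ⟨z, rfl⟩ := M.exists_eq hy
    obtain ⟨e, he⟩ := exists_isLocalGenerator hI z
    have h1 := hf z _ ((M.isLocalEq_pullback hg).add ((isLocalEq_divisorOfIdeal hI he).zsmul k))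
    have h2 := (mem_unitsAt_iff.mp (zpow_mem (M.mem_unitsAt he hy) k)).2
    have h3 := mul_mem h1 h2
    rw [mul_assoc, ← Units.val_mul, mul_inv_cancel_right] at h3
    apply M.mem_of_map_mem hy
    rw [map_mul, φ.apply_symm_apply]
    exact h3
  rw [mem_H0_iff_exists]
  intro y
  obtain ⟨U, hyU, g, hg⟩ := exists_isLocalEq D' y
  refine ⟨g, hg y hyU, ?_⟩
  by_cases hy : y = p
  · subst hy
    exact mem_stalkRange_of_forall_specializes hx fun z hz hzy =>
      hoff z hzy g (hg z (hz.mem_open U.2 hyU))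
  · exact hoff y hy g (hg y hyU)

end IsBlowUpModel

end Decomposition

end CoxRing

end

noncomputable section

/-! ### Comparison of graded rings of rational functions -/

section GradedComparison

open DirectSum LaurentPolynomial

variable {ι ι' K K' : Type*} [AddCommGroup ι] [DecidableEq ι] [AddCommGroup ι'] [DecidableEq ι']
  [Field K] [Field K'] {𝒜 : ι → AddSubgroup K} {ℬ : ι' → AddSubgroup K'} [SetLike.GradedMonoid 𝒜]
  [SetLike.GradedMonoid ℬ] {φ : K ≃+* K'} {h : Multiplicative ι →* Kˣ} {θ : ι ≃+ ι' × ℤ}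

/-- Compares monomials whose degrees are equal only propositionally. -/
theorem C_of_mul_T_congr {b b' : ι'} {j j' : ℤ} {g : ℬ b} {g' : ℬ b'} (hb : b = b') (hj : j = j')
    (hg : (g : K') = g') :
    (C (of (fun b => ℬ b) b g) * T j : LaurentPolynomial (⨁ b, ℬ b)) =
      C (of (fun b => ℬ b) b' g') * T j' := by
  subst hb hj
  rw [Subtype.ext hg]

/-- The homomorphism of graded rings defined by a regrading and a twist by a character. -/
def gradedComparison (hφ : ∀ n, ∀ f ∈ 𝒜 n, φ (f * h (.ofAdd n)) ∈ ℬ (θ n).1) :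
    (⨁ n, 𝒜 n) →+* LaurentPolynomial (⨁ b, ℬ b) :=
  DirectSum.toSemiring
    (fun n =>
      { toFun := fun f => C (of (fun b => ℬ b) (θ n).1 ⟨φ (f * h (.ofAdd n)), hφ n f f.2⟩) *
          T (θ n).2
        map_zero' := by
          have : (⟨φ ((0 : 𝒜 n) * h (.ofAdd n)), hφ n _ (0 : 𝒜 n).2⟩ : ℬ (θ n).1) = 0 :=
            Subtype.ext (by simp)
          rw [this, map_zero, map_zero, zero_mul]
        map_add' := fun f g => by
          have : (⟨φ ((f + g : 𝒜 n) * h (.ofAdd n)), hφ n _ (f + g).2⟩ : ℬ (θ n).1) =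
              ⟨φ (f * h (.ofAdd n)), hφ n f f.2⟩ + ⟨φ (g * h (.ofAdd n)), hφ n g g.2⟩ :=
            Subtype.ext (by simp [add_mul])
          rw [this, map_add, map_add, add_mul] })
    (by
      refine (C_of_mul_T_congr (g' := (⟨1, SetLike.GradedOne.one_mem⟩ : ℬ 0))
        (b' := 0) (j' := 0) (by simp) (by simp) ?_).trans ?_
      · change φ ((1 : K) * _) = 1
        simp
      · have : of (fun b => ℬ b) 0 ⟨1, SetLike.GradedOne.one_mem⟩ = (1 : ⨁ b, ℬ b) := rfl
        rw [this, T_zero, map_one, one_mul])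
    (fun {i j} f g => by
      have h1 : ∀ (a b : ⨁ b, ℬ b) (k l : ℤ), (C a * T k) * (C b * T l) = C (a * b) * T (k + l) :=
        fun a b k l => by rw [map_mul, T_add, mul_mul_mul_comm]
      refine Eq.trans ?_ (h1 _ _ _ _).symm
      rw [of_mul_of]
      refine C_of_mul_T_congr (by simp) (by simp) ?_
      change φ ((f * g : K) * _) = φ _ * φ _
      rw [← map_mul, ofAdd_add, map_mul h, Units.val_mul, mul_mul_mul_comm])

variable (hφ : ∀ n, ∀ f ∈ 𝒜 n, φ (f * h (.ofAdd n)) ∈ ℬ (θ n).1)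

theorem gradedComparison_of (n : ι) (f : 𝒜 n) : gradedComparison hφ (of (fun n => 𝒜 n) n f) =
    C (of (fun b => ℬ b) (θ n).1 ⟨φ (f * h (.ofAdd n)), hφ n f f.2⟩) * T (θ n).2 :=
  DirectSum.toSemiring_of _ _ _ _ _

/-- Distinct degrees have distinct images under `θ`, so each component can be read off from one
coefficient; injectivity follows. -/
theorem coeff_gradedComparison (a : ⨁ n, 𝒜 n) (n : ι) :
    (((gradedComparison hφ a).coeff (θ n).2 (θ n).1 : ℬ (θ n).1) : K') =
      φ (a n * h (.ofAdd n)) := by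
  induction a using DirectSum.induction_on with
  | zero => simp
  | add a b ha hb =>
    rw [map_add, AddMonoidAlgebra.coeff_add, Finsupp.add_apply, DirectSum.add_apply,
      AddSubgroup.coe_add, ha, hb, DirectSum.add_apply, AddSubgroup.coe_add, add_mul, map_add]
  | of k f =>
    rw [gradedComparison_of, ← single_eq_C_mul_T, AddMonoidAlgebra.coeff_single]
    by_cases hk : k = n
    · subst hk
      rw [Finsupp.single_eq_same, of_eq_same, of_eq_same]
    · rw [of_eq_of_ne _ _ _ (Ne.symm hk), ZeroMemClass.coe_zero, zero_mul, map_zero]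
      by_cases h2 : (θ n).2 = (θ k).2
      · have h1 : (θ n).1 ≠ (θ k).1 := fun h1 => hk (θ.injective (Prod.ext h1 h2)).symm
        rw [h2, Finsupp.single_eq_same, of_eq_of_ne _ _ _ h1]
        rfl
      · rw [Finsupp.single_eq_of_ne h2]
        rfl

theorem gradedComparison_injective : Function.Injective (gradedComparison hφ) := by
  rw [injective_iff_map_eq_zero]
  intro a ha
  refine DFinsupp.ext fun n => Subtype.ext ?_
  have h1 := coeff_gradedComparison hφ a n
  rw [ha] at h1
  have h2 : φ ((a n : K) * h (.ofAdd n)) = 0 := h1.symm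
  rw [map_eq_zero_iff φ φ.injective, mul_eq_zero] at h2
  exact h2.resolve_right (Units.ne_zero _)

variable (hsurj : ∀ n, 0 ≤ (θ n).2 → ∀ g ∈ ℬ (θ n).1, ∃ f ∈ 𝒜 n, φ (f * h (.ofAdd n)) = g)

include hsurj in
theorem C_of_mul_T_mem_range (b : ι') (g : ℬ b) {j : ℤ} (hj : 0 ≤ j) :
    C (of (fun b => ℬ b) b g) * T j ∈ (gradedComparison hφ).range := by
  have hn : θ (θ.symm (b, j)) = (b, j) := θ.apply_symm_apply _
  obtain ⟨f, hf, hfg⟩ := hsurj (θ.symm (b, j)) (by rw [hn]; exact hj) g (by rw [hn]; exact g.2)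
  refine ⟨of (fun n => 𝒜 n) _ ⟨f, hf⟩, ?_⟩
  rw [gradedComparison_of]
  exact C_of_mul_T_congr (congrArg Prod.fst hn) (congrArg Prod.snd hn) hfg

-- All of `Cox(X')[T]` is reached, but negative powers of `T` need not be.
include hsurj in
theorem toLaurent_mem_range (q : Polynomial (⨁ b, ℬ b)) :
    Polynomial.toLaurent q ∈ (gradedComparison hφ).range := by
  have hC : ∀ a : ⨁ b, ℬ b, C a ∈ (gradedComparison hφ).range := by
    intro a
    induction a using DirectSum.induction_on with
    | zero => rw [map_zero]; exact zero_mem _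
    | add a b ha hb => rw [map_add]; exact add_mem ha hb
    | of b g =>
      have := C_of_mul_T_mem_range hφ hsurj b g le_rfl
      rwa [T_zero, mul_one] at this
  have hT : T 1 ∈ (gradedComparison hφ).range := by
    have h1 := C_of_mul_T_mem_range hφ hsurj 0 ⟨1, SetLike.GradedOne.one_mem⟩ zero_le_one
    have h2 : of (fun b => ℬ b) 0 ⟨1, SetLike.GradedOne.one_mem⟩ = (1 : ⨁ b, ℬ b) := rfl
    rwa [h2, map_one, one_mul] at h1
  induction q using Polynomial.induction_on' with
  | add q q' hq hq' => rw [map_add]; exact add_mem hq hq'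
  | monomial k a =>
    rw [← Polynomial.C_mul_X_pow_eq_monomial, map_mul, map_pow, Polynomial.toLaurent_C,
      Polynomial.toLaurent_X]
    exact mul_mem (hC a) (pow_mem hT k)

include hφ hsurj in
/-- Inverting a homogeneous element of degree `(0, 1)` whose image is invertible gives a ring of
Laurent polynomials. -/
theorem nonempty_localizationAway_equiv {m : ι} (hm : θ m = (0, 1)) (s : 𝒜 m)
    (hs : (s : K) ≠ 0) (hs' : (φ (s * h (.ofAdd m)))⁻¹ ∈ ℬ 0) :
    Nonempty (Localization.Away (of (fun n => 𝒜 n) m s) ≃+* LaurentPolynomial (⨁ b, ℬ b)) := by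
  let Ψ := gradedComparison hφ
  let := Ψ.toAlgebra
  have hu0 : φ (s * h (.ofAdd m)) ≠ 0 :=
    (map_ne_zero_iff φ φ.injective).mpr (mul_ne_zero hs (Units.ne_zero _))
  have hu : φ (s * h (.ofAdd m)) ∈ ℬ 0 := by
    have := hφ m s s.2
    rwa [hm] at this
  have hΨs : Ψ (of (fun n => 𝒜 n) m s) = C (of (fun b => ℬ b) 0 ⟨_, hu⟩) * T 1 := by
    refine (gradedComparison_of hφ m s).trans ?_
    exact C_of_mul_T_congr (congrArg Prod.fst hm) (congrArg Prod.snd hm) rfl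
  have hinv : of (fun b => ℬ b) 0 ⟨_, hu⟩ * of (fun b => ℬ b) 0 ⟨_, hs'⟩ = 1 := by
    rw [of_mul_of]
    refine of_eq_of_gradedMonoid_eq (Sigma.subtype_ext (zero_add 0) ?_)
    exact mul_inv_cancel₀ hu0
  have hunit : IsUnit (Ψ (of (fun n => 𝒜 n) m s)) := by
    rw [hΨs]
    exact ((IsUnit.of_mul_eq_one _ hinv).map C).mul (isUnit_T 1)
  have hloc : IsLocalization.Away (of (fun n => 𝒜 n) m s) (LaurentPolynomial (⨁ b, ℬ b)) := by
    -- The comparison map is injective, so equal images need no extra power of the section.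
    refine IsLocalization.Away.mk _ hunit (fun z => ?_) fun a b hab =>
      ⟨0, by rw [gradedComparison_injective hφ hab]⟩
    obtain ⟨N, q, hq⟩ := z.exists_T_pow
    obtain ⟨a, ha⟩ := toLaurent_mem_range hφ hsurj q
    obtain ⟨c, hc⟩ := C_of_mul_T_mem_range hφ hsurj 0 ⟨_, hu⟩ le_rfl
    -- The section maps to `u T` with `u` of degree 0, and `z (u T) ^ N = (z T ^ N) u ^ N`; the
    -- first factor is a polynomial, and `c` is a preimage of `u`.
    refine ⟨N, a * c ^ N, ?_⟩
    change z * Ψ (of (fun n => 𝒜 n) m s) ^ N = gradedComparison hφ (a * c ^ N)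
    rw [hΨs, map_mul (gradedComparison hφ), map_pow (gradedComparison hφ), ha, hc, hq, mul_pow, T_pow, T_zero, mul_one, mul_one]
    ring
  exact ⟨(IsLocalization.algEquiv (Submonoid.powers (of (fun n => 𝒜 n) m s))
    (Localization.Away (of (fun n => 𝒜 n) m s)) (LaurentPolynomial (⨁ b, ℬ b))).toRingEquiv⟩

end GradedComparison

end

noncomputable section

namespace CoxRing

universe u

/-! ### Cox rings of blow-ups -/

section FreelyGenerates

variable {X : Scheme.{u}} [IsIntegral X] {r : ℕ} {D : Fin r → CaDiv X}

/-- The homomorphism `m ↦ m₁D₁ + … + m_rD_r`. -/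
def comb (D : Fin r → CaDiv X) : (Fin r → ℤ) →+ CaDiv X :=
  (Fintype.linearCombination ℤ D).toAddMonoidHom

theorem comb_apply (m : Fin r → ℤ) : comb D m = ∑ i, m i • D i :=
  Fintype.linearCombination_apply ℤ D m

theorem mk_comb (m : Fin r → ℤ) : (QuotientAddGroup.mk (comb D m) : Pic X) =
    ∑ i, m i • (QuotientAddGroup.mk (D i) : Pic X) := by
  rw [comb_apply]
  exact map_sum (QuotientAddGroup.mk' (principal X).range) _ _

theorem FreelyGeneratesPic.eq_zero (hD : FreelyGeneratesPic D) {m : Fin r → ℤ}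
    {f : Additive (FunField X)ˣ} (h : comb D m = principal X f) : m = 0 := by
  refine funext (Fintype.linearIndependent_iff.mp hD.1 m ?_)
  rw [← mk_comb, QuotientAddGroup.eq_zero_iff, h]
  exact ⟨f, rfl⟩

theorem FreelyGeneratesPic.exists_eq (hD : FreelyGeneratesPic D) (D₀ : CaDiv X) :
    ∃ (m : Fin r → ℤ) (f : Additive (FunField X)ˣ), D₀ = comb D m + principal X f := by
  have h1 : (QuotientAddGroup.mk D₀ : Pic X) ∈
      Submodule.span ℤ (Set.range fun i => (QuotientAddGroup.mk (D i) : Pic X)) := by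
    rw [hD.2]
    trivial
  obtain ⟨m, hm⟩ := (Submodule.mem_span_range_iff_exists_fun ℤ).mp h1
  rw [← mk_comb, QuotientAddGroup.eq] at hm
  obtain ⟨f, hf⟩ := hm
  exact ⟨m, f, by rw [hf, add_neg_cancel_left]⟩

end FreelyGenerates

section Regrading

variable {X Y : Scheme.{u}} [IsIntegral X] [IsIntegral Y] {π : X ⟶ Y} {p : Y}
  {I : X.IdealSheafData} {φ : FunField Y ≃+* FunField X}
  {v : Valuation (FunField X) (WithZero (Multiplicative ℤ))} {η : X}
  [IsNoetherianRing (Y.presheaf.stalk p)]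
  [Infinite (IsLocalRing.ResidueField (Y.presheaf.stalk p))] {n : ℕ}
  {x : Fin (n + 2) → Y.presheaf.stalk p} {r r' : ℕ} {D : Fin r → CaDiv X} {D' : Fin r' → CaDiv Y}

namespace IsBlowUpModel

/-- A principal divisor on `X` is a pullback, so independence on the level of divisors gives
independence of classes. The last conclusion, that `f` is a global unit, later makes the degree 0
factor of the image of `x_E` invertible. -/
theorem eq_zero_of_pullback_comb_add_eq_principal (M : IsBlowUpModel π p I φ v η)
    (hI : IsInvertibleIdeal I) (hx : IsRegularSystem x) (hD' : FreelyGeneratesPic D')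
    {a : Fin r' → ℤ} {k : ℤ} {f : (FunField X)ˣ}
    (h : M.pullback (comb D' a) + k • divisorOfIdeal I hI = principal X (Additive.ofMul f)) :
    a = 0 ∧ k = 0 ∧ principal Y (Additive.ofMul ((Units.mapEquiv φ.toMulEquiv).symm f)) = 0 := by
  have h1 : principal X (Additive.ofMul f) =
      M.pullback (principal Y (Additive.ofMul ((Units.mapEquiv φ.toMulEquiv).symm f))) := by
    rw [M.pullback_principal, MulEquiv.apply_symm_apply]
  obtain ⟨h2, h3⟩ := M.eq_zero_of_pullback_add_eq_zero hI hx
    (D' := comb D' a - principal Y (Additive.ofMul ((Units.mapEquiv φ.toMulEquiv).symm f)))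
    (k := k) (by rw [map_sub, ← h1, ← h]; abel)
  have ha : a = 0 := hD'.eq_zero (sub_eq_zero.mp h2)
  refine ⟨ha, h3, ?_⟩
  rw [ha, map_zero, zero_sub, neg_eq_zero] at h2
  exact h2

/-- The degrees of the Cox ring of the blow-up, in terms of those of the base and of multiples of
the exceptional divisor. -/
theorem exists_regrading [TopologicalSpace.NoetherianSpace Y] (M : IsBlowUpModel π p I φ v η)
    (hI : IsInvertibleIdeal I) (hp : IsClosed ({p} : Set Y)) (hx : IsRegularSystem x)
    (hD : FreelyGeneratesPic D) (hD' : FreelyGeneratesPic D') :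
    ∃ (θ : (Fin r → ℤ) ≃+ (Fin r' → ℤ) × ℤ) (h : Multiplicative (Fin r → ℤ) →* (FunField X)ˣ),
      ∀ m, comb D m = M.pullback (comb D' (θ m).1) + (θ m).2 • divisorOfIdeal I hI +
        principal X (Additive.ofMul (h (.ofAdd m))) := by
  let E := divisorOfIdeal I hI
  let F : (Fin r' → ℤ) × ℤ →+ CaDiv X :=
    (M.pullback.comp (comb D')).coprod (zmultiplesHom (CaDiv X) E)
  have hF : ∀ b, F b = M.pullback (comb D' b.1) + b.2 • E := fun b => rfl
  have hgen : ∀ D₀ : CaDiv X, ∃ (b : (Fin r' → ℤ) × ℤ) (f : Additive (FunField X)ˣ),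
      D₀ = F b + principal X f := by
    intro D₀
    obtain ⟨D₁, k, h1⟩ := M.exists_eq_pullback_add hI hp hx D₀
    obtain ⟨a, f, h2⟩ := hD'.exists_eq D₁
    refine ⟨(a, k), Additive.ofMul (Units.mapEquiv φ.toMulEquiv f.toMul), ?_⟩
    rw [h1, h2, map_add, hF, ← M.pullback_principal, ofMul_toMul]
    exact add_right_comm _ _ _
  have hinj : ∀ (b : (Fin r' → ℤ) × ℤ) (f : Additive (FunField X)ˣ), F b = principal X f →
      b = 0 := by
    intro b f h
    obtain ⟨h1, h2, -⟩ := M.eq_zero_of_pullback_comb_add_eq_principal hI hx hD' (f := f.toMul) h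
    exact Prod.ext h1 h2
  -- Rational functions are chosen only for the basis `D i` and extended linearly; this makes the
  -- twist a character.
  choose b f hbf using fun i => hgen (D i)
  let θ₀ : (Fin r → ℤ) →ₗ[ℤ] (Fin r' → ℤ) × ℤ := Fintype.linearCombination ℤ b
  let H : (Fin r → ℤ) →ₗ[ℤ] Additive (FunField X)ˣ := Fintype.linearCombination ℤ f
  have key : ∀ m, comb D m = F (θ₀ m) + principal X (H m) := by
    intro m
    have h1 : θ₀ m = ∑ i, m i • b i := Fintype.linearCombination_apply ℤ b m
    have h2 : H m = ∑ i, m i • f i := Fintype.linearCombination_apply ℤ f m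
    rw [comb_apply, h1, h2, map_sum, map_sum, ← Finset.sum_add_distrib]
    refine Finset.sum_congr rfl fun i _ => ?_
    rw [map_zsmul, map_zsmul, ← zsmul_add, ← hbf]
  -- Both the `D i` and the pullbacks together with `E` freely generate the Picard group, so the
  -- change of coordinates is bijective.
  have hbij : Function.Bijective θ₀ := by
    constructor
    · rw [injective_iff_map_eq_zero]
      intro m hm
      have h1 := key m
      rw [hm, map_zero, zero_add] at h1
      exact hD.eq_zero h1
    · intro c
      obtain ⟨m, g, hm⟩ := hD.exists_eq (F c)
      refine ⟨m, ?_⟩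
      rw [key m] at hm
      have h1 := hinj (c - θ₀ m) (H m + g) (by rw [map_sub, hm, map_add]; abel)
      exact (sub_eq_zero.mp h1).symm
  exact ⟨AddEquiv.ofBijective θ₀.toAddMonoidHom hbij,
    { toFun := fun m => (H m.toAdd).toMul
      map_one' := by rw [toAdd_one, map_zero]; rfl
      map_mul' := fun m m' => by rw [toAdd_mul, map_add]; rfl }, key⟩

/-- The localization of the Cox ring of the blow-up at a section defining the exceptional
divisor. -/
theorem nonempty_cox_equiv [TopologicalSpace.NoetherianSpace Y] (M : IsBlowUpModel π p I φ v η)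
    (hI : IsInvertibleIdeal I) (hp : IsClosed ({p} : Set Y)) (hx : IsRegularSystem x)
    (hD : FreelyGeneratesPic D) (hD' : FreelyGeneratesPic D') (m : Fin r → ℤ)
    (s : H0 (∑ i, m i • D i)) (hs : HasZeroDivisor s (divisorOfIdeal I hI)) :
    Nonempty (Localization.Away (Cox.ofSection D m s) ≃+* LaurentPolynomial (Cox D')) := by
  obtain ⟨θ, h, hθ⟩ := M.exists_regrading hI hp hx hD hD'
  obtain ⟨f, hfs, hf⟩ := hs
  rw [← comb_apply, hθ m, add_assoc, ← map_add, ← ofMul_mul] at hf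
  -- Comparing the divisor of the section with `E` puts it in degree `(0, 1)` and shows that its
  -- twisted function has trivial divisor.
  obtain ⟨h1, h2, h3⟩ := M.eq_zero_of_pullback_comb_add_eq_principal hI hx hD'
    (a := (θ m).1) (k := (θ m).2 - 1) (f := (h (.ofAdd m) * f)⁻¹) (by
      rw [ofMul_inv, map_neg, eq_neg_iff_add_eq_zero, sub_smul, one_smul, ← add_sub_assoc,
        sub_add_eq_add_sub, hf, sub_self])
  refine nonempty_localizationAway_equiv (𝒜 := coxPiece D) (ℬ := coxPiece D') (φ := φ.symm)
    (h := h) (θ := θ) ?_ ?_ (m := m) (Prod.ext h1 (by rw [← sub_eq_zero]; exact h2)) s ?_ ?_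
  · intro k g hg
    rw [coxPiece, ← comb_apply, hθ k, ← mul_mem_H0_iff] at hg
    rw [coxPiece, ← comb_apply]
    exact M.symm_mem_H0 hI hx hg
  · intro k hk g hg
    rw [coxPiece, ← comb_apply] at hg
    refine ⟨φ g * ↑(h (.ofAdd k))⁻¹, ?_, ?_⟩
    · rw [coxPiece, ← comb_apply, hθ k, ← mul_mem_H0_iff, mul_assoc, Units.inv_mul, mul_one]
      exact M.map_mem_H0 hI hk hg
    · rw [mul_assoc, Units.inv_mul, mul_one, φ.symm_apply_apply]
  · rw [← hfs]
    exact f.ne_zero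
  -- The inverse of a function with trivial divisor is a section of the zero divisor.
  · have h4 : (1 : FunField Y) * ((Units.mapEquiv φ.toMulEquiv).symm (h (.ofAdd m) * f)⁻¹ :
        (FunField Y)ˣ) ∈ H0 (0 : CaDiv Y) := by
      rw [mul_mem_H0_iff, h3, add_zero]
      exact one_mem_H0_zero
    rw [coxPiece, ← comb_apply, map_zero, ← map_inv₀, ← hfs, ← Units.val_mul, mul_comm f,
      ← Units.val_inv_eq_inv_val]
    rwa [one_mul] at h4

end IsBlowUpModel

end Regrading

/-! ### Projective varieties -/

section Projective

instance (n : ℕ) : Algebra.FiniteType (MvPolynomial.homogeneousSubmodule (Fin (n + 1)) ℂ 0)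
    (MvPolynomial (Fin (n + 1)) ℂ) :=
  have : IsScalarTower ℂ (MvPolynomial.homogeneousSubmodule (Fin (n + 1)) ℂ 0)
      (MvPolynomial (Fin (n + 1)) ℂ) :=
    ⟨fun c a f => smul_mul_assoc c (a : MvPolynomial (Fin (n + 1)) ℂ) f⟩
  Algebra.FiniteType.of_restrictScalars_finiteType ℂ _ _

theorem isNoetherianRing_homogeneousSubmodule_zero (n : ℕ) :
    IsNoetherianRing (MvPolynomial.homogeneousSubmodule (Fin (n + 1)) ℂ 0) := by
  refine isNoetherianRing_of_surjective ℂ _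
    (algebraMap ℂ (MvPolynomial.homogeneousSubmodule (Fin (n + 1)) ℂ 0)) ?_
  rintro ⟨f, hf⟩
  rw [MvPolynomial.mem_homogeneousSubmodule, ← MvPolynomial.totalDegree_zero_iff_isHomogeneous,
    MvPolynomial.totalDegree_eq_zero_iff_eq_C] at hf
  exact ⟨_, Subtype.ext hf.symm⟩

theorem IsProjective.isNoetherian {X : Scheme.{0}} {s : X ⟶ Spec (.of ℂ)} (h : IsProjective s) :
    IsNoetherian X := by
  obtain ⟨n, i, hi, -⟩ := h
  let 𝒜 := MvPolynomial.homogeneousSubmodule (Fin (n + 1)) ℂ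
  have := isNoetherianRing_homogeneousSubmodule_zero n
  have : IsNoetherianRing (CommRingCat.of (𝒜 0)) := this
  let i' : X ⟶ Proj 𝒜 := i
  have : IsClosedImmersion i' := hi
  let f := i' ≫ Proj.toSpecZero 𝒜
  have h1 : IsLocallyNoetherian X := LocallyOfFiniteType.isLocallyNoetherian f
  have h2 : CompactSpace X := QuasiCompact.compactSpace_of_compactSpace f
  exact {}

/-- The residue field contains `ℂ`, which provides the points where forms do not vanish. -/
theorem infinite_residueField {X : Scheme.{0}} (s : X ⟶ Spec (.of ℂ)) (x : X) :
    Infinite (IsLocalRing.ResidueField (X.presheaf.stalk x)) := by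
  let f : ℂ →+* IsLocalRing.ResidueField (X.presheaf.stalk x) :=
    (IsLocalRing.residue _).comp
      ((Scheme.ΓSpecIso (.of ℂ)).inv ≫ s.appTop ≫ X.presheaf.germ ⊤ x trivial).hom
  exact Infinite.of_injective f f.injective

/-- The length of a regular system is at least the dimension; the index `n + 2` carries the
dimension hypothesis from here on. -/
theorem exists_isRegularSystem_add_two {A : Type*} [CommRing A] [IsRegularLocalRing A]
    (h : 2 ≤ ringKrullDim A) : ∃ (n : ℕ) (x : Fin (n + 2) → A), IsRegularSystem x := by
  obtain ⟨n, x, hx⟩ := IsRegularLocalRing.exists_isRegularSystem A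
  have h1 : ringKrullDim A ≤ n := by
    refine (ringKrullDim_le_spanFinrank_maximalIdeal A).trans ?_
    rw [← hx.span_eq]
    have h2 := Submodule.spanFinrank_span_le_ncard_of_finite (R := A) (Set.finite_range x)
    have h3 : (Set.range x).ncard ≤ n := by
      rw [← Set.image_univ]
      refine (Set.ncard_image_le Set.finite_univ).trans ?_
      simp [Set.ncard_univ]
    exact_mod_cast h2.trans h3
  have h4 : 2 ≤ n := by exact_mod_cast h.trans h1
  obtain ⟨k, rfl⟩ := Nat.exists_eq_add_of_le' h4
  exact ⟨k, x, hx⟩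

end Projective

end CoxRing

end

open CoxRing in
theorem proposition3p1
    {X X' : Scheme.{0}} [IsIntegral X] [IsIntegral X']
    -- `X'` is a projective variety over `ℂ` of dimension at least 2, and `p` is a smooth point of it
    (s : X' ⟶ Spec (.of ℂ)) (hX' : IsProjective s)
    (p : X') (hp : IsSmoothPoint X' p) (hdim : 2 ≤ ringKrullDim (X'.presheaf.stalk p))
    -- `π` is the blow-up of `p`
    (π : X ⟶ X') (hπ : IsBlowUp (pointIdeal p hp.isClosed) π)
    -- the bases of the Picard groups that define the Cox rings
    {r r' : ℕ} (D : Fin r → CaDiv X) (hD : FreelyGeneratesPic D)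
    (D' : Fin r' → CaDiv X') (hD' : FreelyGeneratesPic D')
    -- the section `x_E` with divisor `E`, in the degree `m` of the class of `E`
    (m : Fin r → ℤ) (xE : H0 (∑ i, m i • D i))
    (hxE : HasZeroDivisor xE (exceptionalDivisor hπ)) :
    Nonempty (Localization.Away (Cox.ofSection D m xE) ≃+* LaurentPolynomial (Cox D')) := by
  have := hX'.isNoetherian
  have := infinite_residueField s p
  have := hp.isRegular
  obtain ⟨n, x, hx⟩ := exists_isRegularSystem_add_two hdim
  obtain ⟨φ, v, η, M⟩ := hπ.exists_isBlowUpModel hx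
  exact M.nonempty_cox_equiv hπ.isInvertible hp.isClosed hx hD hD' m xE hxE
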